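/- **Theorem 1.7.** Let $\alpha>-1$ and $1\le p\le\infty$, let $1\le q\le\infty$ satisfy $\frac1p+\frac1q=1$ (with $\frac1\infty=0$), and put $c_\alpha=\Gamma(\alpha/2+1)^2/\Gamma(1+\alpha)$. For $f\in L^p(\mathbb T)$ (complex valued, with $\|f\|_p$ the $L^p$ norm with respect to $\frac{dt}{2\pi}$) let $u=P_\alpha[f]$ be the $\alpha$-harmonic function $$u(z)=\frac1{2\pi}\int_0^{2\pi}K_\alpha(ze^{-it})f(e^{it})\,dt,\qquad K_\alpha(z)=c_\alpha\frac{(1-|z|^2)^{\alpha+1}}{|1-z|^{\alpha+2}},\qquad |z|<1 .$$ Let $F$ be the Gauss hypergeometric function, $\mathrm B$ the Euler Beta function, and for $0\le r<1$ put $$I_{11}=\int_0^{2\pi}\frac{|\cos s|^q\,ds}{|1+re^{-is}|^{2-(2+\alpha)q}},\quad I_{12}=\int_0^{2\pi}\frac{ds}{|1+re^{-is}|^{2-(2+\alpha)q}},\quad G(r,\theta)=\int_{-\pi}^{\pi}|\cos(t-\theta)|^q(1+r^2+2r\cos t)^{\frac{(2+\alpha)q-2}2}dt .$$ For $p>1$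 define $$A_{\alpha,p}(r)=c_\alpha\Big(\tfrac{(\alpha+2)^q}{2\pi}I_{11}+\tfrac{q(|\alpha|r+\alpha+2)^{q-1}|\alpha|r}{2\pi}I_{12}\Big)^{1/q},$$ $$B_{\alpha,p}(r)=\tfrac{(\alpha+2)c_\alpha}{\pi^{1/q}}\,r\Big(\mathrm B\big(\tfrac{q+1}2,\tfrac12\big)F\big(1-\tfrac{(\alpha+3)q}2,1-\tfrac{(\alpha+2)q}2;1+\tfrac q2;r^2\big)\Big)^{1/q},$$ $$C_{\alpha,p}(r)=c_\alpha\big(\tfrac{|\alpha|r}2+1+\tfrac\alpha2\big)\big(\tfrac1{2\pi}I_{12}\big)^{1/q},\qquad C_{\alpha,p}=c_\alpha\big(\tfrac{|\alpha|}2+1+\tfrac\alpha2\big)\Big(\tfrac{\Gamma((\alpha+2)q-1)}{\Gamma((\alpha+2)q/2)^2}\Big)^{1/q},$$ let $B_{\alpha,p}$ (used when $\alpha+\frac2p\ge0$) be the expression for $B_{\alpha,p}(r)$ with $r=1$, and for $\theta\in\mathbb R$ let $$\widehat A_{\alpha,p}(\theta)=c_\alpha\Big(\tfrac{(\alpha+2)^q}{2\pi}G(1,\theta)+q(|\alpha|+\alpha+2)^{q-1}|\alpha|\tfrac{\Gamma((\alpha+2)q-1)}{\Gamma((\alpha+2)q/2)^2}\Big)^{1/q}.$$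 For $p=1$ (so $q=\infty$) these quantities are the limits of the formulas as $q\to\infty$: $A_{\alpha,1}(r)=c_\alpha(|\alpha|r+\alpha+2)(1+r)^{\alpha+2}$, $B_{\alpha,1}(r)=(\alpha+2)c_\alpha r\sup_s|\sin s|\,|1+re^{-is}|^{\alpha+2}$, $C_{\alpha,1}(r)=c_\alpha(\frac{|\alpha|r}2+1+\frac\alpha2)(1+r)^{\alpha+2}$, and $B_{\alpha,1}$, $C_{\alpha,1}$ are the last two expressions at $r=1$. Finally let $A_{\alpha,p}=\sup_{0\le r<1}A_{\alpha,p}(r)$. Then $u$ is (real) differentiable in the unit disc and, at every $z=re^{i\theta}$ with $0\le r<1$: (1) $A_{\alpha,p}<\infty$ and $$|u_r|\le\frac{A_{\alpha,p}(r)}{(1-r^2)^{1+1/p}}\|f\|_p\le\frac{A_{\alpha,p}}{(1-r^2)^{1+1/p}}\|f\|_p .$$ For $p=1$, $A_{\alpha,1}=c_\alpha(|\alpha|+\alpha+2)2^{\alpha+2}$. For $p>1$: $A_{\alpha,p}=\widehat A_{\alpha,p}(0)$ if $(2+\alpha)q>4$, and $A_{\alpha,p}\le\widehat A_{\alpha,p}(\frac\pi2)$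 if $2\le(2+\alpha)q\le4$. The constant $A_{\alpha,p}$ is asymptotically sharp as $\alpha\to0$. (2) $$|u_\theta|\le\frac{B_{\alpha,p}(r)}{(1-r^2)^{1+1/p}}\|f\|_p .$$ If $\alpha+\frac2p\ge0$, then $B_{\alpha,p}=\sup_{0\le r<1}B_{\alpha,p}(r)$ (finite), hence $|u_\theta|\le\frac{B_{\alpha,p}}{(1-r^2)^{1+1/p}}\|f\|_p$, and the constant $B_{\alpha,p}$ is sharp here. (3) $C_{\alpha,p}=\sup_{0\le r<1}C_{\alpha,p}(r)$ (finite) and $$|u_z|,\ |u_{\bar z}|\le\frac{C_{\alpha,p}(r)}{(1-r^2)^{1+1/p}}\|f\|_p\le\frac{C_{\alpha,p}}{(1-r^2)^{1+1/p}}\|f\|_p .$$ The constant $C_{\alpha,p}$ is asymptotically sharp as $\alpha\to0$, in the estimate of $|u_z|$ and in that of $|u_{\bar z}|$. Here a constant is *sharp* in one of these inequalities if it is the smallest constant (for the given $\alpha,p$) for which the inequality holds for all $f\in L^p(\mathbb T)$ and all $z$ in the disc. It is *asymptotically sharp as $\alpha\to0$* if it is sharp for $\alpha=0$ and, for fixed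 $p$, its ratio to the smallest such constant tends to $1$ as $\alpha\to0$. -/

import Mathlib

open MeasureTheory Set Filter Topology
open scoped ENNReal

noncomputable section

namespace AlphaHarmonic

/-! ### The Poisson type integral -/

/-- The normalized arc length measure `dt / (2π)` in the angle variable `t ∈ (0, 2π]`. -/
def angleMeasure : Measure ℝ :=
  (ENNReal.ofReal (2 * Real.pi))⁻¹ • (volume.restrict (Ioc (0 : ℝ) (2 * Real.pi)))

/-- `f ∈ L^p(𝕋)`, in terms of `t ↦ f(e^{it})`. -/
def MemLpT (f : Circle → ℂ) (p : ℝ≥0∞) : Prop :=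
  MemLp (fun t : ℝ => f (Circle.exp t)) p angleMeasure

/-- `‖f‖_{L^p(𝕋)}` with respect to `dt / (2π)` (the essential supremum if `p = ∞`). -/
def normLpT (f : Circle → ℂ) (p : ℝ≥0∞) : ℝ :=
  (eLpNorm (fun t : ℝ => f (Circle.exp t)) p angleMeasure).toReal

/-- `c_α = Γ(α/2 + 1)² / Γ(1 + α)`. -/
def c (α : ℝ) : ℝ := Real.Gamma (α / 2 + 1) ^ 2 / Real.Gamma (1 + α)

/-- The kernel `K_α(z) = c_α (1 - |z|²)^{α+1} / |1 - z|^{α+2}`. -/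
def K (α : ℝ) (z : ℂ) : ℝ :=
  c α * ((1 - ‖z‖ ^ 2) ^ (α + 1) / ‖1 - z‖ ^ (α + 2))

/-- `P_α[f](z) = (1/2π) ∫_0^{2π} K_α(z e^{-it}) f(e^{it}) dt`. -/
def P (α : ℝ) (f : Circle → ℂ) (z : ℂ) : ℂ :=
  ∫ t : ℝ, (K α (z * Complex.exp (-(t * Complex.I))) : ℂ) * f (Circle.exp t) ∂angleMeasure

/-! ### First order derivatives at `z = r e^{iθ}` -/

/-- The point `r e^{iθ}`. -/
def polar (r θ : ℝ) : ℂ := r * Complex.exp (θ * Complex.I)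

/-- `u_r`. -/
def dR (u : ℂ → ℂ) (r θ : ℝ) : ℂ := deriv (fun ρ : ℝ => u (polar ρ θ)) r

/-- `u_θ`. -/
def dTheta (u : ℂ → ℂ) (r θ : ℝ) : ℂ := deriv (fun φ : ℝ => u (polar r φ)) θ

/-- `u_z = (u_x - i u_y) / 2`. -/
def dZ (u : ℂ → ℂ) (r θ : ℝ) : ℂ :=
  (fderiv ℝ u (polar r θ) 1 - Complex.I * fderiv ℝ u (polar r θ) Complex.I) / 2

/-- `u_{z̄} = (u_x + i u_y) / 2`. -/
def dZbar (u : ℂ → ℂ) (r θ : ℝ) : ℂ :=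
  (fderiv ℝ u (polar r θ) 1 + Complex.I * fderiv ℝ u (polar r θ) Complex.I) / 2

/-! ### The bounding functions and constants

For `1 < p ≤ ∞` the formulas involve the finite conjugate exponent `q`.  For `p = 1` one has
`q = ∞`, and each expression is replaced by its limit as `q → ∞`. -/

/-- The exponent `q` with `1/p + 1/q = 1`, as a real number (used for `1 < p ≤ ∞` only). -/
def conjExp (p : ℝ≥0∞) : ℝ := (ENNReal.conjExponent p).toReal

/-- The exponent `1 + 1/p` (equal to `1` if `p = ∞`). -/
def growthExp (p : ℝ≥0∞) : ℝ := 1 + (p⁻¹).toReal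

/-- `|1 + r e^{-is}|`. -/
def w (r s : ℝ) : ℝ := ‖1 + r * Complex.exp (-(s * Complex.I))‖

/-- `I₁₁ = ∫_0^{2π} |cos s|^q / |1 + r e^{-is}|^{2 - (2+α)q} ds`. -/
def I11 (α q r : ℝ) : ℝ :=
  ∫ s in (0 : ℝ)..2 * Real.pi, |Real.cos s| ^ q / w r s ^ (2 - (2 + α) * q)

/-- `I₁₂ = ∫_0^{2π} 1 / |1 + r e^{-is}|^{2 - (2+α)q} ds`. -/
def I12 (α q r : ℝ) : ℝ :=
  ∫ s in (0 : ℝ)..2 * Real.pi, 1 / w r s ^ (2 - (2 + α) * q)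

/-- `A_{α,p}(r)`. -/
def A (α : ℝ) (p : ℝ≥0∞) (r : ℝ) : ℝ :=
  if p = 1 then c α * ((|α| * r + α + 2) * (1 + r) ^ (α + 2))
  else
    let q := conjExp p
    c α * ((α + 2) ^ q / (2 * Real.pi) * I11 α q r
      + q * (|α| * r + α + 2) ^ (q - 1) * |α| * r / (2 * Real.pi) * I12 α q r) ^ (1 / q)

/-- `A_{α,p} = sup_{0 ≤ r < 1} A_{α,p}(r)`. -/
def AConst (α : ℝ) (p : ℝ≥0∞) : ℝ := sSup (A α p '' Ico 0 1)

/-- `G(r, θ) = ∫_{-π}^{π} |cos(t - θ)|^k (1 + r² + 2 r cos t)^m dt`. -/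
def G (k m r θ : ℝ) : ℝ :=
  ∫ t in -Real.pi..Real.pi,
    |Real.cos (t - θ)| ^ k * (1 + r ^ 2 + 2 * r * Real.cos t) ^ m

/-- The closed expression
`c_α ((α+2)^q/(2π) G(1,θ) + q(|α|+α+2)^{q-1}|α| Γ((α+2)q-1)/Γ((α+2)q/2)²)^{1/q}`,
where `G` has the parameters `k = q` and `m = ((2+α)q-2)/2`. -/
def AClosed (α : ℝ) (p : ℝ≥0∞) (θ : ℝ) : ℝ :=
  let q := conjExp p
  c α * ((α + 2) ^ q / (2 * Real.pi) * G q (((2 + α) * q - 2) / 2) 1 θ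
    + q * (|α| + α + 2) ^ (q - 1) * |α|
      * (Real.Gamma ((α + 2) * q - 1) / Real.Gamma ((α + 2) * q / 2) ^ 2)) ^ (1 / q)

/-- `B_{α,p}(r)`, with the Euler Beta function and the Gauss hypergeometric function. -/
def B (α : ℝ) (p : ℝ≥0∞) (r : ℝ) : ℝ :=
  if p = 1 then (α + 2) * c α * r * ⨆ s : ℝ, |Real.sin s| * w r s ^ (α + 2)
  else
    let q := conjExp p
    (α + 2) * c α / Real.pi ^ (1 / q) * r *
      (ProbabilityTheory.beta ((q + 1) / 2) (1 / 2) *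
        ordinaryHypergeometric (1 - (α + 3) * q / 2) (1 - (α + 2) * q / 2) (1 + q / 2) (r ^ 2))
          ^ (1 / q)

/-- `B_{α,p}`, the value of the expression for `B_{α,p}(r)` at `r = 1`. -/
def BConst (α : ℝ) (p : ℝ≥0∞) : ℝ :=
  if p = 1 then (α + 2) * c α * ⨆ s : ℝ, |Real.sin s| * w 1 s ^ (α + 2)
  else
    let q := conjExp p
    (α + 2) * c α / Real.pi ^ (1 / q) *
      (ProbabilityTheory.beta ((q + 1) / 2) (1 / 2) *
        ordinaryHypergeometric (1 - (α + 3) * q / 2) (1 - (α + 2) * q / 2) (1 + q / 2) (1 : ℝ))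
          ^ (1 / q)

/-- `C_{α,p}(r)`. -/
def C (α : ℝ) (p : ℝ≥0∞) (r : ℝ) : ℝ :=
  if p = 1 then c α * (|α| * r / 2 + 1 + α / 2) * (1 + r) ^ (α + 2)
  else
    let q := conjExp p
    c α * (|α| * r / 2 + 1 + α / 2) * (1 / (2 * Real.pi) * I12 α q r) ^ (1 / q)

/-- `C_{α,p}`. -/
def CConst (α : ℝ) (p : ℝ≥0∞) : ℝ :=
  if p = 1 then c α * (|α| / 2 + 1 + α / 2) * 2 ^ (α + 2)
  else
    let q := conjExp p
    c α * (|α| / 2 + 1 + α / 2) *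
      (Real.Gamma ((α + 2) * q - 1) / Real.Gamma ((α + 2) * q / 2) ^ 2) ^ (1 / q)

/-! ### Sharpness -/

/-- The constants `M` for which `|D u(r e^{iθ})| ≤ M (1 - r²)^{-(1+1/p)} ‖f‖_p` holds for all
`u = P_α[f]` with `f ∈ L^p(𝕋)` and all points of the disc; `D` is a first order derivative. -/
def Admissible (D : (ℂ → ℂ) → ℝ → ℝ → ℂ) (α : ℝ) (p : ℝ≥0∞) : Set ℝ :=
  {M | ∀ f : Circle → ℂ, MemLpT f p → ∀ r ∈ Ico (0 : ℝ) 1, ∀ θ : ℝ,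
    ‖D (P α f) r θ‖ ≤ M / (1 - r ^ 2) ^ growthExp p * normLpT f p}

/-- `M` is sharp: it is the smallest admissible constant. -/
def IsSharp (D : (ℂ → ℂ) → ℝ → ℝ → ℂ) (α : ℝ) (p : ℝ≥0∞) (M : ℝ) : Prop :=
  IsLeast (Admissible D α p) M

/-- `M α` is asymptotically sharp as `α → 0`: it is sharp for `α = 0`, and the ratio of `M α` to the
best constant tends to `1` as `α → 0`. -/
def IsAsymptoticallySharp (D : (ℂ → ℂ) → ℝ → ℝ → ℂ) (p : ℝ≥0∞) (M : ℝ → ℝ) : Prop :=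
  IsSharp D 0 p (M 0) ∧
  ∀ ε > 0, ∀ᶠ α in 𝓝 (0 : ℝ),
    M α ∈ Admissible D α p ∧ ∀ N ∈ Admissible D α p, M α ≤ (1 + ε) * N

end AlphaHarmonic

end

noncomputable section

namespace AlphaHarmonic

/-! Fix r. Differentiating under the integral sign, every first order derivative of u at r e^{iθ}
is, up to a unimodular factor, the convolution of f with a kernel built from one function H(τ) =
e^{iτ} ∂_zK_α(r e^{iτ}): 2 Re H for u_r, -2r Im H for u_θ, and H and its conjugate for the Wirtinger
derivatives (`dR_P_eq`, `dTheta_P_eq`, `dZ_P_eq`, `dZbar_P_eq`). By Hölder's inequality and its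
converse (`norm_conv_le`, `rpow_norm_le_of_conv_le`, and `norm_le_of_conv_le` for p = 1) the best
constant at radius r is the L^q norm of the kernel. Everything reduces to computing or estimating
these norms.

The substitution e^{is} = (e^{iτ} - r)/(1 - r e^{iτ}) makes the kernels transparent. By `H_eq`, H is
c_α/2 · w^{α+2} (1-r²)^{-2} times (α+2)e^{is} - αr, where w = |1 + r e^{is}|. The Jacobian
contributes w^{-2}(1-r²), whence the factor (1-r²)^{-(1+1/p)} and a weighted norm of the real part,
imaginary part or modulus of (α+2)e^{is} - αr (`IsMobiusKernel.norm_eq_weightedNorm`,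
`HasMobiusKernel.isSharp`).

Angular derivative: the imaginary part is exactly (α+2) sin s, so nothing is lost and the constant
is sharp. The mean of (sin t)^q |1+re^{it}|^{2m} satisfies the same second order equation as a Gauss
hypergeometric function of r². The singularity at 0 forces their Wronskian to vanish
(`sinMean_wronskian`, `sinMean_eq_hypergeometric`). The same equation in divergence form gives
monotonicity in r (`sinMeanAux_nonneg`), and Abel's theorem gives the value at r = 1.

Wirtinger derivatives: the modulus of (α+2)e^{is} - αr lies between α+2-|α|r and α+2+|α|r. The upper
bound yields C, and the lower bound shows that little is lost as α → 0
(`isAsymptoticallySharp_wirtinger`).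

Radial derivative: Bernoulli's inequality replaces |(α+2)cos s - αr|^q by |(α+2)cos s|^q with an
error proportional to |α|. The inequality works in both directions, giving both the estimate by A
and its asymptotic sharpness (`weightedNorm_radial_le`, `A_le_weightedNorm_add`). The mean with
|cos|^q increases in r when |1+re^{it}|^{2m} is convex in r (`monotoneOn_I11`). For 0 ≤ m ≤ 1 it is
at most the mean with |sin|^q (`integral_cos_le_integral_sin`), which increases by the differential
equation. -/

/-! ### The gradient of the kernel. -/

/-- The Wirtinger derivative `∂K_α/∂z`. -/
def Kz (α : ℝ) (z : ℂ) : ℂ :=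
  ((c α * ((1 - ‖z‖ ^ 2) ^ α * (‖1 - z‖ ^ (α + 2))⁻¹) : ℝ) : ℂ) *
    (-((α / 2 : ℝ) : ℂ) * (starRingEnd ℂ) z
      + (((α + 2) / 2 : ℝ) : ℂ) * ((1 - (starRingEnd ℂ) z) / (1 - z)))

/-- The real linear form `v ↦ 2 Re (k v)`. -/
def twoReMul (k : ℂ) : ℂ →L[ℝ] ℝ :=
  (2 : ℝ) • Complex.reCLM.comp (ContinuousLinearMap.mul ℝ ℂ k)

@[simp] lemma twoReMul_apply (k v : ℂ) : twoReMul k v = 2 * (k * v).re := by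
  simp [twoReMul]

lemma continuous_twoReMul : Continuous twoReMul := by
  unfold twoReMul
  fun_prop

lemma norm_twoReMul_le (k : ℂ) : ‖twoReMul k‖ ≤ 2 * ‖k‖ := by
  refine ContinuousLinearMap.opNorm_le_bound _ (by positivity) fun v => ?_
  rw [twoReMul_apply, Real.norm_eq_abs, abs_mul, abs_two, mul_assoc]
  gcongr
  exact (Complex.abs_re_le_norm _).trans (norm_mul_le _ _)

lemma one_sub_normSq_pos {z : ℂ} (hz : ‖z‖ < 1) : 0 < 1 - ‖z‖ ^ 2 := by
  nlinarith [norm_nonneg z]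

lemma one_sub_ne_zero {z : ℂ} (hz : ‖z‖ < 1) : 1 - z ≠ 0 := by
  intro h
  have : z = 1 := (sub_eq_zero.1 h).symm
  simp [this] at hz

lemma norm_one_sub_pos {z : ℂ} (hz : ‖z‖ < 1) : 0 < ‖1 - z‖ :=
  norm_pos_iff.2 (one_sub_ne_zero hz)

/-- The kernel is a product of real powers of 1-|z|² and |1-z|², both smooth and positive in the
disc. Since it is real valued, its differential is twice the real part of multiplication by the
Wirtinger derivative. -/
lemma hasFDerivAt_K (α : ℝ) {z : ℂ} (hz : ‖z‖ < 1) :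
    HasFDerivAt (K α) (twoReMul (Kz α z)) z := by
  have hA := one_sub_normSq_pos hz
  have hB := norm_one_sub_pos hz
  have h1 : HasFDerivAt (fun z : ℂ => 1 - ‖z‖ ^ 2) (-(2 • innerSL ℝ z)) z :=
    (hasStrictFDerivAt_norm_sq z).hasFDerivAt.const_sub 1
  have h2 : HasFDerivAt (fun z : ℂ => ‖1 - z‖ ^ 2)
      ((2 • innerSL ℝ (1 - z)).comp (-ContinuousLinearMap.id ℝ ℂ)) z :=
    (hasStrictFDerivAt_norm_sq (1 - z)).hasFDerivAt.comp z ((hasFDerivAt_id z).const_sub 1)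
  have h1' := h1.rpow_const (p := α + 1) (Or.inl hA.ne')
  have h2' := h2.rpow_const (p := -((α + 2) / 2)) (Or.inl (by positivity))
  have h3 := (h1'.mul h2').const_mul (c α)
  have hK : K α = fun z : ℂ =>
      c α * ((1 - ‖z‖ ^ 2) ^ (α + 1) * (‖1 - z‖ ^ 2) ^ (-((α + 2) / 2))) := by
    funext y
    rw [K, div_eq_mul_inv, ← Real.rpow_neg (norm_nonneg _), ← Real.rpow_natCast,
      ← Real.rpow_natCast, ← Real.rpow_mul (norm_nonneg (1 - y))]
    congr 4
    push_cast
    ring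
  rw [hK]
  refine h3.congr_fderiv ?_
  have e1 : (‖1 - z‖ ^ 2) ^ (-((α + 2) / 2)) = (‖1 - z‖ ^ (α + 2))⁻¹ := by
    rw [← Real.rpow_natCast, ← Real.rpow_mul (norm_nonneg (1 - z)),
      ← Real.rpow_neg (norm_nonneg _)]
    congr 1
    push_cast
    ring
  have e2 : (‖1 - z‖ ^ 2) ^ (-((α + 2) / 2) - 1) =
      (‖1 - z‖ ^ (α + 2))⁻¹ * (‖1 - z‖ ^ 2)⁻¹ := by
    rw [Real.rpow_sub_one (by positivity), e1, div_eq_mul_inv]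
  have e3 : (1 - ‖z‖ ^ 2) ^ (α + 1) = (1 - ‖z‖ ^ 2) ^ α * (1 - ‖z‖ ^ 2) :=
    Real.rpow_add_one hA.ne' _
  have e4 : (1 - ‖z‖ ^ 2) ^ (α + 1 - 1) = (1 - ‖z‖ ^ 2) ^ α := by congr 1; ring
  have hz1 : ‖1 - z‖ ^ 2 = (1 - z.re) ^ 2 + z.im ^ 2 := by
    rw [← Complex.normSq_eq_norm_sq, Complex.normSq_apply]; simp; ring
  have hz2 : ‖z‖ ^ 2 = z.re ^ 2 + z.im ^ 2 := by
    rw [← Complex.normSq_eq_norm_sq, Complex.normSq_apply]; ring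
  have hne : (1 - z.re) ^ 2 + z.im ^ 2 ≠ 0 := by rw [← hz1]; positivity
  have hdiv : (1 - (starRingEnd ℂ) z) / (1 - z) =
      (((1 - (starRingEnd ℂ) z) * (1 - (starRingEnd ℂ) z)) : ℂ) *
        (((((1 - z.re) ^ 2 + z.im ^ 2)⁻¹ : ℝ)) : ℂ) := by
    have h0 := one_sub_ne_zero hz
    have h0' : (((((1 - z.re) ^ 2 + z.im ^ 2) : ℝ)) : ℂ) =
        (1 - z) * (1 - (starRingEnd ℂ) z) := by
      rw [← hz1, ← Complex.normSq_eq_norm_sq, Complex.normSq_eq_conj_mul_self]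
      simp [mul_comm]
    have h00 : 1 - (starRingEnd ℂ) z ≠ 0 := by
      intro h; apply h0; have := congrArg (starRingEnd ℂ) h; simpa using this
    rw [Complex.ofReal_inv, h0']
    field_simp
  have hE := mul_inv_cancel₀ hne
  rw [e1, e2, e3, e4, hz1]
  ext v
  simp only [twoReMul_apply, Kz, _root_.smul_apply, _root_.add_apply,
    _root_.neg_apply, ContinuousLinearMap.comp_apply,
    ContinuousLinearMap.id_apply, innerSL_apply_apply, Complex.inner, hdiv, smul_eq_mul,
    nsmul_eq_mul]
  -- With the powers and the inverse as free variables, only a polynomial identity in real and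
  -- imaginary parts remains, modulo E |1-z|² = 1.
  generalize ((1 - z.re) ^ 2 + z.im ^ 2)⁻¹ = E at hE ⊢
  generalize (‖1 - z‖ ^ (α + 2))⁻¹ = X
  generalize (1 - ‖z‖ ^ 2) ^ α = Y
  rw [hz2]
  simp only [Complex.mul_re, Complex.mul_im, Complex.add_re, Complex.add_im, Complex.sub_re,
    Complex.sub_im, Complex.neg_re, Complex.neg_im, Complex.conj_re, Complex.conj_im,
    Complex.ofReal_re, Complex.ofReal_im, Complex.one_re, Complex.one_im, Nat.cast_ofNat]
  linear_combination (c α * X * Y * (α + 2) * (z.re * v.re + z.im * v.im)) * hE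

lemma continuousOn_Kz (α : ℝ) : ContinuousOn (Kz α) (Metric.ball 0 1) := by
  unfold Kz
  have h1 : ∀ z ∈ Metric.ball (0 : ℂ) 1, 1 - ‖z‖ ^ 2 ≠ 0 := fun z hz =>
    (one_sub_normSq_pos (by simpa using hz)).ne'
  have h2 : ∀ z ∈ Metric.ball (0 : ℂ) 1, ‖1 - z‖ ≠ 0 := fun z hz =>
    (norm_one_sub_pos (by simpa using hz)).ne'
  have h3 : ∀ z ∈ Metric.ball (0 : ℂ) 1, 1 - z ≠ 0 := fun z hz =>
    one_sub_ne_zero (by simpa using hz)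
  have h4 : ∀ z ∈ Metric.ball (0 : ℂ) 1, ‖1 - z‖ ^ (α + 2) ≠ 0 := fun z hz =>
    (Real.rpow_pos_of_pos (norm_one_sub_pos (by simpa using hz)) _).ne'
  refine ContinuousOn.mul ?_ ?_
  · refine Complex.continuous_ofReal.comp_continuousOn ?_
    refine continuousOn_const.mul (ContinuousOn.mul ?_ ?_)
    · exact ContinuousOn.rpow_const (by fun_prop) fun z hz => Or.inl (h1 z hz)
    · refine ContinuousOn.inv₀ ?_ h4
      exact ContinuousOn.rpow_const (by fun_prop) fun z hz => Or.inl (h2 z hz)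
  · refine ContinuousOn.add (by fun_prop) (ContinuousOn.mul (by fun_prop) ?_)
    exact ContinuousOn.div (by fun_prop) (by fun_prop) h3

/-! ### Differentiation of the Poisson type integral. -/

instance isFiniteMeasure_angleMeasure : IsFiniteMeasure angleMeasure := by
  unfold angleMeasure
  refine Measure.smul_finite _ ?_
  simp [Real.pi_pos]

/-- The rotation `e^{-it}`. -/
def rot (t : ℝ) : ℂ := Complex.exp (-(t * Complex.I))

@[simp] lemma norm_rot (t : ℝ) : ‖rot t‖ = 1 := by
  rw [rot, ← neg_mul, ← Complex.ofReal_neg, Complex.norm_exp_ofReal_mul_I]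

lemma continuous_rot : Continuous rot := by unfold rot; fun_prop

/-- The derivative of the integrand of `P_α[f]`. -/
def PDeriv (α : ℝ) (f : Circle → ℂ) (z : ℂ) (t : ℝ) : ℂ →L[ℝ] ℂ :=
  (twoReMul (Kz α (z * rot t) * rot t)).smulRight (f (Circle.exp t))

lemma mul_rot_mem {z : ℂ} {ρ : ℝ} (hz : ‖z‖ < ρ) (t : ℝ) : ‖z * rot t‖ < ρ := by simpa

lemma continuous_Kz_rot (α : ℝ) {z : ℂ} (hz : ‖z‖ < 1) :
    Continuous fun t => Kz α (z * rot t) * rot t :=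
  ((continuousOn_Kz α).comp_continuous (continuous_const.mul continuous_rot)
    (fun t => by simpa using hz)).mul continuous_rot

lemma aestronglyMeasurable_PDeriv (α : ℝ) {f : Circle → ℂ}
    (hf : Integrable (fun t : ℝ => f (Circle.exp t)) angleMeasure) {z : ℂ} (hz : ‖z‖ < 1) :
    AEStronglyMeasurable (PDeriv α f z) angleMeasure := by
  have h1 : AEStronglyMeasurable (fun t => twoReMul (Kz α (z * rot t) * rot t)) angleMeasure :=
    (continuous_twoReMul.comp (continuous_Kz_rot α hz)).aestronglyMeasurable
  exact (ContinuousLinearMap.smulRightL ℝ ℂ ℂ).continuous₂.comp_aestronglyMeasurable₂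
    h1 hf.aestronglyMeasurable

/-- Rotations preserve the closed disc of radius ρ, so compactness gives one bound for all t; this
is the integrable majorant for differentiating under the integral. -/
lemma exists_norm_PDeriv_le (α : ℝ) (f : Circle → ℂ) {ρ : ℝ} (hρ : ρ < 1) :
    ∃ C : ℝ, ∀ z : ℂ, ‖z‖ ≤ ρ → ∀ t, ‖PDeriv α f z t‖ ≤ C * ‖f (Circle.exp t)‖ := by
  obtain ⟨C, hC⟩ := (isCompact_closedBall (0 : ℂ) ρ).exists_bound_of_continuousOn
    ((continuousOn_Kz α).mono (Metric.closedBall_subset_ball hρ))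
  refine ⟨2 * C, fun z hz t => ?_⟩
  rw [PDeriv, ContinuousLinearMap.norm_smulRight_apply]
  gcongr
  refine (norm_twoReMul_le _).trans ?_
  rw [norm_mul, norm_rot, mul_one]
  gcongr
  exact hC _ (by simpa using hz)

lemma integrable_PDeriv (α : ℝ) {f : Circle → ℂ}
    (hf : Integrable (fun t : ℝ => f (Circle.exp t)) angleMeasure) {z : ℂ} (hz : ‖z‖ < 1) :
    Integrable (PDeriv α f z) angleMeasure := by
  obtain ⟨C, hC⟩ := exists_norm_PDeriv_le α f hz
  exact (hf.norm.const_mul C).mono' (aestronglyMeasurable_PDeriv α hf hz)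
    (Eventually.of_forall fun t => hC z le_rfl t)

lemma continuous_K_rot (α : ℝ) {z : ℂ} (hz : ‖z‖ < 1) :
    Continuous fun t => K α (z * rot t) := by
  refine continuous_iff_continuousAt.2 fun t => ?_
  exact ContinuousAt.comp (f := fun t => z * rot t)
    (hasFDerivAt_K α (mul_rot_mem hz t)).continuousAt
    (continuous_const.mul continuous_rot).continuousAt

lemma hasFDerivAt_P (α : ℝ) {f : Circle → ℂ}
    (hf : Integrable (fun t : ℝ => f (Circle.exp t)) angleMeasure) {z : ℂ} (hz : ‖z‖ < 1) :
    HasFDerivAt (P α f) (∫ t, PDeriv α f z t ∂angleMeasure) z := by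
  -- The kernel is unbounded near the unit circle, so the domination takes place on a smaller disc
  -- around 0 containing z.
  obtain ⟨ρ, hzρ, hρ⟩ := exists_between hz
  obtain ⟨C, hC⟩ := exists_norm_PDeriv_le α f hρ
  have hmem : ∀ y ∈ Metric.ball (0 : ℂ) ρ, ‖y‖ < 1 := fun y hy =>
    (by simpa using hy : ‖y‖ < ρ).trans hρ
  have hP : P α f = fun z => ∫ t, K α (z * rot t) • f (Circle.exp t) ∂angleMeasure := by
    funext z
    simp [P, rot]
  rw [hP]
  have hmeas : ∀ y : ℂ, ‖y‖ < 1 → AEStronglyMeasurable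
      (fun t => K α (y * rot t) • f (Circle.exp t)) angleMeasure := fun y hy =>
    (continuous_K_rot α hy).aestronglyMeasurable.smul hf.aestronglyMeasurable
  refine hasFDerivAt_integral_of_dominated_of_fderiv_le (s := Metric.ball 0 ρ)
    (bound := fun t => C * ‖f (Circle.exp t)‖)
    (Metric.isOpen_ball.mem_nhds (by simpa using hzρ)) ?_ ?_
    (aestronglyMeasurable_PDeriv α hf hz) ?_ (hf.norm.const_mul C) ?_
  · filter_upwards [Metric.isOpen_ball.mem_nhds (by simpa using hzρ : z ∈ Metric.ball 0 ρ)]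
      with y hy using hmeas y (hmem y hy)
  · obtain ⟨C', hC'⟩ := (isCompact_closedBall (0 : ℂ) ρ).exists_bound_of_continuousOn
      (f := K α) (fun y hy => (hasFDerivAt_K α
        ((by simpa using hy : ‖y‖ ≤ ρ).trans_lt hρ)).continuousAt.continuousWithinAt)
    refine (hf.norm.const_mul C').mono' (hmeas z hz) (Eventually.of_forall fun t => ?_)
    rw [norm_smul]
    gcongr
    exact hC' _ (by simpa using hzρ.le)
  · exact Eventually.of_forall fun t y hy => hC y (by simpa using (Metric.mem_ball.1 hy).le) t
  · refine Eventually.of_forall fun t y hy => ?_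
    have h1 : HasFDerivAt (fun y : ℂ => y * rot t)
        ((ContinuousLinearMap.mul ℝ ℂ).flip (rot t)) y :=
      ((ContinuousLinearMap.mul ℝ ℂ).flip (rot t)).hasFDerivAt
    have h2 := ((hasFDerivAt_K α (mul_rot_mem (hmem y hy) t)).comp y h1).smul_const
      (f (Circle.exp t))
    refine h2.congr_fderiv ?_
    refine ContinuousLinearMap.ext fun v => ?_
    change (twoReMul _ (v * rot t) : ℝ) • f (Circle.exp t) =
      (twoReMul _ v : ℝ) • f (Circle.exp t)
    rw [twoReMul_apply, twoReMul_apply, mul_assoc, mul_comm v]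

lemma fderiv_P_apply (α : ℝ) {f : Circle → ℂ}
    (hf : Integrable (fun t : ℝ => f (Circle.exp t)) angleMeasure) {z : ℂ} (hz : ‖z‖ < 1)
    (v : ℂ) :
    fderiv ℝ (P α f) z v =
      ∫ t, ((2 * (Kz α (z * rot t) * rot t * v).re : ℝ) : ℂ) * f (Circle.exp t)
        ∂angleMeasure := by
  rw [(hasFDerivAt_P α hf hz).fderiv, ContinuousLinearMap.integral_apply (integrable_PDeriv α hf hz)]
  simp [PDeriv]

/-! ### The derivatives of `P_α[f]` as convolutions -/

/-- The kernel `e^{iτ} ∂K_α/∂z (r e^{iτ})`. -/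
def H (α r τ : ℝ) : ℂ := Kz α (polar r τ) * Complex.exp (τ * Complex.I)

/-- The convolution of `k` and `f`. -/
def conv (k : ℝ → ℂ) (f : Circle → ℂ) (θ : ℝ) : ℂ :=
  ∫ t, k (θ - t) * f (Circle.exp t) ∂angleMeasure

lemma norm_polar {r : ℝ} (hr : 0 ≤ r) (θ : ℝ) : ‖polar r θ‖ = r := by
  rw [polar, norm_mul, Complex.norm_exp_ofReal_mul_I, mul_one, Complex.norm_real,
    Real.norm_of_nonneg hr]

lemma polar_mul_rot (r θ t : ℝ) : polar r θ * rot t = polar r (θ - t) := by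
  rw [polar, polar, rot, mul_assoc, ← Complex.exp_add]
  congr 2
  push_cast
  ring

lemma exp_mul_rot (θ t : ℝ) :
    Complex.exp (θ * Complex.I) * rot t = Complex.exp ((θ - t : ℝ) * Complex.I) := by
  rw [rot, ← Complex.exp_add]
  congr 1
  push_cast
  ring

/-- The direction e^{iθ} and the rotation e^{-it} merge into e^{i(θ-t)}. This is why all derivatives
become convolutions with kernels made from H. -/
lemma Kz_mul_rot (α r θ t : ℝ) :
    Kz α (polar r θ * rot t) * rot t * Complex.exp (θ * Complex.I) = H α r (θ - t) := by
  rw [H, polar_mul_rot, mul_assoc, mul_comm (rot t), exp_mul_rot]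

lemma hasDerivAt_polar_left (r θ : ℝ) :
    HasDerivAt (fun ρ : ℝ => polar ρ θ) (Complex.exp (θ * Complex.I)) r := by
  unfold polar
  simpa using (Complex.ofRealCLM.hasDerivAt (x := r)).mul_const (Complex.exp (θ * Complex.I))

lemma hasDerivAt_polar_right (r θ : ℝ) :
    HasDerivAt (fun φ : ℝ => polar r φ) (r * (Complex.exp (θ * Complex.I) * Complex.I)) θ := by
  unfold polar
  have h : HasDerivAt (fun φ : ℝ => (φ : ℂ) * Complex.I) Complex.I θ := by
    simpa using (Complex.ofRealCLM.hasDerivAt (x := θ)).mul_const Complex.I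
  exact (h.cexp).const_mul (r : ℂ)

section

variable {α : ℝ} {f : Circle → ℂ} (hf : Integrable (fun t : ℝ => f (Circle.exp t)) angleMeasure)
  {r : ℝ} (hr : r ∈ Ico (0 : ℝ) 1) (θ : ℝ)

include hf hr

lemma dR_P_eq :
    dR (P α f) r θ = conv (fun τ => ((2 * (H α r τ).re : ℝ) : ℂ)) f θ := by
  have hz : ‖polar r θ‖ < 1 := by rw [norm_polar hr.1]; exact hr.2
  have h := (hasFDerivAt_P α hf hz).differentiableAt.hasFDerivAt.comp_hasDerivAt r
    (hasDerivAt_polar_left r θ)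
  rw [dR]
  refine h.deriv.trans ?_
  rw [fderiv_P_apply α hf hz, conv]
  simp only [Kz_mul_rot]

lemma dTheta_P_eq :
    dTheta (P α f) r θ = conv (fun τ => ((-(2 * r * (H α r τ).im) : ℝ) : ℂ)) f θ := by
  have hz : ‖polar r θ‖ < 1 := by rw [norm_polar hr.1]; exact hr.2
  have h := (hasFDerivAt_P α hf hz).differentiableAt.hasFDerivAt.comp_hasDerivAt θ
    (hasDerivAt_polar_right r θ)
  rw [dTheta]
  refine h.deriv.trans ?_
  rw [fderiv_P_apply α hf hz, conv]
  congr 1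
  funext t
  have e : Kz α (polar r θ * rot t) * rot t * (r * (Complex.exp (θ * Complex.I) * Complex.I)) =
      r * (H α r (θ - t) * Complex.I) := by
    rw [← Kz_mul_rot]
    ring
  rw [e, Complex.re_ofReal_mul, Complex.mul_I_re]
  push_cast
  ring

omit hr in
lemma integrable_conv_kernel {z : ℂ} (hz : ‖z‖ < 1) (v : ℂ) :
    Integrable (fun t => ((2 * (Kz α (z * rot t) * rot t * v).re : ℝ) : ℂ) * f (Circle.exp t))
      angleMeasure := by
  have := (ContinuousLinearMap.apply ℝ ℂ v).integrable_comp (integrable_PDeriv α hf hz)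
  simpa [PDeriv] using this

-- One identity serves both Wirtinger derivatives: ε = i gives u_z and ε = -i gives the conjugate
-- derivative.
omit hr in
lemma integral_Kz_mul {z : ℂ} (hz : ‖z‖ < 1) (ε : ℂ) :
    (fderiv ℝ (P α f) z 1 - ε * fderiv ℝ (P α f) z Complex.I) / 2 =
      ∫ t, ((Kz α (z * rot t) * rot t).re + ε * (Kz α (z * rot t) * rot t).im) *
        f (Circle.exp t) ∂angleMeasure := by
  rw [fderiv_P_apply α hf hz, fderiv_P_apply α hf hz, ← integral_const_mul, ← integral_sub,
    ← integral_div]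
  · congr 1
    funext t
    simp
    ring
  · exact integrable_conv_kernel hf hz _
  · exact (integrable_conv_kernel hf hz _).const_mul _

lemma dZ_P_eq :
    dZ (P α f) r θ = Complex.exp (-(θ * Complex.I)) * conv (H α r) f θ := by
  have hz : ‖polar r θ‖ < 1 := by rw [norm_polar hr.1]; exact hr.2
  rw [dZ, integral_Kz_mul hf hz, conv, ← integral_const_mul]
  congr 1
  funext t
  rw [← Kz_mul_rot, mul_comm Complex.I, Complex.re_add_im, Complex.exp_neg]
  field_simp [Complex.exp_ne_zero]

lemma dZbar_P_eq :
    dZbar (P α f) r θ =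
      Complex.exp (θ * Complex.I) * conv (fun τ => (starRingEnd ℂ) (H α r τ)) f θ := by
  have hz : ‖polar r θ‖ < 1 := by rw [norm_polar hr.1]; exact hr.2
  have h := integral_Kz_mul (α := α) hf hz (-Complex.I)
  rw [neg_mul, sub_neg_eq_add] at h
  rw [dZbar, h, conv, ← integral_const_mul]
  congr 1
  funext t
  rw [← Kz_mul_rot, map_mul, ← Complex.exp_conj]
  have e1 : (starRingEnd ℂ) (θ * Complex.I) = -(θ * Complex.I) := by simp
  have e2 : ∀ x : ℂ, (x.re : ℂ) + -Complex.I * x.im = (starRingEnd ℂ) x := fun x => by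
    apply Complex.ext <;> simp
  rw [e1, e2, Complex.exp_neg]
  field_simp [Complex.exp_ne_zero]

end

/-! ### The angle of the Möbius map -/

/-- The argument `s` with `e^{is} = e^{iτ} (1 - r e^{-iτ}) / (1 - r e^{iτ})`. -/
def mobAngle (r τ : ℝ) : ℝ := τ + 2 * Real.arctan (r * Real.sin τ / (1 - r * Real.cos τ))

section

variable {r : ℝ} (hr : r ∈ Ico (0 : ℝ) 1) (τ : ℝ)

include hr

lemma one_sub_mul_cos_pos : 0 < 1 - r * Real.cos τ := by
  nlinarith [hr.1, hr.2, Real.cos_le_one τ]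

lemma one_sub_polar_ne_zero : 1 - polar r τ ≠ 0 :=
  one_sub_ne_zero (by rw [norm_polar hr.1]; exact hr.2)

omit hr in
lemma one_sub_polar (r τ : ℝ) : 1 - polar r τ =
    ((1 - r * Real.cos τ : ℝ) : ℂ) - ((r * Real.sin τ : ℝ) : ℂ) * Complex.I := by
  rw [polar, Complex.exp_mul_I]
  push_cast
  ring

omit hr in
lemma one_sub_conj_polar (r τ : ℝ) : 1 - (starRingEnd ℂ) (polar r τ) =
    ((1 - r * Real.cos τ : ℝ) : ℂ) + ((r * Real.sin τ : ℝ) : ℂ) * Complex.I := by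
  have := congrArg (starRingEnd ℂ) (one_sub_polar r τ)
  rw [map_sub, map_one] at this
  rw [this]
  simp [-Complex.ofReal_mul]

omit hr in
lemma norm_one_sub_polar_sq (r τ : ℝ) :
    ‖1 - polar r τ‖ ^ 2 = (1 - r * Real.cos τ) ^ 2 + (r * Real.sin τ) ^ 2 := by
  rw [one_sub_polar, ← Complex.normSq_eq_norm_sq, Complex.normSq_apply]
  simp [-Complex.ofReal_mul]
  ring

/-- The numbers 1 - r e^{∓iτ} are conjugate with positive real part, so their arguments are ±a with
a the arctangent in `mobAngle`, and their quotient is e^{2ia}. -/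
lemma exp_mobAngle :
    Complex.exp (mobAngle r τ * Complex.I) = Complex.exp (τ * Complex.I) *
      ((1 - (starRingEnd ℂ) (polar r τ)) / (1 - polar r τ)) := by
  have hx := one_sub_mul_cos_pos hr τ
  have hne := one_sub_polar_ne_zero hr τ
  have hcos : Real.cos (Real.arctan (r * Real.sin τ / (1 - r * Real.cos τ))) ≠ 0 :=
    (Real.cos_arctan_pos _).ne'
  have htan := Real.tan_arctan (r * Real.sin τ / (1 - r * Real.cos τ))
  -- Writing 2a as a - (-a) turns e^{2ia} into a quotient that can be cross-multiplied, leaving only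
  -- the value of tan a.
  have e : ((mobAngle r τ : ℝ) : ℂ) * Complex.I = τ * Complex.I +
      ((Real.arctan (r * Real.sin τ / (1 - r * Real.cos τ)) : ℝ) * Complex.I
        - (-(Real.arctan (r * Real.sin τ / (1 - r * Real.cos τ)) : ℝ)) * Complex.I) := by
    rw [mobAngle]
    push_cast
    ring
  rw [e, Complex.exp_add, Complex.exp_sub]
  congr 1
  generalize Real.arctan (r * Real.sin τ / (1 - r * Real.cos τ)) = a at *
  rw [Real.tan_eq_sin_div_cos, div_eq_div_iff hcos hx.ne'] at htan
  have hne' : Complex.exp (-(a : ℂ) * Complex.I) ≠ 0 := Complex.exp_ne_zero _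
  rw [div_eq_div_iff hne' hne, Complex.exp_mul_I, Complex.exp_mul_I, one_sub_polar,
    one_sub_conj_polar, Complex.cos_neg, Complex.sin_neg, ← Complex.ofReal_cos,
    ← Complex.ofReal_sin]
  have h' : ((Real.sin a : ℝ) : ℂ) * ((1 - r * Real.cos τ : ℝ) : ℂ) =
      ((r * Real.sin τ : ℝ) : ℂ) * ((Real.cos a : ℝ) : ℂ) := by exact_mod_cast htan
  linear_combination 2 * Complex.I * h'

lemma hasDerivAt_mobAngle :
    HasDerivAt (mobAngle r) ((1 - r ^ 2) / ‖1 - polar r τ‖ ^ 2) τ := by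
  have hx := one_sub_mul_cos_pos hr τ
  have h1 : HasDerivAt (fun τ => r * Real.sin τ) (r * Real.cos τ) τ :=
    (Real.hasDerivAt_sin τ).const_mul r
  have h2 : HasDerivAt (fun τ => 1 - r * Real.cos τ) (-(r * -Real.sin τ)) τ :=
    ((Real.hasDerivAt_cos τ).const_mul r).const_sub 1
  have h3 := (hasDerivAt_id τ).add (((h1.fun_div h2 hx.ne').arctan).const_mul 2)
  have hD : 0 < (1 - r * Real.cos τ) ^ 2 + (r * Real.sin τ) ^ 2 := by positivity
  refine h3.congr_deriv ?_
  rw [norm_one_sub_polar_sq]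
  field_simp
  nlinarith [Real.sin_sq_add_cos_sq τ]

lemma continuous_mobAngle : Continuous (mobAngle r) :=
  continuous_iff_continuousAt.2 fun τ => (hasDerivAt_mobAngle hr τ).continuousAt

omit hr in
lemma abs_mobAngle_sub_le (r τ : ℝ) : |mobAngle r τ - τ| ≤ Real.pi := by
  have h1 := Real.arctan_lt_pi_div_two (r * Real.sin τ / (1 - r * Real.cos τ))
  have h2 := Real.neg_pi_div_two_lt_arctan (r * Real.sin τ / (1 - r * Real.cos τ))
  rw [mobAngle, abs_le]
  constructor <;> linarith

/-- The angle stays within π of τ, so it tends to ±∞ with τ. Surjectivity transfers pointwise bounds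
from τ to all s when p = 1. -/
lemma surjective_mobAngle : Function.Surjective (mobAngle r) := by
  refine (continuous_mobAngle hr).surjective ?_ ?_
  · refine tendsto_atTop_mono (f := fun τ => τ - Real.pi) (fun τ => ?_)
      (tendsto_atTop_add_const_right _ _ tendsto_id)
    linarith [(abs_le.1 (abs_mobAngle_sub_le r τ)).1]
  · refine tendsto_atBot_mono (g := mobAngle r) (f := fun τ => τ + Real.pi) (fun τ => ?_)
      (tendsto_atBot_add_const_right _ _ tendsto_id)
    linarith [(abs_le.1 (abs_mobAngle_sub_le r τ)).2]

omit hr in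
lemma w_eq_norm (r s : ℝ) : w r s = ‖1 + r * Complex.exp (s * Complex.I)‖ := by
  rw [w, ← Complex.norm_conj]
  congr 1
  rw [map_add, map_mul, map_one, Complex.conj_ofReal, ← Complex.exp_conj]
  simp

/-- Already before taking moduli, 1 + r e^{is} = (1-r²)/(1 - r e^{iτ}). -/
lemma w_mobAngle : w r (mobAngle r τ) = (1 - r ^ 2) / ‖1 - polar r τ‖ := by
  have hne := one_sub_polar_ne_zero hr τ
  have hr2 : 0 ≤ 1 - r ^ 2 := by nlinarith [hr.1, hr.2]
  have hE : Complex.exp (τ * Complex.I) * (starRingEnd ℂ) (Complex.exp (τ * Complex.I)) = 1 := by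
    rw [Complex.mul_conj, Complex.normSq_eq_norm_sq, Complex.norm_exp_ofReal_mul_I]
    simp
  rw [w_eq_norm, exp_mobAngle hr, ← Real.norm_of_nonneg hr2, ← Complex.norm_real, ← norm_div]
  congr 1
  field_simp
  rw [polar, map_mul, Complex.conj_ofReal]
  push_cast
  linear_combination (-(r : ℂ) ^ 2) * hE

end

lemma w_sq (r s : ℝ) : w r s ^ 2 = 1 + r ^ 2 + 2 * r * Real.cos s := by
  rw [w_eq_norm, ← Complex.normSq_eq_norm_sq, Complex.normSq_apply, Complex.exp_mul_I]
  simp [← Complex.ofReal_cos, ← Complex.ofReal_sin]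
  nlinarith [Real.sin_sq_add_cos_sq s]

lemma w_pos {r : ℝ} (hr : r ∈ Ico (0 : ℝ) 1) (s : ℝ) : 0 < w r s := by
  have h : 0 < w r s ^ 2 := by
    rw [w_sq]
    nlinarith [Real.neg_one_le_cos s, hr.1, hr.2, sq_nonneg (1 - r), mul_pos_of_neg_of_neg
      (sub_neg.2 hr.2) (sub_neg.2 hr.2)]
  have h0 : 0 ≤ w r s := norm_nonneg _
  exact lt_of_le_of_ne h0 fun h' => by simp [← h'] at h

lemma w_le {r : ℝ} (hr : 0 ≤ r) (s : ℝ) : w r s ≤ 1 + r := by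
  rw [w_eq_norm]
  refine (norm_add_le _ _).trans ?_
  rw [norm_mul, Complex.norm_exp_ofReal_mul_I, Complex.norm_real, Real.norm_of_nonneg hr]
  simp

lemma continuous_w (r : ℝ) : Continuous (w r) := by unfold w; fun_prop

/-- Multiplying the bracket in `Kz` by e^{iτ} turns the conjugate of z into r and the unimodular
quotient into e^{is}, so the bracket becomes affine in e^{is}. The remaining factors are powers of
|1-z| and 1-r², which `w_mobAngle` rewrites in terms of w. -/
lemma H_eq (α : ℝ) {r : ℝ} (hr : r ∈ Ico (0 : ℝ) 1) (τ : ℝ) :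
    H α r τ = ((c α / 2 * w r (mobAngle r τ) ^ (α + 2) / (1 - r ^ 2) ^ (2 : ℝ) : ℝ) : ℂ) *
      (((α + 2 : ℝ) : ℂ) * Complex.exp (mobAngle r τ * Complex.I) - ((α * r : ℝ) : ℂ)) := by
  have hr2 : 0 < 1 - r ^ 2 := by nlinarith [hr.1, hr.2]
  have hn : 0 < ‖1 - polar r τ‖ := norm_pos_iff.2 (one_sub_polar_ne_zero hr τ)
  have hE : (starRingEnd ℂ) (polar r τ) * Complex.exp (τ * Complex.I) = r := by
    rw [polar, map_mul, Complex.conj_ofReal, mul_assoc, mul_comm ((starRingEnd ℂ) _),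
      Complex.mul_conj, Complex.normSq_eq_norm_sq, Complex.norm_exp_ofReal_mul_I]
    simp
  have hA : (1 - r ^ 2) ^ α * (‖1 - polar r τ‖ ^ (α + 2))⁻¹ =
      w r (mobAngle r τ) ^ (α + 2) / (1 - r ^ 2) ^ (2 : ℝ) := by
    rw [w_mobAngle hr, Real.div_rpow hr2.le hn.le, Real.rpow_add hr2]
    field_simp
  rw [H, Kz, norm_polar hr.1, hA, exp_mobAngle hr]
  push_cast
  linear_combination ((-(α : ℂ) / 2) * ((c α : ℂ) * (((w r (mobAngle r τ) ^ (α + 2) : ℝ) : ℂ) /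
    (((1 - r ^ 2) ^ (2 : ℝ) : ℝ) : ℂ)))) * hE

/-! ### Conjugate exponents -/

section

variable {p : ℝ≥0∞} (hp : 1 ≤ p)

include hp

lemma conjExponent_ne_zero : ENNReal.conjExponent p ≠ 0 :=
  have := ENNReal.HolderConjugate.conjExponent hp
  ENNReal.HolderConjugate.ne_zero (ENNReal.conjExponent p) p

lemma conjExponent_ne_top (h1 : p ≠ 1) : ENNReal.conjExponent p ≠ ⊤ := by
  have := ENNReal.HolderConjugate.conjExponent hp
  intro h
  have := ENNReal.HolderConjugate.inv_add_inv_eq_one p (ENNReal.conjExponent p)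
  rw [h] at this
  simp at this
  exact h1 this

lemma inv_conjExp_add (h1 : p ≠ 1) : (conjExp p)⁻¹ + (p⁻¹).toReal = 1 := by
  have := ENNReal.HolderConjugate.conjExponent hp
  have h := ENNReal.HolderConjugate.inv_add_inv_eq_one p (ENNReal.conjExponent p)
  have hp0 : p ≠ 0 := by rintro rfl; simp at hp
  have h' := congrArg ENNReal.toReal h
  rw [ENNReal.toReal_add (by simpa using hp0) (by simpa using conjExponent_ne_zero hp),
    ENNReal.toReal_inv (ENNReal.conjExponent p)] at h'
  rw [conjExp, add_comm, h']
  simp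

lemma conjExp_pos (h1 : p ≠ 1) : 0 < conjExp p :=
  ENNReal.toReal_pos (conjExponent_ne_zero hp) (conjExponent_ne_top hp h1)

lemma one_le_conjExp (h1 : p ≠ 1) : 1 ≤ conjExp p := by
  have h := inv_conjExp_add hp h1
  have h2 : (conjExp p)⁻¹ ≤ 1 := by linarith [ENNReal.toReal_nonneg (a := p⁻¹)]
  exact (inv_le_one₀ (conjExp_pos hp h1)).1 h2

/-- This is the form in which the exponent comes out of the Möbius substitution. -/
lemma growthExp_eq (h1 : p ≠ 1) : growthExp p = 2 - 1 / conjExp p := by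
  have h := inv_conjExp_add hp h1
  rw [growthExp, one_div]
  linarith

end

lemma growthExp_one : growthExp 1 = 2 := by norm_num [growthExp]

/-! ### Integrals over the circle -/

lemma integral_angleMeasure {E : Type*} [NormedAddCommGroup E] [NormedSpace ℝ E] (g : ℝ → E) :
    ∫ t, g t ∂angleMeasure = (2 * Real.pi)⁻¹ • ∫ t in (0 : ℝ)..2 * Real.pi, g t := by
  rw [angleMeasure, integral_smul_measure, intervalIntegral.integral_of_le Real.two_pi_pos.le,
    ENNReal.toReal_inv, ENNReal.toReal_ofReal Real.two_pi_pos.le]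

instance isProbabilityMeasure_angleMeasure : IsProbabilityMeasure angleMeasure := by
  constructor
  rw [angleMeasure]
  simp only [Measure.smul_apply, Measure.restrict_apply MeasurableSet.univ, univ_inter,
    Real.volume_Ioc, sub_zero, smul_eq_mul]
  exact ENNReal.inv_mul_cancel (by simp [Real.pi_pos]) ENNReal.ofReal_ne_top

lemma integral_angleMeasure_sub {E : Type*} [NormedAddCommGroup E] [NormedSpace ℝ E]
    {g : ℝ → E} (hg : Function.Periodic g (2 * Real.pi)) (θ : ℝ) :
    ∫ t, g (θ - t) ∂angleMeasure = (2 * Real.pi)⁻¹ • ∫ t in -Real.pi..Real.pi, g t := by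
  rw [integral_angleMeasure, intervalIntegral.integral_comp_sub_left]
  congr 1
  have := hg.intervalIntegral_add_eq (θ - 2 * Real.pi) (-Real.pi)
  rw [show θ - 2 * Real.pi + 2 * Real.pi = θ by ring,
    show -Real.pi + 2 * Real.pi = Real.pi by ring] at this
  simpa using this

lemma interval_symm_eq {g : ℝ → ℝ} (hg : Function.Periodic g (2 * Real.pi)) :
    ∫ t in -Real.pi..Real.pi, g t = ∫ t in (0 : ℝ)..2 * Real.pi, g t := by
  have := hg.intervalIntegral_add_eq (-Real.pi) 0
  rwa [show -Real.pi + 2 * Real.pi = Real.pi by ring, zero_add] at this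

/-- The function on the circle attached to a periodic function of `-t`. -/
def ofPeriodic (g : ℝ → ℂ) (ζ : Circle) : ℂ := g (-(Complex.arg ζ))

/-- The reflected variable matches the convolution at angle 0, where the kernel is evaluated at -t.
The argument of e^{it} differs from t by a multiple of 2π, which periodicity absorbs. -/
lemma ofPeriodic_exp {g : ℝ → ℂ} (hg : Function.Periodic g (2 * Real.pi)) (t : ℝ) :
    ofPeriodic g (Circle.exp t) = g (-t) := by
  obtain ⟨m, hm⟩ := Circle.exp_eq_exp.1 (Circle.exp_arg (Circle.exp t))
  rw [ofPeriodic, hm, neg_add, ← sub_eq_add_neg]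
  exact hg.sub_int_mul_eq m

lemma MemLpT.integrable {f : Circle → ℂ} {p : ℝ≥0∞} (hp : 1 ≤ p) (hf : MemLpT f p) :
    Integrable (fun t : ℝ => f (Circle.exp t)) angleMeasure :=
  MemLp.integrable hp hf

lemma normLpT_nonneg (f : Circle → ℂ) (p : ℝ≥0∞) : 0 ≤ normLpT f p := ENNReal.toReal_nonneg

/-- Hölder's inequality for convolutions, in terms of the `L^q` seminorm of the kernel. -/
lemma norm_conv_le_eLpNorm {k : ℝ → ℂ} (hk : Continuous k) {p : ℝ≥0∞} (hp : 1 ≤ p)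
    {f : Circle → ℂ} (hf : MemLpT f p) (θ : ℝ)
    (hfin : eLpNorm (fun t => k (θ - t)) (ENNReal.conjExponent p) angleMeasure ≠ ⊤) :
    ‖conv k f θ‖ ≤
      (eLpNorm (fun t => k (θ - t)) (ENNReal.conjExponent p) angleMeasure).toReal *
        normLpT f p := by
  have := ENNReal.HolderConjugate.conjExponent hp
  have : (ENNReal.conjExponent p).HolderConjugate p := ENNReal.HolderConjugate.symm
  have hkθ : Continuous fun t => k (θ - t) := by fun_prop
  have h := eLpNorm_smul_le_mul_eLpNorm (p := ENNReal.conjExponent p) (q := p) (r := 1)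
    hf.1 (hkθ.aestronglyMeasurable (μ := angleMeasure))
  have hf' : eLpNorm (fun t : ℝ => f (Circle.exp t)) p angleMeasure ≠ ⊤ := hf.2.ne
  rw [normLpT, ← ENNReal.toReal_mul]
  refine le_trans ?_ (ENNReal.toReal_mono (ENNReal.mul_ne_top hfin hf') h)
  rw [eLpNorm_one_eq_lintegral_enorm]
  have h2 : ‖conv k f θ‖ₑ ≤ ∫⁻ t, ‖((fun t => k (θ - t)) • fun t : ℝ => f (Circle.exp t)) t‖ₑ
      ∂angleMeasure := by
    rw [conv]
    exact enorm_integral_le_lintegral_enorm _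
  rw [eLpNorm_one_eq_lintegral_enorm] at h
  have h3 := ENNReal.toReal_mono ((h.trans_lt (ENNReal.mul_lt_top hfin.lt_top hf'.lt_top)).ne) h2
  simpa using h3

/-- Hölder's inequality for convolutions, finite exponents. -/
lemma norm_conv_le {k : ℝ → ℂ} (hk : Continuous k) (hper : Function.Periodic k (2 * Real.pi))
    {p : ℝ≥0∞} (hp : 1 ≤ p) (h1 : p ≠ 1) {f : Circle → ℂ} (hf : MemLpT f p) (θ : ℝ) :
    ‖conv k f θ‖ ≤
      ((2 * Real.pi)⁻¹ * ∫ t in -Real.pi..Real.pi, ‖k t‖ ^ conjExp p) ^ (1 / conjExp p) *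
        normLpT f p := by
  have hkθ : Continuous fun t => k (θ - t) := by fun_prop
  obtain ⟨C, hC⟩ : ∃ C, ∀ t, ‖k t‖ ≤ C := by
    obtain ⟨C, hC⟩ := isCompact_Icc.exists_bound_of_continuousOn
      (hk.continuousOn (s := Icc 0 (2 * Real.pi)))
    refine ⟨C, fun t => ?_⟩
    obtain ⟨y, hy, hyt⟩ := hper.exists_mem_Ico₀ Real.two_pi_pos t
    rw [hyt]
    exact hC y ⟨hy.1, hy.2.le⟩
  have hmem : MemLp (fun t => k (θ - t)) (ENNReal.conjExponent p) angleMeasure :=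
    MemLp.of_bound hkθ.aestronglyMeasurable C (Eventually.of_forall fun t => hC _)
  refine (norm_conv_le_eLpNorm hk hp hf θ hmem.2.ne).trans (le_of_eq ?_)
  congr 1
  have hper' : Function.Periodic (fun t => ‖k t‖ ^ conjExp p) (2 * Real.pi) := fun t => by
    simp only [hper t]
  rw [hmem.eLpNorm_eq_integral_rpow_norm (conjExponent_ne_zero hp) (conjExponent_ne_top hp h1),
    ENNReal.toReal_ofReal (by positivity), one_div]
  have := integral_angleMeasure_sub hper' θ
  rw [smul_eq_mul] at this
  rw [← this]
  rfl

lemma norm_conv_le_of_bound {k : ℝ → ℂ} (hk : Continuous k) {C : ℝ} (hC : ∀ t, ‖k t‖ ≤ C)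
    {f : Circle → ℂ} (hf : MemLpT f 1) (θ : ℝ) :
    ‖conv k f θ‖ ≤ C * normLpT f 1 := by
  have h0 : 0 ≤ C := (norm_nonneg _).trans (hC 0)
  have hkθ : Continuous fun t => k (θ - t) := by fun_prop
  have hle : eLpNorm (fun t => k (θ - t)) (ENNReal.conjExponent 1) angleMeasure ≤
      ENNReal.ofReal C := by
    refine (eLpNorm_le_of_ae_bound (Eventually.of_forall fun t => hC (θ - t))).trans ?_
    simp
  refine (norm_conv_le_eLpNorm hk le_rfl hf θ
    (hle.trans_lt ENNReal.ofReal_lt_top).ne).trans ?_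
  gcongr
  · exact normLpT_nonneg _ _
  · exact ENNReal.toReal_le_of_le_ofReal h0 hle

/-! ### Duality -/

lemma normLpT_const {p : ℝ≥0∞} (hp : 1 ≤ p) : normLpT (fun _ => 1) p = 1 := by
  have hp0 : p ≠ 0 := by rintro rfl; simp at hp
  rw [normLpT, eLpNorm_const _ hp0 (IsProbabilityMeasure.ne_zero _)]
  simp

lemma nonneg_of_conv_le {k : ℝ → ℂ} {p : ℝ≥0∞} (hp : 1 ≤ p) {N : ℝ}
    (hN : ∀ f, MemLpT f p → ‖conv k f 0‖ ≤ N * normLpT f p) : 0 ≤ N := by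
  have h := hN (fun _ => 1) (memLp_const 1)
  rw [normLpT_const hp, mul_one] at h
  exact (norm_nonneg _).trans h

/-- The extremal function in Hölder's inequality, the conjugate of k times |k|^{q-2}, turns the
convolution at 0 into the mean S of |k|^q, while its p-norm is at most S^{1/p}. Dividing leaves
S^{1/q} ≤ N. -/
lemma rpow_norm_le_of_conv_le {k : ℝ → ℂ} (hk : Continuous k)
    (hper : Function.Periodic k (2 * Real.pi)) {p : ℝ≥0∞} (hp : 1 ≤ p) (h1 : p ≠ 1) {N : ℝ}
    (hN : ∀ f, MemLpT f p → ‖conv k f 0‖ ≤ N * normLpT f p) :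
    ((2 * Real.pi)⁻¹ * ∫ t in -Real.pi..Real.pi, ‖k t‖ ^ conjExp p) ^ (1 / conjExp p) ≤ N := by
  set q := conjExp p with hq
  have hq1 : 1 ≤ q := one_le_conjExp hp h1
  have hq0 : 0 < q := conjExp_pos hp h1
  have hN0 := nonneg_of_conv_le hp hN
  obtain ⟨C, hC⟩ : ∃ C, ∀ t, ‖k t‖ ≤ C := by
    obtain ⟨C, hC⟩ := isCompact_Icc.exists_bound_of_continuousOn
      (hk.continuousOn (s := Icc 0 (2 * Real.pi)))
    refine ⟨C, fun t => ?_⟩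
    obtain ⟨y, hy, hyt⟩ := hper.exists_mem_Ico₀ Real.two_pi_pos t
    rw [hyt]
    exact hC y ⟨hy.1, hy.2.le⟩
  -- The exponent q-2 may be negative, but at zeros of k the conjugate factor makes g vanish
  -- whatever value the power takes there.
  set g : ℝ → ℂ := fun t => (starRingEnd ℂ) (k t) * ((‖k t‖ ^ (q - 2) : ℝ) : ℂ) with hg
  have hgper : Function.Periodic g (2 * Real.pi) := fun t => by simp only [hg, hper t]
  have hgn : ∀ t, k t ≠ 0 → ‖g t‖ = ‖k t‖ ^ (q - 1) := fun t ht => by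
    have h0 : 0 < ‖k t‖ := norm_pos_iff.2 ht
    rw [hg]
    simp only [norm_mul, RCLike.norm_conj, Complex.norm_real]
    rw [Real.norm_of_nonneg (by positivity), show q - 1 = 1 + (q - 2) by ring, Real.rpow_add h0,
      Real.rpow_one]
  have hgz : ∀ t, k t = 0 → g t = 0 := fun t ht => by simp [hg, ht]
  have hgle : ∀ t, ‖g t‖ ≤ ‖k t‖ ^ (q - 1) := fun t => by
    by_cases ht : k t = 0
    · rw [hgz t ht, norm_zero]; positivity
    · exact (hgn t ht).le
  have hgm : AEStronglyMeasurable (fun t : ℝ => ofPeriodic g (Circle.exp t)) angleMeasure := by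
    have : (fun t : ℝ => ofPeriodic g (Circle.exp t)) = fun t => g (-t) := by
      funext t; exact ofPeriodic_exp hgper t
    rw [this, hg]
    refine Measurable.aestronglyMeasurable ?_
    have hkm : Measurable fun t => k (-t) := (hk.comp continuous_neg).measurable
    have hc : Measurable fun t => (starRingEnd ℂ) (k (-t)) :=
      (Complex.continuous_conj.comp (hk.comp continuous_neg)).measurable
    exact hc.mul (Complex.measurable_ofReal.comp (hkm.norm.pow_const _))
  have hgb : ∀ t : ℝ, ‖ofPeriodic g (Circle.exp t)‖ ≤ C ^ (q - 1) := fun t => by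
    rw [ofPeriodic_exp hgper]
    refine (hgle _).trans ?_
    exact Real.rpow_le_rpow (norm_nonneg _) (hC _) (by linarith)
  have hmem : MemLpT (ofPeriodic g) p :=
    MemLp.of_bound hgm (C ^ (q - 1)) (Eventually.of_forall hgb)
  set S := (2 * Real.pi)⁻¹ * ∫ t in -Real.pi..Real.pi, ‖k t‖ ^ q with hS
  have hkg : ∀ t, k t * g t = ((‖k t‖ ^ q : ℝ) : ℂ) := fun t => by
    by_cases ht : k t = 0
    · rw [ht, norm_zero, Real.zero_rpow hq0.ne']; simp
    · have h0 : 0 < ‖k t‖ := norm_pos_iff.2 ht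
      rw [hg]
      simp only
      rw [← mul_assoc, Complex.mul_conj, Complex.normSq_eq_norm_sq, ← Complex.ofReal_mul]
      congr 1
      rw [← Real.rpow_natCast, ← Real.rpow_add h0]
      congr 1
      push_cast
      ring
  have hkper : Function.Periodic (fun t => ‖k t‖ ^ q) (2 * Real.pi) := fun t => by
    simp only [hper t]
  have hI : ∫ t, ‖k (0 - t)‖ ^ q ∂angleMeasure = S := by
    rw [integral_angleMeasure_sub hkper 0, smul_eq_mul]
  have hS0 : 0 ≤ S := by rw [← hI]; exact integral_nonneg fun t => by positivity
  have hconv : conv k (ofPeriodic g) 0 = S := by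
    rw [conv, ← hI, ← integral_complex_ofReal]
    congr 1
    funext t
    rw [ofPeriodic_exp hgper, zero_sub, hkg]
  have hmain := hN _ hmem
  rw [hconv, Complex.norm_real, Real.norm_of_nonneg hS0] at hmain
  have hinv := inv_conjExp_add hp h1
  rw [← hq] at hinv
  -- For p = ∞ the exponent q is 1 and |g| ≤ 1, so no power of S has to be divided out.
  by_cases htop : p = ⊤
  · subst htop
    have hq' : q = 1 := by simpa using hinv
    have hn1 : normLpT (ofPeriodic g) ⊤ ≤ 1 := by
      refine ENNReal.toReal_le_of_le_ofReal zero_le_one ?_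
      refine (eLpNorm_le_of_ae_bound (C := 1) (Eventually.of_forall fun t => ?_)).trans ?_
      · rw [ofPeriodic_exp hgper]
        refine (hgle _).trans ?_
        rw [hq']
        simp
      · simp
    rw [hq', div_one, Real.rpow_one]
    exact hmain.trans (mul_le_of_le_one_right hN0 hn1)
  · have hp0 : p ≠ 0 := by rintro rfl; simp at hp
    have hP0 : 0 < p.toReal := ENNReal.toReal_pos hp0 htop
    -- Conjugacy of the exponents: |g|^p is bounded by |k|^q.
    have hqP : (q - 1) * p.toReal = q := by
      rw [ENNReal.toReal_inv] at hinv
      field_simp at hinv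
      linarith
    have hnorm : normLpT (ofPeriodic g) p ≤ S ^ (1 / p.toReal) := by
      rw [normLpT, MemLp.eLpNorm_eq_integral_rpow_norm hp0 htop hmem,
        ENNReal.toReal_ofReal (by positivity), ← one_div, ← hI]
      refine Real.rpow_le_rpow (integral_nonneg fun t => by positivity) ?_ (by positivity)
      refine integral_mono_of_nonneg (Eventually.of_forall fun t => by positivity) ?_
        (Eventually.of_forall fun t => ?_)
      · refine Integrable.of_bound (C := C ^ q) (Continuous.aestronglyMeasurable ?_)
          (Eventually.of_forall fun t => ?_)
        · exact (hk.comp (by fun_prop : Continuous fun t : ℝ => 0 - t)).norm.rpow_const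
            fun t => Or.inr hq0.le
        · rw [Real.norm_of_nonneg (by positivity)]
          exact Real.rpow_le_rpow (norm_nonneg _) (hC _) hq0.le
      · simp only
        rw [ofPeriodic_exp hgper, zero_sub]
        refine (Real.rpow_le_rpow (norm_nonneg _) (hgle _) hP0.le).trans ?_
        rw [← Real.rpow_mul (norm_nonneg _), hqP]
    rcases hS0.eq_or_lt with h | h
    · rw [← h, Real.zero_rpow (by positivity)]; exact hN0
    · have h2 : S ≤ N * S ^ (1 / p.toReal) :=
        hmain.trans (mul_le_mul_of_nonneg_left hnorm hN0)
      have h3 : S = S ^ (1 / q) * S ^ (1 / p.toReal) := by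
        rw [← Real.rpow_add h]
        rw [ENNReal.toReal_inv] at hinv
        rw [one_div, one_div, hinv, Real.rpow_one]
      rw [h3] at h2
      have h4 : S ^ (1 / q) * S ^ (1 / p.toReal) ≤ N * S ^ (1 / p.toReal) := by
        rw [← h3]; rw [← h3] at h2; exact h2
      exact le_of_mul_le_mul_right h4 (by positivity)

/-- For p = 1 a test function concentrated near a point recovers the value of the kernel there: on
the set where k is within ε of k(τ), the average of k is within ε of k(τ). -/
lemma norm_le_of_conv_le {k : ℝ → ℂ} (hk : Continuous k)
    (hper : Function.Periodic k (2 * Real.pi)) {N : ℝ}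
    (hN : ∀ f, MemLpT f 1 → ‖conv k f 0‖ ≤ N * normLpT f 1) (τ : ℝ) : ‖k τ‖ ≤ N := by
  refine le_of_forall_pos_le_add fun ε hε => ?_
  set E : Set ℝ := {t | ‖k t - k τ‖ < ε} with hE
  have hEo : IsOpen E := isOpen_lt (by fun_prop) continuous_const
  have hEper : ∀ t, t + 2 * Real.pi ∈ E ↔ t ∈ E := fun t => by simp only [hE, mem_ofPred_eq, hper t]
  set g : ℝ → ℂ := E.indicator 1 with hg
  have hgper : Function.Periodic g (2 * Real.pi) := fun t => by
    simp only [hg, indicator, hEper t, Pi.one_apply]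
  set E' : Set ℝ := {t | -t ∈ E} with hE'
  have hE'o : IsOpen E' := hEo.preimage continuous_neg
  have hgE : (fun t : ℝ => ofPeriodic g (Circle.exp t)) = E'.indicator 1 := by
    funext t
    rw [ofPeriodic_exp hgper, hg]
    rfl
  have hpos : 0 < angleMeasure.real E' := by
    have hper' : Function.Periodic (fun t => k (-t)) (2 * Real.pi) := fun t => by
      simp only [neg_add, ← sub_eq_add_neg, hper.sub_eq]
    obtain ⟨y, hy, hyt⟩ := hper'.exists_mem_Ico₀ Real.two_pi_pos (-τ)
    have hyE : y ∈ E' := by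
      simp only [neg_neg] at hyt
      simp [hE', hE, ← hyt, hε]
    -- The representative y may be the endpoint 0. An open set around a point of the closure still
    -- meets the open interval, hence has positive measure there.
    have hycl : y ∈ closure (Ioo (0 : ℝ) (2 * Real.pi)) := by
      rw [closure_Ioo Real.two_pi_pos.ne]
      exact ⟨hy.1, hy.2.le⟩
    obtain ⟨x, hx⟩ := mem_closure_iff.1 hycl E' hE'o hyE
    have hvol : 0 < volume (E' ∩ Ioo (0 : ℝ) (2 * Real.pi)) :=
      (hE'o.inter isOpen_Ioo).measure_pos _ ⟨x, hx⟩
    refine ENNReal.toReal_pos (ne_of_gt ?_) (measure_ne_top _ _)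
    rw [angleMeasure, Measure.smul_apply, Measure.restrict_apply hE'o.measurableSet, smul_eq_mul]
    refine ENNReal.mul_pos (ENNReal.inv_ne_zero.2 ENNReal.ofReal_ne_top) (ne_of_gt (hvol.trans_le (measure_mono ?_)))
    exact inter_subset_inter_right _ Ioo_subset_Ioc_self
  have hmem : MemLpT (ofPeriodic g) 1 := by
    rw [MemLpT, hgE]
    exact memLp_indicator_const 1 hE'o.measurableSet 1 (Or.inr (measure_ne_top _ _))
  have hnorm : normLpT (ofPeriodic g) 1 = angleMeasure.real E' := by
    rw [normLpT, hgE]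
    change (eLpNorm (E'.indicator fun _ => (1 : ℂ)) 1 angleMeasure).toReal = _
    rw [eLpNorm_indicator_const hE'o.measurableSet one_ne_zero ENNReal.one_ne_top]
    simp [Measure.real]
  have hconv : conv k (ofPeriodic g) 0 = ∫ t in E', k (-t) ∂angleMeasure := by
    rw [conv, ← integral_indicator hE'o.measurableSet]
    congr 1
    funext t
    rw [congrFun hgE t, zero_sub]
    by_cases ht : t ∈ E' <;> simp [ht]
  have hdiff : ‖(∫ t in E', k (-t) ∂angleMeasure) - angleMeasure.real E' • k τ‖ ≤
      ε * angleMeasure.real E' := by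
    have hint : IntegrableOn (fun t => k (-t)) E' angleMeasure := by
      refine Measure.integrableOn_of_bounded (M := ‖k τ‖ + ε) (measure_ne_top _ _)
        (hk.comp continuous_neg).aestronglyMeasurable ?_
      filter_upwards [ae_restrict_mem hE'o.measurableSet] with t ht
      have ht' : ‖k (-t) - k τ‖ < ε := ht
      linarith [norm_sub_norm_le (k (-t)) (k τ)]
    rw [← setIntegral_const, ← integral_sub hint (integrable_const _)]
    exact norm_setIntegral_le_of_norm_le_const (measure_lt_top _ _) fun t ht => le_of_lt ht
  have h := hN _ hmem
  rw [hconv, hnorm] at h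
  have h2 : ‖angleMeasure.real E' • k τ‖ ≤ (N + ε) * angleMeasure.real E' := by
    have := norm_sub_norm_le (angleMeasure.real E' • k τ) (∫ t in E', k (-t) ∂angleMeasure)
    rw [norm_sub_rev] at this
    linarith
  rw [norm_smul, Real.norm_of_nonneg hpos.le, mul_comm] at h2
  exact le_of_mul_le_mul_right h2 hpos

/-! ### The best constant for a kernel in Möbius coordinates -/

/-- The `L^q` norm of `Φ w^{α+2}` with respect to `w^{-2} ds / 2π`. -/
def weightedNorm (α : ℝ) (p : ℝ≥0∞) (r : ℝ) (Φ : ℝ → ℝ) : ℝ :=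
  if p = 1 then ⨆ s, Φ s * w r s ^ (α + 2)
  else ((2 * Real.pi)⁻¹ * ∫ s in (0 : ℝ)..2 * Real.pi,
    Φ s ^ conjExp p * w r s ^ ((2 + α) * conjExp p - 2)) ^ (1 / conjExp p)

/-- `|k(τ)| = Φ(s) w(r,s)^{α+2} / (1-r²)²`, where `s` is the Möbius angle of `τ`. -/
structure IsMobiusKernel (α r : ℝ) (Φ : ℝ → ℝ) (k : ℝ → ℂ) : Prop where
  cont : Continuous k
  periodic : Function.Periodic k (2 * Real.pi)
  contΦ : Continuous Φ
  nonneg : ∀ s, 0 ≤ Φ s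
  periodicΦ : Function.Periodic Φ (2 * Real.pi)
  norm_eq : ∀ τ, ‖k τ‖ = Φ (mobAngle r τ) * w r (mobAngle r τ) ^ (α + 2) / (1 - r ^ 2) ^ (2 : ℝ)

lemma periodic_w (r : ℝ) : Function.Periodic (w r) (2 * Real.pi) := fun s => by
  have h : w r (s + 2 * Real.pi) ^ 2 = w r s ^ 2 := by rw [w_sq, w_sq, Real.cos_add_two_pi]
  exact (pow_left_inj₀ (norm_nonneg _) (norm_nonneg _) two_ne_zero).1 h

lemma one_sub_sq_pos {r : ℝ} (hr : r ∈ Ico (0 : ℝ) 1) : 0 < 1 - r ^ 2 := by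
  nlinarith [hr.1, hr.2]

lemma mobAngle_pi (r : ℝ) : mobAngle r Real.pi = Real.pi := by simp [mobAngle]

lemma mobAngle_neg_pi (r : ℝ) : mobAngle r (-Real.pi) = -Real.pi := by simp [mobAngle]

lemma continuous_w_rpow {r : ℝ} (hr : r ∈ Ico (0 : ℝ) 1) (a : ℝ) :
    Continuous fun s => w r s ^ a :=
  (continuous_w r).rpow_const fun s => Or.inl (w_pos hr s).ne'

section

variable {α r : ℝ} {Φ : ℝ → ℝ} {k : ℝ → ℂ} (h : IsMobiusKernel α r Φ k)
  (hr : r ∈ Ico (0 : ℝ) 1) {p : ℝ≥0∞} (hp : 1 ≤ p)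

include h hr

/-- Continuity on one period suffices. Boundedness is what makes the real supremum in `weightedNorm`
meaningful for p = 1. -/
lemma IsMobiusKernel.bddAbove : BddAbove (range fun s => Φ s * w r s ^ (α + 2)) := by
  have hc : Continuous fun s => Φ s * w r s ^ (α + 2) := h.contΦ.mul (continuous_w_rpow hr _)
  have hper : Function.Periodic (fun s => Φ s * w r s ^ (α + 2)) (2 * Real.pi) := fun s => by
    simp only [h.periodicΦ s, periodic_w r s]
  rw [← hper.image_Icc Real.two_pi_pos 0]
  exact (isCompact_Icc.image hc).bddAbove

/-- The Möbius angle fixes ±π and satisfies ds = w²/(1-r²) dτ. Passing to s therefore lowers the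
exponent of w by 2 and contributes one factor 1-r² against (1-r²)^{-2q}. -/
lemma IsMobiusKernel.integral_eq {q : ℝ} (hq : 0 ≤ q) :
    ∫ τ in -Real.pi..Real.pi, ‖k τ‖ ^ q =
      (1 - r ^ 2) ^ (1 - 2 * q) *
        ∫ s in (0 : ℝ)..2 * Real.pi, Φ s ^ q * w r s ^ ((2 + α) * q - 2) := by
  have hr2 := one_sub_sq_pos hr
  set g : ℝ → ℝ := fun s => Φ s ^ q * w r s ^ ((2 + α) * q - 2) with hg
  have hgc : Continuous g :=
    (h.contΦ.rpow_const fun s => Or.inr hq).mul (continuous_w_rpow hr _)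
  have hgper : Function.Periodic g (2 * Real.pi) := fun s => by
    simp only [hg, h.periodicΦ s, periodic_w r s]
  rw [← interval_symm_eq hgper]
  have hd : Continuous fun τ => (1 - r ^ 2) / ‖1 - polar r τ‖ ^ 2 := by
    refine Continuous.div continuous_const ?_ fun τ =>
      pow_ne_zero _ (norm_ne_zero_iff.2 (one_sub_polar_ne_zero hr τ))
    unfold polar
    fun_prop
  have hsub := intervalIntegral.integral_comp_mul_deriv (a := -Real.pi) (b := Real.pi)
    (f := mobAngle r) (g := g) (fun τ _ => hasDerivAt_mobAngle hr τ) hd.continuousOn hgc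
  rw [mobAngle_pi, mobAngle_neg_pi] at hsub
  rw [← hsub, ← intervalIntegral.integral_const_mul]
  congr 1
  funext τ
  have hw := w_pos hr (mobAngle r τ)
  have hn : 0 < ‖1 - polar r τ‖ := norm_pos_iff.2 (one_sub_polar_ne_zero hr τ)
  have hd' : (1 - r ^ 2) / ‖1 - polar r τ‖ ^ 2 = w r (mobAngle r τ) ^ 2 / (1 - r ^ 2) := by
    rw [w_mobAngle hr]
    field_simp
  simp only [Function.comp_apply, hg]
  rw [hd', h.norm_eq, Real.div_rpow (mul_nonneg (h.nonneg _) (by positivity)) (by positivity),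
    Real.mul_rpow (h.nonneg _) (by positivity), ← Real.rpow_mul hw.le, ← Real.rpow_mul hr2.le,
    Real.rpow_sub hr2, Real.rpow_one, Real.rpow_sub hw, show (α + 2) * q = (2 + α) * q by ring,
    show w r (mobAngle r τ) ^ (2 : ℝ) = w r (mobAngle r τ) ^ 2 from Real.rpow_natCast _ 2]
  field_simp

/-- Taking the q-th root of (1-r²)^{1-2q} produces the exponent 1/q - 2 = -(1+1/p). -/
lemma IsMobiusKernel.norm_eq_weightedNorm (hp : 1 ≤ p) (h1 : p ≠ 1) :
    ((2 * Real.pi)⁻¹ * ∫ t in -Real.pi..Real.pi, ‖k t‖ ^ conjExp p) ^ (1 / conjExp p) =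
      weightedNorm α p r Φ / (1 - r ^ 2) ^ growthExp p := by
  have hr2 := one_sub_sq_pos hr
  have hq := conjExp_pos hp h1
  have hJ : 0 ≤ ∫ s in (0 : ℝ)..2 * Real.pi,
      Φ s ^ conjExp p * w r s ^ ((2 + α) * conjExp p - 2) :=
    intervalIntegral.integral_nonneg Real.two_pi_pos.le fun s _ =>
      mul_nonneg (Real.rpow_nonneg (h.nonneg s) _) (Real.rpow_nonneg (w_pos hr s).le _)
  rw [weightedNorm, if_neg h1, h.integral_eq hr hq.le, growthExp_eq hp h1, mul_left_comm,
    Real.mul_rpow (by positivity) (mul_nonneg (by positivity) hJ), ← Real.rpow_mul hr2.le,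
    div_eq_mul_inv _ (_ ^ _), ← Real.rpow_neg hr2.le, mul_comm]
  congr 2
  field_simp
  ring

include hp

lemma IsMobiusKernel.norm_conv_le {f : Circle → ℂ} (hf : MemLpT f p) (θ : ℝ) :
    ‖conv k f θ‖ ≤ weightedNorm α p r Φ / (1 - r ^ 2) ^ growthExp p * normLpT f p := by
  by_cases h1 : p = 1
  · subst h1
    refine norm_conv_le_of_bound h.cont (fun τ => ?_) hf θ
    have hr2 := one_sub_sq_pos hr
    rw [h.norm_eq, growthExp_one, weightedNorm, if_pos rfl]
    gcongr
    exact le_ciSup (h.bddAbove hr) (mobAngle r τ)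
  · rw [← h.norm_eq_weightedNorm hr hp h1]
    exact AlphaHarmonic.norm_conv_le h.cont h.periodic hp h1 hf θ

/-- The duality half. Testing at angle 0 suffices because the kernel norm does not depend on θ. -/
lemma IsMobiusKernel.weightedNorm_le {N : ℝ}
    (hN : ∀ f, MemLpT f p → ‖conv k f 0‖ ≤ N / (1 - r ^ 2) ^ growthExp p * normLpT f p) :
    weightedNorm α p r Φ ≤ N := by
  have hr2 := one_sub_sq_pos hr
  have hpos : 0 < (1 - r ^ 2) ^ growthExp p := by positivity
  by_cases h1 : p = 1
  · subst h1
    rw [weightedNorm, if_pos rfl]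
    refine ciSup_le fun s => ?_
    obtain ⟨τ, rfl⟩ := surjective_mobAngle hr s
    have h2 := norm_le_of_conv_le h.cont h.periodic hN τ
    rw [h.norm_eq, growthExp_one, div_le_div_iff_of_pos_right (by positivity)] at h2
    exact h2
  · have h2 := rpow_norm_le_of_conv_le h.cont h.periodic hp h1 hN
    rw [h.norm_eq_weightedNorm hr hp h1, div_le_div_iff_of_pos_right hpos] at h2
    exact h2

end

/-! ### The kernels of the four derivatives -/

lemma c_pos {α : ℝ} (hα : -1 < α) : 0 < c α :=
  div_pos (pow_pos (Real.Gamma_pos_of_pos (by linarith)) 2) (Real.Gamma_pos_of_pos (by linarith))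

lemma exp_add_two_pi_mul_I (τ : ℝ) :
    Complex.exp ((τ + 2 * Real.pi : ℝ) * Complex.I) = Complex.exp (τ * Complex.I) := by
  push_cast
  rw [add_mul, Complex.exp_add, Complex.exp_two_pi_mul_I, mul_one]

lemma periodic_H (α r : ℝ) : Function.Periodic (H α r) (2 * Real.pi) := fun τ => by
  rw [H, H, polar, polar, exp_add_two_pi_mul_I]

lemma continuous_H (α : ℝ) {r : ℝ} (hr : r ∈ Ico (0 : ℝ) 1) : Continuous (H α r) := by
  have h1 : Continuous fun τ : ℝ => polar r τ := by unfold polar; fun_prop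
  have h2 : Continuous fun τ => Kz α (polar r τ) :=
    (continuousOn_Kz α).comp_continuous h1 fun τ => by
      simpa [norm_polar hr.1 τ] using hr.2
  unfold H
  fun_prop

/-- The modulus of the radial kernel in Möbius coordinates, up to the weight. -/
def radialΦ (α r s : ℝ) : ℝ := c α * |(α + 2) * Real.cos s - α * r|

/-- The modulus of the angular kernel in Möbius coordinates, up to the weight. -/
def angularΦ (α r s : ℝ) : ℝ := c α * ((α + 2) * r * |Real.sin s|)

/-- The modulus of the Wirtinger kernels in Möbius coordinates, up to the weight. -/
def wirtingerΦ (α r s : ℝ) : ℝ :=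
  c α * (‖((α + 2 : ℝ) : ℂ) * Complex.exp (s * Complex.I) - ((α * r : ℝ) : ℂ)‖ / 2)

section

variable {α : ℝ} (hα : -1 < α) {r : ℝ} (hr : r ∈ Ico (0 : ℝ) 1)

include hα hr

lemma isMobiusKernel_radial :
    IsMobiusKernel α r (radialΦ α r) fun τ => ((2 * (H α r τ).re : ℝ) : ℂ) where
  cont := Complex.continuous_ofReal.comp
    (continuous_const.mul (Complex.continuous_re.comp (continuous_H α hr)))
  periodic τ := by simp only [periodic_H α r τ]
  contΦ := by unfold radialΦ; fun_prop
  nonneg s := mul_nonneg (c_pos hα).le (abs_nonneg _)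
  periodicΦ s := by simp only [radialΦ, Real.cos_add_two_pi]
  norm_eq τ := by
    have hr2 := one_sub_sq_pos hr
    have hw := w_pos hr (mobAngle r τ)
    have hc := c_pos hα
    rw [H_eq α hr, Complex.norm_real, Complex.re_ofReal_mul, Complex.sub_re,
      Complex.re_ofReal_mul, Complex.exp_ofReal_mul_I_re, Complex.ofReal_re, radialΦ,
      Real.norm_eq_abs, abs_mul, abs_mul, abs_of_nonneg (by positivity : (0 : ℝ) ≤
        c α / 2 * w r (mobAngle r τ) ^ (α + 2) / (1 - r ^ 2) ^ (2 : ℝ)), abs_two]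
    ring

lemma isMobiusKernel_angular :
    IsMobiusKernel α r (angularΦ α r) fun τ => ((-(2 * r * (H α r τ).im) : ℝ) : ℂ) where
  cont := Complex.continuous_ofReal.comp
    (continuous_const.mul (Complex.continuous_im.comp (continuous_H α hr))).neg
  periodic τ := by simp only [periodic_H α r τ]
  contΦ := by unfold angularΦ; fun_prop
  nonneg s := mul_nonneg (c_pos hα).le
    (mul_nonneg (mul_nonneg (by linarith) hr.1) (abs_nonneg _))
  periodicΦ s := by simp only [angularΦ, Real.sin_add_two_pi]
  norm_eq τ := by
    have hr2 := one_sub_sq_pos hr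
    have hw := w_pos hr (mobAngle r τ)
    have hc := c_pos hα
    rw [H_eq α hr, Complex.norm_real, Complex.im_ofReal_mul, Complex.sub_im,
      Complex.im_ofReal_mul, Complex.exp_ofReal_mul_I_im, Complex.ofReal_im, angularΦ, sub_zero,
      Real.norm_eq_abs, abs_neg, abs_mul, abs_mul, abs_mul, abs_mul,
      abs_of_nonneg (by positivity : (0 : ℝ) ≤
        c α / 2 * w r (mobAngle r τ) ^ (α + 2) / (1 - r ^ 2) ^ (2 : ℝ)), abs_two,
      abs_of_nonneg hr.1, abs_of_pos (by linarith : 0 < α + 2)]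
    ring

lemma isMobiusKernel_wirtinger : IsMobiusKernel α r (wirtingerΦ α r) (H α r) where
  cont := continuous_H α hr
  periodic := periodic_H α r
  contΦ := by unfold wirtingerΦ; fun_prop
  nonneg s := mul_nonneg (c_pos hα).le (by positivity)
  periodicΦ s := by simp only [wirtingerΦ, exp_add_two_pi_mul_I]
  norm_eq τ := by
    have hr2 := one_sub_sq_pos hr
    have hw := w_pos hr (mobAngle r τ)
    have hc := c_pos hα
    rw [H_eq α hr, norm_mul, Complex.norm_real, wirtingerΦ, Real.norm_of_nonneg (by positivity)]
    ring

lemma isMobiusKernel_wirtinger_conj :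
    IsMobiusKernel α r (wirtingerΦ α r) fun τ => (starRingEnd ℂ) (H α r τ) where
  cont := Complex.continuous_conj.comp (continuous_H α hr)
  periodic τ := by simp only [periodic_H α r τ]
  contΦ := (isMobiusKernel_wirtinger hα hr).contΦ
  nonneg := (isMobiusKernel_wirtinger hα hr).nonneg
  periodicΦ := (isMobiusKernel_wirtinger hα hr).periodicΦ
  norm_eq τ := by rw [RCLike.norm_conj, (isMobiusKernel_wirtinger hα hr).norm_eq]

end

/-- `Φ` describes the kernels of the first order derivative `D` of `P_α[f]`. -/
structure HasMobiusKernel (D : (ℂ → ℂ) → ℝ → ℝ → ℂ) (α : ℝ) (Φ : ℝ → ℝ → ℝ) : Prop where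
  exists_kernel : ∀ r ∈ Ico (0 : ℝ) 1, ∃ k, IsMobiusKernel α r (Φ r) k ∧
    ∀ f : Circle → ℂ, Integrable (fun t : ℝ => f (Circle.exp t)) angleMeasure →
      ∀ θ, ‖D (P α f) r θ‖ = ‖conv k f θ‖

lemma hasMobiusKernel_dR {α : ℝ} (hα : -1 < α) : HasMobiusKernel dR α (radialΦ α) :=
  ⟨fun _ hr => ⟨_, isMobiusKernel_radial hα hr, fun _ hf θ => by rw [dR_P_eq hf hr]⟩⟩

lemma hasMobiusKernel_dTheta {α : ℝ} (hα : -1 < α) : HasMobiusKernel dTheta α (angularΦ α) :=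
  ⟨fun _ hr => ⟨_, isMobiusKernel_angular hα hr, fun _ hf θ => by rw [dTheta_P_eq hf hr]⟩⟩

lemma hasMobiusKernel_dZ {α : ℝ} (hα : -1 < α) : HasMobiusKernel dZ α (wirtingerΦ α) :=
  ⟨fun _ hr => ⟨_, isMobiusKernel_wirtinger hα hr, fun _ hf θ => by
    rw [dZ_P_eq hf hr, norm_mul, ← neg_mul, ← Complex.ofReal_neg, Complex.norm_exp_ofReal_mul_I,
      one_mul]⟩⟩

lemma hasMobiusKernel_dZbar {α : ℝ} (hα : -1 < α) : HasMobiusKernel dZbar α (wirtingerΦ α) :=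
  ⟨fun _ hr => ⟨_, isMobiusKernel_wirtinger_conj hα hr, fun _ hf θ => by
    rw [dZbar_P_eq hf hr, norm_mul, Complex.norm_exp_ofReal_mul_I, one_mul]⟩⟩

section

variable {D : (ℂ → ℂ) → ℝ → ℝ → ℂ} {α : ℝ} {Φ : ℝ → ℝ → ℝ} (h : HasMobiusKernel D α Φ)
  {p : ℝ≥0∞} (hp : 1 ≤ p)

include h hp

lemma HasMobiusKernel.norm_le {f : Circle → ℂ} (hf : MemLpT f p) {r : ℝ}
    (hr : r ∈ Ico (0 : ℝ) 1) (θ : ℝ) {N : ℝ} (hN : weightedNorm α p r (Φ r) ≤ N) :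
    ‖D (P α f) r θ‖ ≤ N / (1 - r ^ 2) ^ growthExp p * normLpT f p := by
  obtain ⟨k, hk, hD⟩ := h.exists_kernel r hr
  have hr2 := one_sub_sq_pos hr
  rw [hD f (hf.integrable hp)]
  refine (hk.norm_conv_le hr hp hf θ).trans ?_
  gcongr
  exact normLpT_nonneg _ _

lemma HasMobiusKernel.weightedNorm_le {N : ℝ} (hN : N ∈ Admissible D α p) {r : ℝ}
    (hr : r ∈ Ico (0 : ℝ) 1) : weightedNorm α p r (Φ r) ≤ N := by
  obtain ⟨k, hk, hD⟩ := h.exists_kernel r hr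
  refine hk.weightedNorm_le hr hp fun f hf => ?_
  rw [← hD f (hf.integrable hp)]
  exact hN f hf r hr 0

/-- The least upper bound of the norms of the kernels is the best constant. -/
lemma HasMobiusKernel.isSharp {M : ℝ}
    (hM : IsLUB ((fun r => weightedNorm α p r (Φ r)) '' Ico 0 1) M) : IsSharp D α p M :=
  ⟨fun _ hf _ hr θ => h.norm_le hp hf hr θ (hM.1 (mem_image_of_mem _ hr)),
    fun _ hN => hM.2 (forall_mem_image.2 fun _ hr => h.weightedNorm_le hp hN hr)⟩

end

/-! ### Powers of the sine and the Beta function -/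

lemma betaIntegrand_eq {x : ℝ} (hx : x ∈ Ioo (0 : ℝ) 1) (u v : ℝ) :
    (x : ℂ) ^ ((u : ℂ) - 1) * (1 - (x : ℂ)) ^ ((v : ℂ) - 1) =
      ((x ^ (u - 1) * (1 - x) ^ (v - 1) : ℝ) : ℂ) := by
  rw [Complex.ofReal_mul, Complex.ofReal_cpow hx.1.le,
    Complex.ofReal_cpow (by linarith [hx.2] : (0 : ℝ) ≤ 1 - x)]
  push_cast
  rfl

lemma integrableOn_betaIntegrand {u v : ℝ} (hu : 0 < u) (hv : 0 < v) :
    IntegrableOn (fun x : ℝ => x ^ (u - 1) * (1 - x) ^ (v - 1)) (Ioo 0 1) := by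
  have h := Complex.betaIntegral_convergent (u := u) (v := v) (by simpa) (by simpa)
  rw [intervalIntegrable_iff_integrableOn_Ioo_of_le zero_le_one] at h
  refine (Integrable.re h).congr ?_
  filter_upwards [ae_restrict_mem measurableSet_Ioo] with x hx
  rw [betaIntegrand_eq hx]
  rfl

lemma setIntegral_betaIntegrand {u v : ℝ} (hu : 0 < u) (hv : 0 < v) :
    ∫ x in Ioo (0 : ℝ) 1, x ^ (u - 1) * (1 - x) ^ (v - 1) = ProbabilityTheory.beta u v := by
  rw [ProbabilityTheory.beta_eq_betaIntegralReal u v hu hv, Complex.betaIntegral,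
    intervalIntegral.integral_of_le zero_le_one, integral_Ioc_eq_integral_Ioo,
    setIntegral_congr_fun measurableSet_Ioo fun x hx => betaIntegrand_eq hx u v,
    integral_complex_ofReal, Complex.ofReal_re]

lemma image_sin_sq : (fun t => Real.sin t ^ 2) '' Ioo 0 (Real.pi / 2) = Ioo 0 1 := by
  apply Subset.antisymm
  · rintro _ ⟨t, ht, rfl⟩
    have h1 : 0 < Real.sin t := Real.sin_pos_of_pos_of_lt_pi ht.1 (by linarith [ht.2, Real.pi_pos])
    have h2 : 0 < Real.cos t := Real.cos_pos_of_mem_Ioo ⟨by linarith [ht.1, Real.pi_pos], ht.2⟩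
    constructor
    · positivity
    · nlinarith [Real.sin_sq_add_cos_sq t]
  · have := intermediate_value_Ioo (a := 0) (b := Real.pi / 2) (by positivity)
      (f := fun t => Real.sin t ^ 2) (by fun_prop)
    simpa using this

lemma injOn_sin_sq : InjOn (fun t => Real.sin t ^ 2) (Ioo 0 (Real.pi / 2)) := by
  intro x hx y hy hxy
  have h1 : 0 ≤ Real.sin x :=
    (Real.sin_pos_of_pos_of_lt_pi hx.1 (by linarith [hx.2, Real.pi_pos])).le
  have h2 : 0 ≤ Real.sin y :=
    (Real.sin_pos_of_pos_of_lt_pi hy.1 (by linarith [hy.2, Real.pi_pos])).le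
  refine Real.injOn_sin ⟨by linarith [hx.1, Real.pi_pos], hx.2.le⟩
    ⟨by linarith [hy.1, Real.pi_pos], hy.2.le⟩ ?_
  exact (pow_left_inj₀ h1 h2 two_ne_zero).1 hxy

/-- The substitution x = sin² t in the Beta integrand: the second parameter 1/2 makes the cosine of
the Jacobian cancel. -/
lemma sin_substitution {a t : ℝ} (ht : t ∈ Ioo 0 (Real.pi / 2)) :
    |2 * Real.sin t * Real.cos t| • ((Real.sin t ^ 2) ^ ((a + 1) / 2 - 1) *
      (1 - Real.sin t ^ 2) ^ ((1 / 2 : ℝ) - 1)) = 2 * Real.sin t ^ a := by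
  have h1 : 0 < Real.sin t := Real.sin_pos_of_pos_of_lt_pi ht.1 (by linarith [ht.2, Real.pi_pos])
  have h2 : 0 < Real.cos t := Real.cos_pos_of_mem_Ioo ⟨by linarith [ht.1, Real.pi_pos], ht.2⟩
  rw [abs_of_pos (by positivity), ← Real.cos_sq', ← Real.rpow_natCast, ← Real.rpow_natCast,
    ← Real.rpow_mul h1.le, ← Real.rpow_mul h2.le, smul_eq_mul]
  have e1 : Real.sin t ^ a = Real.sin t * Real.sin t ^ (((2 : ℕ) : ℝ) * ((a + 1) / 2 - 1)) := by
    conv_lhs => rw [show a = 1 + ((2 : ℕ) : ℝ) * ((a + 1) / 2 - 1) by push_cast; ring]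
    rw [Real.rpow_add h1, Real.rpow_one]
  have e2 : Real.cos t * Real.cos t ^ (((2 : ℕ) : ℝ) * (1 / 2 - 1)) = 1 := by
    rw [show ((2 : ℕ) : ℝ) * (1 / 2 - 1) = -1 by norm_num, Real.rpow_neg_one,
      mul_inv_cancel₀ h2.ne']
  rw [e1]
  linear_combination (2 * Real.sin t * Real.sin t ^ (((2 : ℕ) : ℝ) * ((a + 1) / 2 - 1))) * e2

lemma hasDerivAt_sin_sq (t : ℝ) :
    HasDerivAt (fun t => Real.sin t ^ 2) (2 * Real.sin t * Real.cos t) t := by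
  simpa using (Real.hasDerivAt_sin t).fun_pow 2

/-- For negative a the integrand blows up at 0, so integrability is transported from the Beta
integrand rather than obtained from continuity. -/
lemma intervalIntegrable_sin_rpow_half {a : ℝ} (ha : -1 < a) :
    IntervalIntegrable (fun t => Real.sin t ^ a) volume 0 (Real.pi / 2) := by
  have h := integrableOn_betaIntegrand (u := (a + 1) / 2) (v := 1 / 2) (by linarith) (by norm_num)
  rw [← image_sin_sq, integrableOn_image_iff_integrableOn_abs_deriv_smul measurableSet_Ioo
    (fun t _ => (hasDerivAt_sin_sq t).hasDerivWithinAt) injOn_sin_sq] at h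
  rw [intervalIntegrable_iff_integrableOn_Ioo_of_le (by positivity)]
  have h2 := (h.congr_fun (fun t ht => sin_substitution ht) measurableSet_Ioo).const_mul (1 / 2)
  simpa [IntegrableOn] using h2

lemma integral_sin_rpow_half {a : ℝ} (ha : -1 < a) :
    2 * ∫ t in (0 : ℝ)..Real.pi / 2, Real.sin t ^ a =
      ProbabilityTheory.beta ((a + 1) / 2) (1 / 2) := by
  rw [← setIntegral_betaIntegrand (by linarith) (by norm_num), ← image_sin_sq,
    integral_image_eq_integral_abs_deriv_smul measurableSet_Ioo
    (fun t _ => (hasDerivAt_sin_sq t).hasDerivWithinAt) injOn_sin_sq,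
    setIntegral_congr_fun measurableSet_Ioo fun t ht => sin_substitution ht,
    integral_const_mul, intervalIntegral.integral_of_le (by positivity),
    integral_Ioc_eq_integral_Ioo]

lemma intervalIntegrable_cos_rpow_half {a : ℝ} (ha : -1 < a) :
    IntervalIntegrable (fun t => Real.cos t ^ a) volume 0 (Real.pi / 2) := by
  have h := ((intervalIntegrable_sin_rpow_half ha).comp_sub_left (Real.pi / 2)).symm
  simpa [Real.sin_pi_div_two_sub] using h

lemma integral_cos_rpow_half (a : ℝ) :
    ∫ t in (0 : ℝ)..Real.pi / 2, Real.cos t ^ a = ∫ t in (0 : ℝ)..Real.pi / 2, Real.sin t ^ a := by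
  have h := intervalIntegral.integral_comp_sub_left (a := 0) (b := Real.pi / 2)
    (fun t => Real.sin t ^ a) (Real.pi / 2)
  simpa [Real.sin_pi_div_two_sub] using h

lemma integral_sin_rpow {a : ℝ} (ha : -1 < a) :
    ∫ t in (0 : ℝ)..Real.pi, Real.sin t ^ a = ProbabilityTheory.beta ((a + 1) / 2) (1 / 2) := by
  have h1 := intervalIntegrable_sin_rpow_half ha
  have h2 : IntervalIntegrable (fun t => Real.sin t ^ a) volume (Real.pi / 2) Real.pi := by
    have := (h1.comp_sub_left Real.pi).symm
    simpa [Real.sin_pi_sub, show Real.pi - Real.pi / 2 = Real.pi / 2 by ring] using this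
  have h3 : ∫ t in Real.pi / 2..Real.pi, Real.sin t ^ a =
      ∫ t in (0 : ℝ)..Real.pi / 2, Real.sin t ^ a := by
    have h := intervalIntegral.integral_comp_sub_left (a := Real.pi / 2) (b := Real.pi)
      (fun t => Real.sin t ^ a) Real.pi
    simpa [Real.sin_pi_sub, show Real.pi - Real.pi / 2 = Real.pi / 2 by ring] using h
  rw [← intervalIntegral.integral_add_adjacent_intervals h1 h2, h3,
    ← integral_sin_rpow_half ha]
  ring

lemma one_add_cos (t : ℝ) : 2 + 2 * Real.cos t = 4 * Real.cos (t / 2) ^ 2 := by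
  rw [Real.cos_sq]
  ring_nf

lemma cos_half_nonneg {t : ℝ} (ht : t ∈ Icc 0 Real.pi) : 0 ≤ Real.cos (t / 2) :=
  Real.cos_nonneg_of_mem_Icc ⟨by linarith [ht.1, Real.pi_pos], by linarith [ht.2]⟩

lemma one_add_cos_rpow {t : ℝ} (ht : t ∈ Icc 0 Real.pi) (m : ℝ) :
    (2 + 2 * Real.cos t) ^ m = 4 ^ m * Real.cos (t / 2) ^ (2 * m) := by
  have h := cos_half_nonneg ht
  rw [one_add_cos, Real.mul_rpow (by norm_num) (by positivity), ← Real.rpow_natCast,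
    ← Real.rpow_mul h]
  norm_num

/-- By the half angle formula 2 + 2 cos t vanishes to second order at π, which explains the
threshold -1/2. -/
lemma intervalIntegrable_one_add_cos_rpow {m : ℝ} (hm : -1 / 2 < m) :
    IntervalIntegrable (fun t => (2 + 2 * Real.cos t) ^ m) volume 0 Real.pi := by
  have h := (intervalIntegrable_cos_rpow_half (a := 2 * m) (by linarith)).comp_mul_right
    (c := (1 / 2 : ℝ))
  have h' := h.const_mul (4 ^ m)
  have e : Real.pi / 2 / (1 / 2) = Real.pi := by ring
  rw [zero_div, e] at h'
  refine h'.congr fun t ht => ?_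
  rw [uIoc_of_le Real.pi_pos.le] at ht
  rw [one_add_cos_rpow ⟨ht.1.le, ht.2⟩]
  congr 3
  ring

/-- Half angles reduce this to a Beta integral, and Legendre's duplication formula brings it to the
Gamma quotient; its factor 2^{-2m} cancels 4^m. -/
lemma integral_one_add_cos_rpow {m : ℝ} (hm : -1 / 2 < m) :
    ∫ t in (0 : ℝ)..Real.pi, (2 + 2 * Real.cos t) ^ m =
      Real.pi * (Real.Gamma (2 * m + 1) / Real.Gamma (m + 1) ^ 2) := by
  have e1 : ∫ t in (0 : ℝ)..Real.pi, (2 + 2 * Real.cos t) ^ m =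
      ∫ t in (0 : ℝ)..Real.pi, 4 ^ m * Real.cos (t / 2) ^ (2 * m) := by
    refine intervalIntegral.integral_congr fun t ht => ?_
    rw [uIcc_of_le Real.pi_pos.le] at ht
    exact one_add_cos_rpow ht m
  have e2 := intervalIntegral.integral_comp_div (a := 0) (b := Real.pi)
    (fun t => Real.cos t ^ (2 * m)) (two_ne_zero (α := ℝ))
  rw [e1, intervalIntegral.integral_const_mul, e2, zero_div, integral_cos_rpow_half, smul_eq_mul,
    integral_sin_rpow_half (by linarith), ProbabilityTheory.beta, Real.Gamma_one_half_eq,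
    show (2 * m + 1) / 2 + 1 / 2 = m + 1 by ring]
  have hd := Real.Gamma_mul_Gamma_add_half ((2 * m + 1) / 2)
  rw [show (2 * m + 1) / 2 + 1 / 2 = m + 1 by ring,
    show 2 * ((2 * m + 1) / 2) = 2 * m + 1 by ring,
    show 1 - (2 * m + 1) = -(2 * m) by ring, Real.rpow_neg (by norm_num)] at hd
  have hG : 0 < Real.Gamma (m + 1) := Real.Gamma_pos_of_pos (by linarith)
  have h4 : (4 : ℝ) ^ m = 2 ^ (2 * m) := by
    rw [Real.rpow_mul (by norm_num)]; norm_num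
  have hpow : (0 : ℝ) < 2 ^ (2 * m) := by positivity
  have hs : √Real.pi * √Real.pi = Real.pi := Real.mul_self_sqrt Real.pi_pos.le
  rw [h4]
  field_simp at hd ⊢
  linear_combination √Real.pi * hd + Real.Gamma (2 * m + 1) * hs

/-! ### Weighted means of powers of `1 + r² + 2 r cos t` -/

/-- `1 + r² + 2 r cos t = |1 + r e^{it}|²`. -/
def Q (r t : ℝ) : ℝ := 1 + r ^ 2 + 2 * r * Real.cos t

/-- The weighted mean `∫_0^π (sin t)^q |1 + r e^{it}|^{2m} dt`. -/
def sinMean (q m r : ℝ) : ℝ := ∫ t in (0 : ℝ)..Real.pi, Real.sin t ^ q * Q r t ^ m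

/-- The integral `∫_0^π (sin t)^q (r + cos t) |1 + r e^{it}|^{2m-2} dt`, half the logarithmic
derivative of the weighted mean with respect to the exponent. -/
def sinMeanAux (q m r : ℝ) : ℝ :=
  ∫ t in (0 : ℝ)..Real.pi, Real.sin t ^ q * ((r + Real.cos t) * Q r t ^ (m - 1))

lemma Q_pos {r : ℝ} (hr : r ∈ Ioo (-1 : ℝ) 1) (t : ℝ) : 0 < Q r t := by
  rw [Q]
  nlinarith [Real.sin_sq_add_cos_sq t, sq_nonneg (r + Real.cos t), Real.neg_one_le_cos t,
    Real.cos_le_one t, hr.1, hr.2, sq_nonneg (1 - r), sq_nonneg (1 + r),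
    mul_pos (by linarith [hr.1] : 0 < 1 + r) (by linarith [hr.2] : 0 < 1 - r)]

lemma Ico_subset_Ioo' : Ico (0 : ℝ) 1 ⊆ Ioo (-1) 1 := fun _ h => ⟨by linarith [h.1], h.2⟩

lemma hasDerivAt_Q (r t : ℝ) : HasDerivAt (fun r => Q r t) (2 * (r + Real.cos t)) r := by
  unfold Q
  have h := (((hasDerivAt_id r).fun_pow 2).const_add 1).fun_add
    (((hasDerivAt_id r).const_mul 2).mul_const (Real.cos t))
  refine h.congr_deriv ?_
  simp
  ring

lemma hasDerivAt_Q_right (r t : ℝ) : HasDerivAt (Q r) (-(2 * r * Real.sin t)) t := by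
  unfold Q
  simpa using ((Real.hasDerivAt_cos t).const_mul (2 * r)).const_add (1 + r ^ 2)

lemma continuousOn_Q_rpow (m : ℝ) :
    ContinuousOn (fun x : ℝ × ℝ => Q x.1 x.2 ^ m) (Ioo (-1) 1 ×ˢ univ) := by
  refine ContinuousOn.rpow_const ?_ fun x hx => Or.inl (Q_pos hx.1 x.2).ne'
  unfold Q
  fun_prop

lemma continuous_Q_rpow {r : ℝ} (hr : r ∈ Ioo (-1 : ℝ) 1) (m : ℝ) :
    Continuous fun t => Q r t ^ m := by
  refine Continuous.rpow_const ?_ fun t => Or.inl (Q_pos hr t).ne'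
  unfold Q
  fun_prop

lemma continuous_sin_rpow {q : ℝ} (hq : 0 ≤ q) : Continuous fun t => Real.sin t ^ q :=
  Real.continuous_sin.rpow_const fun _ => Or.inr hq

/-- Differentiation under the integral sign, for a continuous derivative. -/
lemma hasDerivAt_integral_of_continuousOn {φ φ' : ℝ → ℝ → ℝ} {a b : ℝ}
    (hc' : ContinuousOn (fun x : ℝ × ℝ => φ' x.1 x.2) (Ioo (-1) 1 ×ˢ univ))
    (hc : ∀ r ∈ Ioo (-1 : ℝ) 1, Continuous (φ r))
    (hd : ∀ r ∈ Ioo (-1 : ℝ) 1, ∀ t, HasDerivAt (fun r => φ r t) (φ' r t) r) {r : ℝ}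
    (hr : r ∈ Ioo (-1 : ℝ) 1) :
    HasDerivAt (fun r => ∫ t in a..b, φ r t) (∫ t in a..b, φ' r t) r := by
  obtain ⟨u, hu1, hur⟩ := exists_between hr.1
  obtain ⟨v, hrv, hv1⟩ := exists_between hr.2
  have hsub : Icc u v ⊆ Ioo (-1 : ℝ) 1 := fun x hx => ⟨by linarith [hx.1], by linarith [hx.2]⟩
  obtain ⟨C, hC⟩ := (isCompact_Icc.prod (isCompact_uIcc (a := a) (b := b))).exists_bound_of_continuousOn
    (hc'.mono (prod_mono hsub (subset_univ _)))
  have hcr : ∀ x ∈ Ioo (-1 : ℝ) 1, Continuous (φ' x) := fun x hx =>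
    hc'.comp_continuous (by fun_prop : Continuous fun t : ℝ => (x, t)) fun t => ⟨hx, mem_univ _⟩
  refine (intervalIntegral.hasDerivAt_integral_of_dominated_loc_of_deriv_le (s := Icc u v)
    (bound := fun _ => C) (Icc_mem_nhds hur hrv) ?_ ((hc r hr).intervalIntegrable _ _)
    (hcr r hr).aestronglyMeasurable ?_ (by simp) ?_).2
  · filter_upwards [Ioo_mem_nhds hr.1 hr.2] with x hx using (hc x hx).aestronglyMeasurable
  · exact Eventually.of_forall fun t ht x hx => hC (x, t) ⟨hx, uIoc_subset_uIcc ht⟩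
  · exact Eventually.of_forall fun t _ x hx => hd x (hsub hx) t

section

variable {q : ℝ} (hq : 0 ≤ q) (m : ℝ) {r : ℝ} (hr : r ∈ Ioo (-1 : ℝ) 1)

include hq hr

lemma hasDerivAt_sinMean : HasDerivAt (sinMean q m) (2 * m * sinMeanAux q m r) r := by
  have h := hasDerivAt_integral_of_continuousOn (a := 0) (b := Real.pi)
    (φ := fun r t => Real.sin t ^ q * Q r t ^ m)
    (φ' := fun r t => Real.sin t ^ q * (2 * (r + Real.cos t) * m * Q r t ^ (m - 1)))
    ?_ ?_ ?_ hr
  · refine h.congr_deriv ?_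
    rw [sinMeanAux, ← intervalIntegral.integral_const_mul]
    congr 1
    funext t
    ring
  · have := continuousOn_Q_rpow (m - 1)
    have h2 := ((continuous_sin_rpow hq).comp (continuous_snd (X := ℝ) (Y := ℝ))).continuousOn
      (s := Ioo (-1 : ℝ) 1 ×ˢ univ)
    exact h2.mul (ContinuousOn.mul (by fun_prop) this)
  · exact fun x hx => (continuous_sin_rpow hq).mul (continuous_Q_rpow hx m)
  · exact fun x hx t => ((hasDerivAt_Q x t).rpow_const (Or.inl (Q_pos hx t).ne')).const_mul _

lemma hasDerivAt_sinMeanAux :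
    HasDerivAt (sinMeanAux q m) (∫ t in (0 : ℝ)..Real.pi, Real.sin t ^ q *
      (Q r t ^ (m - 1) + 2 * (m - 1) * (r + Real.cos t) ^ 2 * Q r t ^ (m - 2))) r := by
  refine hasDerivAt_integral_of_continuousOn (a := 0) (b := Real.pi)
    (φ := fun r t => Real.sin t ^ q * ((r + Real.cos t) * Q r t ^ (m - 1)))
    (φ' := fun r t => Real.sin t ^ q *
      (Q r t ^ (m - 1) + 2 * (m - 1) * (r + Real.cos t) ^ 2 * Q r t ^ (m - 2)))
    ?_ ?_ ?_ hr
  · have h2 := ((continuous_sin_rpow hq).comp (continuous_snd (X := ℝ) (Y := ℝ))).continuousOn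
      (s := Ioo (-1 : ℝ) 1 ×ˢ univ)
    exact h2.mul ((continuousOn_Q_rpow (m - 1)).add
      (ContinuousOn.mul (by fun_prop) (continuousOn_Q_rpow (m - 2))))
  · exact fun x hx => (continuous_sin_rpow hq).mul
      (Continuous.mul (by fun_prop) (continuous_Q_rpow hx _))
  · intro x hx t
    have h := (((hasDerivAt_id x).add_const (Real.cos t)).fun_mul
      ((hasDerivAt_Q x t).rpow_const (p := m - 1) (Or.inl (Q_pos hx t).ne'))).const_mul
        (Real.sin t ^ q)
    refine h.congr_deriv ?_
    rw [show m - 1 - 1 = m - 2 by ring]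
    simp only [id]
    ring

lemma intervalIntegrable_sin_Q {g : ℝ → ℝ} (hg : Continuous g) (k a b : ℝ) :
    IntervalIntegrable (fun t => Real.sin t ^ q * (g t * Q r t ^ k)) volume a b :=
  ((continuous_sin_rpow hq).mul (hg.mul (continuous_Q_rpow hr k))).intervalIntegrable _ _

/-- Pointwise, 2r(r + cos t) = Q - (1-r²). -/
lemma two_mul_sinMeanAux :
    2 * r * sinMeanAux q m r = sinMean q m r - (1 - r ^ 2) * sinMean q (m - 1) r := by
  have h1 := intervalIntegrable_sin_Q hq hr (g := fun _ => 1) continuous_const m 0 Real.pi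
  have h2 := intervalIntegrable_sin_Q hq hr (g := fun _ => 1) continuous_const (m - 1) 0 Real.pi
  simp only [one_mul] at h1 h2
  rw [sinMeanAux, sinMean, sinMean, ← intervalIntegral.integral_const_mul,
    ← intervalIntegral.integral_const_mul,
    ← intervalIntegral.integral_sub h1 (h2.const_mul _)]
  congr 1
  funext t
  have hQ := Q_pos hr t
  have e : Q r t ^ m = Q r t ^ (m - 1) * Q r t := by
    rw [← Real.rpow_add_one hQ.ne']
    congr 1
    ring
  rw [e, Q]
  ring

/-- The derivative of (sin t)^{q+1} Q^{m-1} integrates to zero because the sine vanishes at 0 and π.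
-/
lemma integral_by_parts_sin_Q :
    (q + 1) * ∫ t in (0 : ℝ)..Real.pi, Real.sin t ^ q * (Real.cos t * Q r t ^ (m - 1)) =
      2 * r * (m - 1) *
        ∫ t in (0 : ℝ)..Real.pi, Real.sin t ^ q * (Real.sin t ^ 2 * Q r t ^ (m - 2)) := by
  have h1 := intervalIntegrable_sin_Q hq hr Real.continuous_cos (m - 1) 0 Real.pi
  have h2 := intervalIntegrable_sin_Q hq hr (g := fun t => Real.sin t ^ 2) (by fun_prop)
    (m - 2) 0 Real.pi
  have hd : ∀ t ∈ uIcc 0 Real.pi, HasDerivAt (fun t => Real.sin t ^ (q + 1) * Q r t ^ (m - 1))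
      ((q + 1) * (Real.sin t ^ q * (Real.cos t * Q r t ^ (m - 1))) -
        2 * r * (m - 1) * (Real.sin t ^ q * (Real.sin t ^ 2 * Q r t ^ (m - 2)))) t := by
    intro t ht
    rw [uIcc_of_le Real.pi_pos.le] at ht
    have hs : 0 ≤ Real.sin t := Real.sin_nonneg_of_mem_Icc ht
    have h := ((Real.hasDerivAt_sin t).rpow_const (p := q + 1) (Or.inr (by linarith))).fun_mul
      ((hasDerivAt_Q_right r t).rpow_const (p := m - 1) (Or.inl (Q_pos hr t).ne'))
    refine h.congr_deriv ?_
    rw [show m - 1 - 1 = m - 2 by ring, show q + 1 - 1 = q by ring,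
      Real.rpow_add_one' hs (by linarith)]
    ring
  have h := intervalIntegral.integral_eq_sub_of_hasDerivAt hd
    ((h1.const_mul _).sub (h2.const_mul _))
  rw [intervalIntegral.integral_sub (h1.const_mul _) (h2.const_mul _),
    intervalIntegral.integral_const_mul, intervalIntegral.integral_const_mul, Real.sin_pi,
    Real.sin_zero, Real.zero_rpow (by linarith)] at h
  linarith

/-- The differential equation satisfied by the weighted mean, in divergence form. -/
lemma sinMeanAux_deriv_eq :
    r * (∫ t in (0 : ℝ)..Real.pi, Real.sin t ^ q *
      (Q r t ^ (m - 1) + 2 * (m - 1) * (r + Real.cos t) ^ 2 * Q r t ^ (m - 2)))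
      + (q + 1) * sinMeanAux q m r = r * (q + 2 * m) * sinMean q (m - 1) r := by
  have hc := intervalIntegrable_sin_Q hq hr Real.continuous_cos (m - 1) 0 Real.pi
  have h1 := intervalIntegrable_sin_Q hq hr (g := fun _ => 1) continuous_const (m - 1) 0 Real.pi
  have hs := intervalIntegrable_sin_Q hq hr (g := fun t => Real.sin t ^ 2) (by fun_prop)
    (m - 2) 0 Real.pi
  have hT := intervalIntegrable_sin_Q hq hr (g := fun t => (r + Real.cos t) ^ 2) (by fun_prop)
    (m - 2) 0 Real.pi
  simp only [one_mul] at h1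
  have e1 : sinMeanAux q m r = r * sinMean q (m - 1) r +
      ∫ t in (0 : ℝ)..Real.pi, Real.sin t ^ q * (Real.cos t * Q r t ^ (m - 1)) := by
    rw [sinMeanAux, sinMean, ← intervalIntegral.integral_const_mul,
      ← intervalIntegral.integral_add (h1.const_mul _) hc]
    congr 1
    funext t
    ring
  have e2 : (∫ t in (0 : ℝ)..Real.pi, Real.sin t ^ q *
      (Q r t ^ (m - 1) + 2 * (m - 1) * (r + Real.cos t) ^ 2 * Q r t ^ (m - 2))) =
      sinMean q (m - 1) r + 2 * (m - 1) *
        ∫ t in (0 : ℝ)..Real.pi, Real.sin t ^ q * ((r + Real.cos t) ^ 2 * Q r t ^ (m - 2)) := by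
    rw [sinMean, ← intervalIntegral.integral_const_mul,
      ← intervalIntegral.integral_add h1 (hT.const_mul _)]
    congr 1
    funext t
    ring
  -- Since Q = (r + cos t)² + sin² t, the square in the second derivative can be traded for sin² t,
  -- which is what integration by parts handles.
  have e3 : (∫ t in (0 : ℝ)..Real.pi, Real.sin t ^ q * ((r + Real.cos t) ^ 2 * Q r t ^ (m - 2))) +
      (∫ t in (0 : ℝ)..Real.pi, Real.sin t ^ q * (Real.sin t ^ 2 * Q r t ^ (m - 2))) =
      sinMean q (m - 1) r := by
    rw [sinMean, ← intervalIntegral.integral_add hT hs]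
    congr 1
    funext t
    have e : Q r t ^ (m - 1) = Q r t ^ (m - 2) * Q r t := by
      rw [← Real.rpow_add_one (Q_pos hr t).ne']
      congr 1
      ring
    have hQ : Q r t = (r + Real.cos t) ^ 2 + Real.sin t ^ 2 := by
      rw [Q]
      linarith [Real.sin_sq_add_cos_sq t]
    rw [e]
    linear_combination (-(Real.sin t ^ q * Q r t ^ (m - 2))) * hQ
  have e4 := integral_by_parts_sin_Q hq m hr
  rw [e1, e2]
  linear_combination e4 + 2 * r * (m - 1) * e3

lemma sinMean_pos : 0 < sinMean q m r := by
  refine intervalIntegral.intervalIntegral_pos_of_pos_on ?_ (fun t ht => ?_) Real.pi_pos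
  · simpa using intervalIntegrable_sin_Q hq hr (g := fun _ => 1) continuous_const m 0 Real.pi
  · have := Real.sin_pos_of_mem_Ioo ht
    have := Q_pos hr t
    positivity

end

/-- With integrating factor r^{q+1}, the divergence form says that m r^{q+1} times the auxiliary
integral has derivative m(q+2m) r^{q+1} times a positive mean. It vanishes at 0, hence is
nonnegative afterwards. -/
lemma sinMeanAux_nonneg {q m r : ℝ} (hq : 0 ≤ q) (h : 0 ≤ m * (q + 2 * m))
    (hr : r ∈ Ico (0 : ℝ) 1) : 0 ≤ m * sinMeanAux q m r := by
  -- At r = 0 the integrating factor is lost, but there the equation itself reads (q+1) times the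
  -- auxiliary integral = 0.
  rcases hr.1.eq_or_lt with h0 | h0
  · subst h0
    have h1 := sinMeanAux_deriv_eq hq m (r := 0) (by norm_num)
    have : sinMeanAux q m 0 = 0 := by
      rw [zero_mul, zero_mul, zero_mul, zero_add] at h1
      exact (mul_eq_zero.1 h1).resolve_left (by linarith)
    rw [this, mul_zero]
  · have hmono : MonotoneOn (fun x => m * (x ^ (q + 1) * sinMeanAux q m x)) (Icc 0 r) := by
      refine monotoneOn_of_deriv_nonneg (convex_Icc 0 r) ?_ ?_ ?_
      · intro x hx
        have hx' : x ∈ Ioo (-1 : ℝ) 1 := ⟨by linarith [hx.1], by linarith [hx.2, hr.2]⟩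
        have h1 : ContinuousAt (fun x : ℝ => x ^ (q + 1)) x :=
          Real.continuousAt_rpow_const _ _ (Or.inr (by linarith))
        exact (continuousAt_const.mul
          (h1.mul (hasDerivAt_sinMeanAux hq m hx').continuousAt)).continuousWithinAt
      · intro x hx
        rw [interior_Icc] at hx
        have hx' : x ∈ Ioo (-1 : ℝ) 1 := ⟨by linarith [hx.1], by linarith [hx.2, hr.2]⟩
        exact (((hasDerivAt_id x).rpow_const (Or.inl hx.1.ne')).fun_mul
          (hasDerivAt_sinMeanAux hq m hx')).const_mul m |>.differentiableAt.differentiableWithinAt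
      · intro x hx
        rw [interior_Icc] at hx
        have hx' : x ∈ Ioo (-1 : ℝ) 1 := ⟨by linarith [hx.1], by linarith [hx.2, hr.2]⟩
        have hd := (((hasDerivAt_id x).rpow_const (p := q + 1) (Or.inl hx.1.ne')).fun_mul
          (hasDerivAt_sinMeanAux hq m hx')).const_mul m
        simp only [id] at hd
        rw [hd.deriv, show q + 1 - 1 = q by ring, Real.rpow_add_one hx.1.ne']
        have h1 := sinMeanAux_deriv_eq hq m hx'
        have h2 := sinMean_pos hq (m - 1) hx'
        have h3 : 0 ≤ x ^ q * (x * (m * (q + 2 * m)) * sinMean q (m - 1) x) := by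
          have := hx.1
          positivity
        refine h3.trans_eq ?_
        linear_combination (-(m * x ^ q)) * h1
    have h1 := hmono (left_mem_Icc.2 h0.le) (right_mem_Icc.2 h0.le) h0.le
    simp only at h1
    rw [Real.zero_rpow (by linarith), zero_mul, mul_zero, mul_left_comm] at h1
    exact nonneg_of_mul_nonneg_right h1 (by positivity)

/-- The sign condition covers two uses: q = 0 with arbitrary m, and arbitrary q ≥ 0 with m ≥ 0. -/
lemma monotoneOn_sinMean {q m : ℝ} (hq : 0 ≤ q) (h : 0 ≤ m * (q + 2 * m)) :
    MonotoneOn (sinMean q m) (Ico 0 1) := by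
  refine monotoneOn_of_deriv_nonneg (convex_Ico 0 1) ?_ ?_ ?_
  · exact fun x hx => (hasDerivAt_sinMean hq m (Ico_subset_Ioo' hx)).continuousAt.continuousWithinAt
  · intro x hx
    exact (hasDerivAt_sinMean hq m
      (Ico_subset_Ioo' (interior_subset hx))).differentiableAt.differentiableWithinAt
  · intro x hx
    rw [(hasDerivAt_sinMean hq m (Ico_subset_Ioo' (interior_subset hx))).deriv]
    linarith [sinMeanAux_nonneg hq h (interior_subset hx)]

lemma Q_one (t : ℝ) : Q 1 t = 2 + 2 * Real.cos t := by rw [Q]; ring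

/-- In terms of moduli, |1+e^{it}| ≤ |1+re^{it}| + (1-r) ≤ 2|1+re^{it}|. This dominates negative
powers of Q uniformly in r. -/
lemma quarter_Q_one_le {r : ℝ} (hr : r ∈ Ico (0 : ℝ) 1) (t : ℝ) : Q 1 t / 4 ≤ Q r t := by
  rw [Q_one, Q]
  nlinarith [Real.neg_one_le_cos t, Real.cos_le_one t, hr.1, hr.2, mul_nonneg hr.1
    (by linarith [Real.neg_one_le_cos t] : 0 ≤ 1 + Real.cos t), sq_nonneg (1 - r),
    mul_nonneg (by linarith [hr.2] : 0 ≤ 1 - r) (by linarith [Real.cos_le_one t] : 0 ≤ 1 - Real.cos t)]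

lemma Q_le_four {r : ℝ} (hr : r ∈ Ico (0 : ℝ) 1) (t : ℝ) : Q r t ≤ 4 := by
  rw [Q]
  nlinarith [Real.neg_one_le_cos t, Real.cos_le_one t, hr.1, hr.2]

/-- A bound for the powers of `|1 + r e^{it}|²`, uniform in `r`. -/
def QBound (m t : ℝ) : ℝ := 4 ^ m + 4 ^ (-m) * (2 + 2 * Real.cos t) ^ m

lemma Q_rpow_le {r : ℝ} (hr : r ∈ Ico (0 : ℝ) 1) (m : ℝ) {t : ℝ} (ht : 0 < 2 + 2 * Real.cos t) :
    Q r t ^ m ≤ QBound m t := by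
  have hQ := Q_pos (Ico_subset_Ioo' hr) t
  have h4 : (0 : ℝ) < 4 ^ m := by positivity
  have h4' : (0 : ℝ) < 4 ^ (-m) := by positivity
  rw [QBound]
  rcases le_total 0 m with hm | hm
  · have := Real.rpow_le_rpow hQ.le (Q_le_four hr t) hm
    have : 0 ≤ 4 ^ (-m) * (2 + 2 * Real.cos t) ^ m := by positivity
    linarith
  · have h1 := quarter_Q_one_le hr t
    rw [Q_one] at h1
    have := Real.rpow_le_rpow_of_nonpos (by positivity) h1 hm
    rw [Real.div_rpow ht.le (by norm_num), div_eq_mul_inv, ← Real.rpow_neg (by norm_num)] at this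
    linarith

lemma intervalIntegrable_QBound {m : ℝ} (hm : -1 / 2 < m) :
    IntervalIntegrable (QBound m) volume 0 Real.pi := by
  unfold QBound
  exact intervalIntegrable_const.add ((intervalIntegrable_one_add_cos_rpow hm).const_mul _)

lemma one_add_cos_pos {t : ℝ} (ht : t ∈ Ioo 0 Real.pi) : 0 < 2 + 2 * Real.cos t := by
  have h := Real.strictAntiOn_cos (a := t) (b := Real.pi) ⟨ht.1.le, ht.2.le⟩
    ⟨Real.pi_pos.le, le_rfl⟩ ht.2
  rw [Real.cos_pi] at h
  linarith

/-- The limit `r → 1` of means with a bounded weight. -/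
lemma tendsto_integral_mul_Q_rpow {g : ℝ → ℝ} (hg : Continuous g) (hg1 : ∀ t, |g t| ≤ 1) {m : ℝ}
    (hm : -1 / 2 < m) :
    Tendsto (fun r => ∫ t in (0 : ℝ)..Real.pi, g t * Q r t ^ m) (𝓝[<] 1)
      (𝓝 (∫ t in (0 : ℝ)..Real.pi, g t * (2 + 2 * Real.cos t) ^ m)) := by
  have hmem : ∀ᶠ r : ℝ in 𝓝[<] 1, r ∈ Ico (0 : ℝ) 1 := by
    filter_upwards [Ioo_mem_nhdsLT (zero_lt_one (α := ℝ))] with r hr using ⟨hr.1.le, hr.2⟩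
  -- At t = π the limit 2 + 2 cos t vanishes, and negative powers are neither dominated nor
  -- continuous there.
  have hne : ∀ᵐ t : ℝ, t ≠ Real.pi := by simp [ae_iff]
  refine intervalIntegral.tendsto_integral_filter_of_dominated_convergence (QBound m)
    ?_ ?_ (intervalIntegrable_QBound hm) ?_
  · filter_upwards [hmem] with r hr
    exact (hg.mul (continuous_Q_rpow (Ico_subset_Ioo' hr) m)).aestronglyMeasurable
  · filter_upwards [hmem] with r hr
    filter_upwards [hne] with t ht ht'
    rw [uIoc_of_le Real.pi_pos.le] at ht'
    have hc := one_add_cos_pos ⟨ht'.1, lt_of_le_of_ne ht'.2 ht⟩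
    have hQ := Q_pos (Ico_subset_Ioo' hr) t
    have := Q_rpow_le hr m hc
    have h0 : 0 ≤ Q r t ^ m := by positivity
    rw [norm_mul, Real.norm_of_nonneg h0, Real.norm_eq_abs]
    exact (mul_le_of_le_one_left h0 (hg1 t)).trans this
  · filter_upwards [hne] with t ht ht'
    rw [uIoc_of_le Real.pi_pos.le] at ht'
    have hc := one_add_cos_pos ⟨ht'.1, lt_of_le_of_ne ht'.2 ht⟩
    rw [← Q_one] at hc ⊢
    have h1 : ContinuousAt (fun r => Q r t) 1 := (hasDerivAt_Q 1 t).continuousAt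
    exact (continuousAt_const.mul (h1.rpow_const (Or.inl hc.ne'))).tendsto.mono_left
      nhdsWithin_le_nhds

/-! ### The Gauss hypergeometric function -/

/-- The coefficients of the Gauss hypergeometric series. -/
def hypCoeff (a b c : ℝ) (n : ℕ) : ℝ :=
  ((n.factorial : ℝ)⁻¹ * (ascPochhammer ℝ n).eval a * (ascPochhammer ℝ n).eval b *
    ((ascPochhammer ℝ n).eval c)⁻¹)

/-- The series `∑ n^k u_n x^n`, where `u_n` are the hypergeometric coefficients. -/
def hypSeries (a b c : ℝ) (k : ℕ) (x : ℝ) : ℝ := ∑' n : ℕ, (n : ℝ) ^ k * hypCoeff a b c n * x ^ n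

lemma ordinaryHypergeometric_eq_hypSeries (a b c x : ℝ) :
    ordinaryHypergeometric a b c x = hypSeries a b c 0 x := by
  rw [ordinaryHypergeometric_eq_tsum, hypSeries]
  simp [hypCoeff]

section

variable (a b : ℝ) {c : ℝ} (hc : 0 < c)

include hc

/-- This recursion drives the ratio test, the differential equation and the convergence at 1.
Keeping it free of division on both sides makes it usable as a polynomial relation. -/
lemma hypCoeff_succ (n : ℕ) :
    ((n : ℝ) + 1) * (n + c) * hypCoeff a b c (n + 1) = (n + a) * (n + b) * hypCoeff a b c n := by
  have h1 : (0 : ℝ) < n + c := by positivity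
  have h2 : (0 : ℝ) < (ascPochhammer ℝ n).eval c := ascPochhammer_pos n c hc
  rw [hypCoeff, hypCoeff, ascPochhammer_succ_eval, ascPochhammer_succ_eval,
    ascPochhammer_succ_eval, Nat.factorial_succ]
  push_cast
  have h3 : (0 : ℝ) < c + n := by positivity
  field_simp
  ring

omit hc in
lemma tendsto_natCast_add_div (s t : ℝ) :
    Tendsto (fun n : ℕ => ((n : ℝ) + s) / (n + t)) atTop (𝓝 1) := by
  have h := tendsto_add_mul_div_add_mul_atTop_nhds s t (1 : ℝ) (one_ne_zero (α := ℝ))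
  simp only [one_mul, div_one] at h
  simpa only [add_comm] using h

/-- The factor n^k does not change the limit |x| of the ratios, so all iterates of x d/dx are
covered at once. -/
lemma summable_hypSeries (k : ℕ) {x : ℝ} (hx : |x| < 1) :
    Summable fun n : ℕ => (n : ℝ) ^ k * hypCoeff a b c n * x ^ n := by
  obtain ⟨ρ, hxρ, hρ⟩ := exists_between hx
  have ht : Tendsto (fun n : ℕ => (((n : ℝ) + 1) / (n + 0)) ^ k *
      (|((n : ℝ) + a) / (n + 1)| * |((n : ℝ) + b) / (n + c)|) * |x|) atTop
      (𝓝 (1 ^ k * (|1| * |1|) * |x|)) :=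
    (((tendsto_natCast_add_div 1 0).pow k).mul (((tendsto_natCast_add_div a 1).abs).mul
      ((tendsto_natCast_add_div b c).abs))).mul_const _
  simp only [one_pow, abs_one, one_mul, add_zero] at ht
  refine summable_of_ratio_norm_eventually_le hρ ?_
  filter_upwards [ht.eventually_lt_const hxρ, eventually_gt_atTop 0] with n hn hn0
  have hn0' : (0 : ℝ) < n := by exact_mod_cast hn0
  have h1 : (0 : ℝ) < n + c := by positivity
  have hrec : hypCoeff a b c (n + 1) =
      ((n + a) / (n + 1)) * ((n + b) / (n + c)) * hypCoeff a b c n := by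
    have := hypCoeff_succ a b hc n
    field_simp
    linarith
  rw [hrec, pow_succ]
  simp only [norm_mul, norm_pow, Real.norm_eq_abs, Nat.abs_cast]
  push_cast
  have e : ((n : ℝ) + 1) ^ k = ((n + 1) / n) ^ k * (n : ℝ) ^ k := by
    rw [← mul_pow, div_mul_cancel₀ _ hn0'.ne']
  rw [e]
  calc _ = (((n : ℝ) + 1) / n) ^ k * (|((n : ℝ) + a) / (n + 1)| * |((n : ℝ) + b) / (n + c)|) * |x| *
        ((n : ℝ) ^ k * |hypCoeff a b c n| * |x| ^ n) := by ring
    _ ≤ _ := by gcongr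

/-- On (-ρ, ρ) the differentiated series is dominated by the series with one more factor n at ρ,
divided by ρ. -/
lemma hasDerivAt_hypSeries (k : ℕ) {x : ℝ} (hx : |x| < 1) :
    HasDerivAt (hypSeries a b c k)
      (∑' n : ℕ, (n : ℝ) ^ k * hypCoeff a b c n * (n * x ^ (n - 1))) x := by
  obtain ⟨ρ, hxρ, hρ⟩ := exists_between hx
  have hρ0 : 0 < ρ := (abs_nonneg x).trans_lt hxρ
  have hs := (summable_hypSeries a b hc (k + 1) (x := ρ) (by rwa [abs_of_pos hρ0])).norm.mul_right
    ρ⁻¹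
  change HasDerivAt (fun x => ∑' n : ℕ, (n : ℝ) ^ k * hypCoeff a b c n * x ^ n) _ x
  refine hasDerivAt_tsum_of_isPreconnected (t := Ioo (-ρ) ρ)
    (g' := fun (n : ℕ) (y : ℝ) => (n : ℝ) ^ k * hypCoeff a b c n * (n * y ^ (n - 1))) hs isOpen_Ioo
    isPreconnected_Ioo (g := fun (n : ℕ) (y : ℝ) => (n : ℝ) ^ k * hypCoeff a b c n * y ^ n) ?_ ?_
    (y₀ := 0) (by simpa using hρ0) ?_ (abs_lt.1 hxρ)
  · exact fun n y _ => (hasDerivAt_pow n y).const_mul _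
  · intro n y hy
    rcases n.eq_zero_or_pos with h0 | h0
    · subst h0; simp
    · have hyρ : |y| ≤ ρ := (abs_lt.2 hy).le
      obtain ⟨j, rfl⟩ : ∃ j, n = j + 1 := ⟨n - 1, by omega⟩
      simp only [norm_mul, norm_pow, Real.norm_eq_abs, Nat.abs_cast, Nat.add_sub_cancel,
        abs_of_pos hρ0, pow_succ _ (j : ℕ), pow_succ _ k]
      have hle : |y| ^ j ≤ ρ ^ j := pow_le_pow_left₀ (abs_nonneg _) hyρ j
      calc _ ≤ ((j + 1 : ℕ) : ℝ) ^ k * |hypCoeff a b c (j + 1)| * (((j + 1 : ℕ) : ℝ) * ρ ^ j) := by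
            gcongr
        _ = _ := by field_simp
  · simpa using summable_hypSeries a b hc k (x := 0) (by simp)

lemma hasDerivAt_hypSeries_of_pos (k : ℕ) {x : ℝ} (hx0 : 0 < x) (hx : x < 1) :
    HasDerivAt (hypSeries a b c k) (hypSeries a b c (k + 1) x / x) x := by
  refine (hasDerivAt_hypSeries a b hc k (by rwa [abs_of_pos hx0])).congr_deriv ?_
  rw [hypSeries, ← tsum_div_const]
  congr 1
  funext n
  rcases n with _ | j
  · simp
  · rw [Nat.add_sub_cancel, pow_succ x, pow_succ _ k]
    field_simp

lemma continuousAt_hypSeries (k : ℕ) {x : ℝ} (hx : |x| < 1) :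
    ContinuousAt (hypSeries a b c k) x := (hasDerivAt_hypSeries a b hc k hx).continuousAt

/-- The hypergeometric differential equation in terms of `ϑ = x d/dx`. -/
lemma hypSeries_ode {x : ℝ} (hx : |x| < 1) :
    hypSeries a b c 2 x + (c - 1) * hypSeries a b c 1 x =
      x * (hypSeries a b c 2 x + (a + b) * hypSeries a b c 1 x + a * b * hypSeries a b c 0 x) := by
  have s0 := summable_hypSeries a b hc 0 hx
  have s1 := summable_hypSeries a b hc 1 hx
  have s2 := summable_hypSeries a b hc 2 hx
  simp only [hypSeries]
  rw [← tsum_mul_left (a := c - 1), ← s2.tsum_add (s1.mul_left _), ← tsum_mul_left (a := a + b),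
    ← tsum_mul_left (a := a * b), ← s2.tsum_add (s1.mul_left _),
    ← (s2.add (s1.mul_left _)).tsum_add (s0.mul_left _), ← tsum_mul_left,
    (s2.add (s1.mul_left _)).tsum_eq_zero_add]
  simp only [Nat.cast_zero, ne_eq, OfNat.ofNat_ne_zero, not_false_eq_true, zero_pow, zero_mul,
    one_ne_zero, mul_zero, add_zero, zero_add]
  congr 1
  funext n
  -- The constant term on the left has dropped out, so the coefficients of x^{n+1} are compared, and
  -- these agree by the recursion.
  have h := hypCoeff_succ a b hc n
  push_cast
  linear_combination (x ^ (n + 1)) * h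

/-- Convergence of the hypergeometric series at `1` if `a + b < c - 1`. -/
lemma summable_hypCoeff (h : a + b < c - 1) : Summable (hypCoeff a b c) := by
  set d := c - a - b - 1 with hd
  have hd0 : 0 < d := by linarith
  -- From N on, n+a and n+b are nonnegative and dn - ab ≥ 1.
  obtain ⟨N, hN⟩ := exists_nat_ge (max (max (-a) (-b)) ((1 + a * b) / d))
  have hN1 : -a ≤ N := (le_max_left _ _).trans ((le_max_left _ _).trans hN)
  have hN2 : -b ≤ N := (le_max_right _ _).trans ((le_max_left _ _).trans hN)
  have hN3 : 1 + a * b ≤ d * N := by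
    have := (le_max_right _ _).trans hN
    rwa [div_le_iff₀' hd0] at this
  -- A telescoping majorant in the manner of Raabe's test: by the recursion v(n) - v(n+1) = (dn -
  -- ab)|u_n| for n ≥ N.
  set v : ℕ → ℝ := fun n => n * (n - 1 + c) * |hypCoeff a b c n| with hv
  have key : ∀ n : ℕ, N ≤ n → |hypCoeff a b c n| ≤ v n - v (n + 1) := fun n hn => by
    have hn' : (N : ℝ) ≤ n := by exact_mod_cast hn
    have h1 : 0 ≤ (n : ℝ) + a := by linarith
    have h2 : 0 ≤ (n : ℝ) + b := by linarith
    have h3 : (0 : ℝ) < n + c := by positivity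
    have h4 := congrArg abs (hypCoeff_succ a b hc n)
    rw [abs_mul, abs_of_nonneg (by positivity : 0 ≤ ((n : ℝ) + 1) * (n + c)),
      abs_mul (((n : ℝ) + a) * (n + b)), abs_of_nonneg (mul_nonneg h1 h2)] at h4
    have e : v (n + 1) = (n + a) * (n + b) * |hypCoeff a b c n| := by
      rw [← h4, hv]
      push_cast
      ring
    have h5 : 1 ≤ d * n - a * b := by nlinarith
    have h6 := mul_le_mul_of_nonneg_right h5 (abs_nonneg (hypCoeff a b c n))
    rw [e]
    simp only [hv]
    calc |hypCoeff a b c n| ≤ (d * n - a * b) * |hypCoeff a b c n| := by linarith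
      _ = _ := by rw [hd]; ring
  have hv0 : ∀ n, 0 ≤ v (n + 1) := fun n => by
    have : (0 : ℝ) ≤ ((n + 1 : ℕ) : ℝ) - 1 + c := by push_cast; ring_nf; positivity
    positivity
  have hsum : ∀ n, ∑ i ∈ Finset.range n, |hypCoeff a b c (i + (N + 1))| ≤
      v (N + 1) - v (n + (N + 1)) := fun n => by
    induction n with
    | zero => simp
    | succ n ih =>
      rw [Finset.sum_range_succ]
      have := key (n + (N + 1)) (by omega)
      rw [show n + 1 + (N + 1) = n + (N + 1) + 1 by ring]
      linarith
  have hs : Summable fun i => |hypCoeff a b c (i + (N + 1))| :=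
    summable_of_sum_range_le (fun _ => abs_nonneg _) fun n =>
      (hsum n).trans (sub_le_self _ (hv0 _))
  exact (summable_nat_add_iff (N + 1)).1 hs.of_abs

/-- Abel's limit theorem, given convergence at 1. -/
lemma tendsto_hypSeries_one (h : a + b < c - 1) :
    Tendsto (hypSeries a b c 0) (𝓝[<] 1) (𝓝 (hypSeries a b c 0 1)) := by
  have := Real.tendsto_tsum_powerSeries_nhdsWithin_lt
    (summable_hypCoeff a b hc h).hasSum.tendsto_sum_nat
  have e : hypSeries a b c 0 = fun x => ∑' n, hypCoeff a b c n * x ^ n := by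
    funext x
    simp [hypSeries]
  rw [e]
  simpa using this

end

/-! ### Hypergeometric form of the weighted means -/

/-- Only continuity is asked at the endpoints, because the equations below are singular at 0. -/
lemma eq_of_hasDerivAt_zero {f : ℝ → ℝ} {a b : ℝ} (hab : a < b) (hc : ContinuousOn f (Icc a b))
    (hd : ∀ x ∈ Ioo a b, HasDerivAt f 0 x) : f b = f a := by
  obtain ⟨x, _, hx⟩ := exists_hasDerivAt_eq_slope f (fun _ => 0) hab hc hd
  rw [eq_comm, div_eq_zero_iff] at hx
  rcases hx with h | h <;> linarith

section

variable {q : ℝ} (hq : 0 < q) (m : ℝ)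

include hq

/-- The weighted mean and the hypergeometric function have a vanishing Wronskian. -/
lemma sinMean_wronskian {r : ℝ} (hr : r ∈ Ioo (0 : ℝ) 1) :
    2 * m * r * sinMeanAux q m r * hypSeries (-(m + q / 2)) (-m) (1 + q / 2) 0 (r ^ 2) =
      sinMean q m r * (2 * hypSeries (-(m + q / 2)) (-m) (1 + q / 2) 1 (r ^ 2)) := by
  have hc : 0 < 1 + q / 2 := by linarith
  set S : ℕ → ℝ → ℝ := hypSeries (-(m + q / 2)) (-m) (1 + q / 2) with hS
  set W : ℝ → ℝ := fun r => 2 * m * r * sinMeanAux q m r * S 0 (r ^ 2) -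
    sinMean q m r * (2 * S 1 (r ^ 2)) with hW
  -- Abel's identity: this multiple of the Wronskian is constant. It is zero at r = 0 because q > 0.
  set V : ℝ → ℝ := fun r => r ^ q * (1 - r ^ 2) ^ (-(2 * m + q)) * W r with hV
  have hsq : ∀ x ∈ Icc 0 r, |x ^ 2| < 1 := fun x hx => by
    rw [abs_of_nonneg (by positivity)]
    nlinarith [hx.1, hx.2, hr.2]
  have hcont : ContinuousOn V (Icc 0 r) := by
    intro x hx
    have hx' : x ∈ Ioo (-1 : ℝ) 1 := ⟨by linarith [hx.1], by linarith [hx.2, hr.2]⟩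
    have h1 := (hasDerivAt_sinMean hq.le m hx').continuousAt
    have h2 := (hasDerivAt_sinMeanAux hq.le m hx').continuousAt
    have h3 : ∀ k, ContinuousAt (fun x : ℝ => S k (x ^ 2)) x := fun k =>
      ContinuousAt.comp (f := fun x : ℝ => x ^ 2)
        (continuousAt_hypSeries _ _ hc k (hsq x hx)) (by fun_prop)
    have h4 : ContinuousAt (fun x : ℝ => (1 - x ^ 2) ^ (-(2 * m + q))) x := by
      refine ContinuousAt.rpow_const (by fun_prop) (Or.inl ?_)
      nlinarith [hx'.1, hx'.2]
    have h5 : ContinuousAt (fun x : ℝ => x ^ q) x :=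
      Real.continuousAt_rpow_const _ _ (Or.inr hq.le)
    have h6 : ContinuousAt W x :=
      (((continuousAt_const.mul continuousAt_id).mul h2).mul (h3 0)).sub
        (h1.mul (continuousAt_const.mul (h3 1)))
    exact ((h5.mul h4).mul h6).continuousWithinAt
  have hder : ∀ x ∈ Ioo 0 r, HasDerivAt V 0 x := by
    intro x hx
    have hx0 := hx.1
    have hx1 : x < 1 := hx.2.trans hr.2
    have hx' : x ∈ Ioo (-1 : ℝ) 1 := ⟨by linarith, hx1⟩
    have hx2 : 0 < 1 - x ^ 2 := by nlinarith
    have dsq : HasDerivAt (fun x : ℝ => x ^ 2) (2 * x) x := by simpa using hasDerivAt_pow 2 x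
    have hSd : ∀ k, HasDerivAt (fun x : ℝ => S k (x ^ 2)) (S (k + 1) (x ^ 2) / x ^ 2 * (2 * x)) x :=
      fun k => (hasDerivAt_hypSeries_of_pos _ _ hc k (by positivity) (by linarith)).comp x dsq
    have hT := hasDerivAt_sinMeanAux hq.le m hx'
    have hM := hasDerivAt_sinMean hq.le m hx'
    have ode1 := sinMeanAux_deriv_eq hq.le m hx'
    have ode2 := two_mul_sinMeanAux hq.le m hx'
    have ode3 := hypSeries_ode (-(m + q / 2)) (-m) hc (x := x ^ 2) (hsq x ⟨hx0.le, hx.2.le⟩)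
    rw [← hS] at ode3
    have hWd := (((((hasDerivAt_id x).const_mul (2 * m)).fun_mul hT).fun_mul (hSd 0))).fun_sub
      (hM.fun_mul ((hSd 1).const_mul 2))
    have hp1 := (hasDerivAt_id x).rpow_const (p := q) (Or.inl hx0.ne')
    have hp2 := (dsq.const_sub 1).rpow_const (p := -(2 * m + q)) (Or.inl hx2.ne')
    have hVd := (hp1.fun_mul hp2).fun_mul hWd
    refine hVd.congr_deriv ?_
    simp only [id]
    rw [Real.rpow_sub_one hx0.ne', Real.rpow_sub_one hx2.ne']
    generalize (∫ t in (0 : ℝ)..Real.pi, Real.sin t ^ q *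
      (Q x t ^ (m - 1) + 2 * (m - 1) * (x + Real.cos t) ^ 2 * Q x t ^ (m - 2))) = T' at *
    generalize sinMeanAux q m x = T at *
    generalize sinMean q m x = M at *
    generalize sinMean q (m - 1) x = N at *
    simp only [Nat.reduceAdd, zero_add] at *
    generalize S 0 (x ^ 2) = S0 at *
    generalize S 1 (x ^ 2) = S1 at *
    generalize S 2 (x ^ 2) = S2 at *
    generalize x ^ q = X at *
    generalize (1 - x ^ 2) ^ (-(2 * m + q)) = Z at *
    -- This is the derivative of V stripped of its prefactor. Here `ode1` removes the derivative of
    -- T, `ode2` removes the mean with exponent m-1, and `ode3` is the hypergeometric equation at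
    -- x².
    have hE : q * (1 - x ^ 2) * (2 * m * x * T * S0 - M * (2 * S1)) +
        2 * x ^ 2 * (2 * m + q) * (2 * m * x * T * S0 - M * (2 * S1)) +
        (1 - x ^ 2) * (2 * m * x * T * S0 + 2 * m * x ^ 2 * T' * S0 - 4 * M * S2) = 0 := by
      linear_combination ((1 - x ^ 2) * 2 * m * S0 * x) * ode1 +
        (2 * m * x ^ 2 * (q + 2 * m) * S0) * ode2 - (4 * M) * ode3
    trans X * Z / (x * (1 - x ^ 2)) * (q * (1 - x ^ 2) * (2 * m * x * T * S0 - M * (2 * S1)) +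
        2 * x ^ 2 * (2 * m + q) * (2 * m * x * T * S0 - M * (2 * S1)) +
        (1 - x ^ 2) * (2 * m * x * T * S0 + 2 * m * x ^ 2 * T' * S0 - 4 * M * S2))
    · field_simp
      ring
    · rw [hE, mul_zero]
  have h0 := eq_of_hasDerivAt_zero hr.1 hcont hder
  have hV0 : V 0 = 0 := by simp [hV, Real.zero_rpow hq.ne']
  rw [hV0] at h0
  have hr2 : 0 < 1 - r ^ 2 := by nlinarith [hr.1, hr.2]
  have hr0 := hr.1
  have := (mul_eq_zero.1 h0).resolve_left (by positivity)
  exact sub_eq_zero.1 this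

lemma sinMean_zero_right : sinMean q m 0 = ProbabilityTheory.beta ((q + 1) / 2) (1 / 2) := by
  rw [sinMean, ← integral_sin_rpow (by linarith)]
  simp [Q]

/-- A vanishing Wronskian makes the quotient of the two solutions constant. The mean goes in the
denominator because it is known to be positive, and the series equals 1 at 0. -/
lemma sinMean_eq_hypergeometric {r : ℝ} (hr : r ∈ Ico (0 : ℝ) 1) :
    sinMean q m r = ProbabilityTheory.beta ((q + 1) / 2) (1 / 2) *
      ordinaryHypergeometric (-(m + q / 2)) (-m) (1 + q / 2) (r ^ 2) := by
  have hc : 0 < 1 + q / 2 := by linarith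
  have hS0 : hypSeries (-(m + q / 2)) (-m) (1 + q / 2) 0 0 = 1 := by
    rw [← ordinaryHypergeometric_eq_hypSeries]
    exact ordinaryHypergeometric_zero ..
  rw [ordinaryHypergeometric_eq_hypSeries, ← sinMean_zero_right hq m]
  rcases hr.1.eq_or_lt with h0 | h0
  · rw [← h0, zero_pow two_ne_zero, hS0, mul_one]
  · have hIoo : ∀ x ∈ Icc 0 r, x ∈ Ioo (-1 : ℝ) 1 := fun x hx =>
      ⟨by linarith [hx.1], by linarith [hx.2, hr.2]⟩
    have hsq : ∀ x ∈ Icc 0 r, |x ^ 2| < 1 := fun x hx => by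
      rw [abs_of_nonneg (by positivity)]
      nlinarith [hx.1, hx.2, hr.2]
    have h := eq_of_hasDerivAt_zero (f := fun x =>
      hypSeries (-(m + q / 2)) (-m) (1 + q / 2) 0 (x ^ 2) / sinMean q m x) h0 ?_ ?_
    · have p1 := sinMean_pos hq.le m (hIoo r ⟨h0.le, le_rfl⟩)
      have p2 := sinMean_pos hq.le m (hIoo 0 ⟨le_rfl, h0.le⟩)
      rw [zero_pow two_ne_zero, hS0] at h
      generalize hypSeries (-(m + q / 2)) (-m) (1 + q / 2) 0 (r ^ 2) = S at h ⊢
      field_simp at h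
      linarith
    · intro x hx
      exact ((ContinuousAt.comp (f := fun x : ℝ => x ^ 2)
        (continuousAt_hypSeries _ _ hc 0 (hsq x hx)) (by fun_prop)).div
        (hasDerivAt_sinMean hq.le m (hIoo x hx)).continuousAt
        (sinMean_pos hq.le m (hIoo x hx)).ne').continuousWithinAt
    · intro x hx
      have hx' := hIoo x ⟨hx.1.le, hx.2.le⟩
      have hx1 : x < 1 := hx'.2
      have hx0 := hx.1
      have dsq : HasDerivAt (fun x : ℝ => x ^ 2) (2 * x) x := by simpa using hasDerivAt_pow 2 x
      have hw := sinMean_wronskian hq m (r := x) ⟨hx0, hx1⟩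
      have hd := ((hasDerivAt_hypSeries_of_pos (-(m + q / 2)) (-m) hc 0 (x := x ^ 2)
        (by positivity) (by nlinarith)).comp x dsq).fun_div
        (hasDerivAt_sinMean hq.le m hx') (sinMean_pos hq.le m hx').ne'
      refine hd.congr_deriv ?_
      rw [div_eq_zero_iff]
      left
      simp only [Function.comp_apply, zero_add]
      generalize hypSeries (-(m + q / 2)) (-m) (1 + q / 2) 0 (x ^ 2) = S0 at *
      generalize hypSeries (-(m + q / 2)) (-m) (1 + q / 2) 1 (x ^ 2) = S1 at *
      field_simp
      linear_combination -hw

end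

/-! ### Means over the circle -/

lemma isLUB_of_monotoneOn_tendsto {f : ℝ → ℝ} {L : ℝ} (hf : MonotoneOn f (Ico 0 1))
    (hL : Tendsto f (𝓝[<] 1) (𝓝 L)) : IsLUB (f '' Ico 0 1) L := by
  constructor
  · rintro _ ⟨r, hr, rfl⟩
    refine ge_of_tendsto hL ?_
    filter_upwards [Ioo_mem_nhdsLT hr.2] with s hs
    exact hf hr ⟨hr.1.trans hs.1.le, hs.2⟩ hs.1.le
  · intro M hM
    refine le_of_tendsto hL ?_
    filter_upwards [Ioo_mem_nhdsLT (zero_lt_one (α := ℝ))] with s hs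
    exact hM (mem_image_of_mem _ ⟨hs.1.le, hs.2⟩)

lemma integral_symm_of_even {g : ℝ → ℝ} (hg : Continuous g) (he : ∀ t, g (-t) = g t) (a : ℝ) :
    ∫ t in -a..a, g t = 2 * ∫ t in (0 : ℝ)..a, g t := by
  rw [← intervalIntegral.integral_add_adjacent_intervals (hg.intervalIntegrable (-a) 0)
    (hg.intervalIntegrable 0 a)]
  have h := intervalIntegral.integral_comp_neg (a := 0) (b := a) g
  rw [neg_zero] at h
  rw [← h]
  simp only [he]
  ring

lemma integral_circle_of_even {g : ℝ → ℝ} (hg : Continuous g) (he : ∀ t, g (-t) = g t)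
    (hper : Function.Periodic g (2 * Real.pi)) :
    ∫ t in (0 : ℝ)..2 * Real.pi, g t = 2 * ∫ t in (0 : ℝ)..Real.pi, g t := by
  rw [← interval_symm_eq hper, integral_symm_of_even hg he]

lemma Q_eq_w_sq (r t : ℝ) : Q r t = w r t ^ 2 := (w_sq r t).symm

lemma w_rpow_eq {r : ℝ} (hr : r ∈ Ico (0 : ℝ) 1) (t a : ℝ) : w r t ^ a = Q r t ^ (a / 2) := by
  rw [Q_eq_w_sq, ← Real.rpow_natCast, ← Real.rpow_mul (w_pos hr t).le]
  congr 1
  push_cast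
  ring

lemma Q_neg (r t : ℝ) : Q r (-t) = Q r t := by rw [Q, Q, Real.cos_neg]

lemma periodic_Q (r : ℝ) : Function.Periodic (Q r) (2 * Real.pi) := fun t => by
  rw [Q, Q, Real.cos_add_two_pi]

/-- Half of the exponent of `|1 + r e^{is}|` in the weight. -/
def halfExp (α q : ℝ) : ℝ := ((2 + α) * q - 2) / 2

/-- Since (2+α)q > 1, the weight stays integrable at r = 1 for every admissible α and q. -/
lemma halfExp_gt {α q : ℝ} (hα : -1 < α) (hq : 1 ≤ q) : -1 / 2 < halfExp α q := by
  rw [halfExp]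
  nlinarith

section

variable {r : ℝ} (hr : r ∈ Ico (0 : ℝ) 1)

include hr

lemma integral_circle_mul_Q_rpow {g : ℝ → ℝ} (hg : Continuous g) (he : ∀ t, g (-t) = g t)
    (hper : Function.Periodic g (2 * Real.pi)) (m : ℝ) :
    ∫ t in (0 : ℝ)..2 * Real.pi, g t * Q r t ^ m =
      2 * ∫ t in (0 : ℝ)..Real.pi, g t * Q r t ^ m :=
  integral_circle_of_even (hg.mul (continuous_Q_rpow (Ico_subset_Ioo' hr) m))
    (fun t => by rw [he, Q_neg]) fun t => by simp only [hper t, periodic_Q r t]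

lemma I11_eq (α q : ℝ) :
    I11 α q r = ∫ t in (0 : ℝ)..2 * Real.pi, |Real.cos t| ^ q * Q r t ^ halfExp α q := by
  rw [I11]
  congr 1
  funext t
  rw [div_eq_mul_inv, ← Real.rpow_neg (w_pos hr t).le, w_rpow_eq hr, halfExp]
  congr 2
  ring

lemma I12_eq (α q : ℝ) : I12 α q r = ∫ t in (0 : ℝ)..2 * Real.pi, Q r t ^ halfExp α q := by
  rw [I12]
  congr 1
  funext t
  rw [one_div, ← Real.rpow_neg (w_pos hr t).le, w_rpow_eq hr, halfExp]
  congr 1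
  ring

lemma I12_eq_sinMean (α q : ℝ) : I12 α q r = 2 * sinMean 0 (halfExp α q) r := by
  rw [I12_eq hr, sinMean]
  have := integral_circle_mul_Q_rpow hr (g := fun _ => 1) continuous_const (fun _ => rfl)
    (fun _ => rfl) (halfExp α q)
  simpa using this

lemma integral_abs_sin_rpow {q : ℝ} (hq : 0 ≤ q) (m : ℝ) :
    ∫ t in (0 : ℝ)..2 * Real.pi, |Real.sin t| ^ q * Q r t ^ m = 2 * sinMean q m r := by
  rw [integral_circle_mul_Q_rpow hr
    (Real.continuous_sin.abs.rpow_const fun _ => Or.inr hq) (fun t => by rw [Real.sin_neg, abs_neg])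
    (fun t => by simp only [Real.sin_add_two_pi]), sinMean]
  congr 1
  refine intervalIntegral.integral_congr fun t ht => ?_
  rw [uIcc_of_le Real.pi_pos.le] at ht
  simp only [abs_of_nonneg (Real.sin_nonneg_of_mem_Icc ht)]

end

/-- The limit of `I₁₂ / 2π` as `r → 1`. -/
def gammaQuot (α q : ℝ) : ℝ :=
  Real.Gamma ((α + 2) * q - 1) / Real.Gamma ((α + 2) * q / 2) ^ 2

lemma eventually_mem_Ico : ∀ᶠ r : ℝ in 𝓝[<] 1, r ∈ Ico (0 : ℝ) 1 := by
  filter_upwards [Ioo_mem_nhdsLT (zero_lt_one (α := ℝ))] with r hr using ⟨hr.1.le, hr.2⟩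

lemma tendsto_I12 {α q : ℝ} (hα : -1 < α) (hq : 1 ≤ q) :
    Tendsto (fun r => 1 / (2 * Real.pi) * I12 α q r) (𝓝[<] 1) (𝓝 (gammaQuot α q)) := by
  have h := tendsto_integral_mul_Q_rpow (g := fun _ => 1) continuous_const (by simp)
    (halfExp_gt hα hq)
  simp only [one_mul] at h
  rw [integral_one_add_cos_rpow (halfExp_gt hα hq)] at h
  have h2 := (h.const_mul 2).const_mul (1 / (2 * Real.pi))
  have e : 1 / (2 * Real.pi) * (2 * (Real.pi * (Real.Gamma (2 * halfExp α q + 1) /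
      Real.Gamma (halfExp α q + 1) ^ 2))) = gammaQuot α q := by
    rw [gammaQuot, show 2 * halfExp α q + 1 = (α + 2) * q - 1 by rw [halfExp]; ring,
      show halfExp α q + 1 = (α + 2) * q / 2 by rw [halfExp]; ring]
    have := Real.pi_pos
    field_simp
  rw [e] at h2
  refine h2.congr' ?_
  filter_upwards [eventually_mem_Ico] with r hr
  rw [I12_eq_sinMean hr, sinMean]
  simp

/-- Here the sine weight is trivial, so the sign condition is 2m² ≥ 0 and holds for either sign of
m. -/
lemma monotoneOn_I12 (α q : ℝ) :
    MonotoneOn (fun r => 1 / (2 * Real.pi) * I12 α q r) (Ico 0 1) := by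
  intro x hx y hy hxy
  simp only
  rw [I12_eq_sinMean hx, I12_eq_sinMean hy]
  have := monotoneOn_sinMean le_rfl (m := halfExp α q)
    (by nlinarith [sq_nonneg (halfExp α q)]) hx hy hxy
  have := Real.pi_pos
  gcongr

lemma I12_pos {r : ℝ} (hr : r ∈ Ico (0 : ℝ) 1) (α q : ℝ) : 0 < 1 / (2 * Real.pi) * I12 α q r := by
  rw [I12_eq_sinMean hr]
  have := sinMean_pos le_rfl (halfExp α q) (Ico_subset_Ioo' hr)
  have := Real.pi_pos
  positivity

lemma I12_le {α q r : ℝ} (hα : -1 < α) (hq : 1 ≤ q) (hr : r ∈ Ico (0 : ℝ) 1) :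
    1 / (2 * Real.pi) * I12 α q r ≤ gammaQuot α q :=
  (isLUB_of_monotoneOn_tendsto (monotoneOn_I12 α q) (tendsto_I12 hα hq)).1 (mem_image_of_mem _ hr)

lemma gammaQuot_pos {α q : ℝ} (hα : -1 < α) (hq : 1 ≤ q) : 0 < gammaQuot α q := by
  have h1 : 0 < (α + 2) * q - 1 := by nlinarith
  have h2 : 0 < (α + 2) * q / 2 := by nlinarith
  exact div_pos (Real.Gamma_pos_of_pos h1) (pow_pos (Real.Gamma_pos_of_pos h2) 2)

/-! ### Monotonicity of the weighted norm -/

section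

variable {α r : ℝ} {p : ℝ≥0∞} {Φ Ψ : ℝ → ℝ}

lemma weightedNorm_mono (hr : r ∈ Ico (0 : ℝ) 1) (hp : 1 ≤ p) (hΦ : Continuous Φ)
    (hΨ : Continuous Ψ) (h0 : ∀ s, 0 ≤ Φ s) (hle : ∀ s, Φ s ≤ Ψ s)
    (hper : Function.Periodic Ψ (2 * Real.pi)) : weightedNorm α p r Φ ≤ weightedNorm α p r Ψ := by
  rw [weightedNorm, weightedNorm]
  split_ifs with h1
  · refine ciSup_mono ?_ fun s => ?_
    · have hc : Continuous fun s => Ψ s * w r s ^ (α + 2) := hΨ.mul (continuous_w_rpow hr _)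
      have hper' : Function.Periodic (fun s => Ψ s * w r s ^ (α + 2)) (2 * Real.pi) := fun s => by
        simp only [hper s, periodic_w r s]
      rw [← hper'.image_Icc Real.two_pi_pos 0]
      exact (isCompact_Icc.image hc).bddAbove
    · have := w_pos hr s
      have := hle s
      gcongr
  · have hq := conjExp_pos hp h1
    have hc : ∀ {Φ : ℝ → ℝ}, Continuous Φ → IntervalIntegrable (fun s => Φ s ^ conjExp p *
        w r s ^ ((2 + α) * conjExp p - 2)) volume 0 (2 * Real.pi) := fun h =>
      ((h.rpow_const fun _ => Or.inr hq.le).mul (continuous_w_rpow hr _)).intervalIntegrable _ _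
    have hle2 : ∀ s, Φ s ^ conjExp p * w r s ^ ((2 + α) * conjExp p - 2) ≤
        Ψ s ^ conjExp p * w r s ^ ((2 + α) * conjExp p - 2) := fun s => by
      have := w_pos hr s
      have := h0 s
      have := hle s
      gcongr
    have h3 := intervalIntegral.integral_mono_on Real.two_pi_pos.le (hc hΦ) (hc hΨ)
      fun s _ => hle2 s
    have h4 : 0 ≤ ∫ s in (0 : ℝ)..2 * Real.pi,
        Φ s ^ conjExp p * w r s ^ ((2 + α) * conjExp p - 2) :=
      intervalIntegral.integral_nonneg Real.two_pi_pos.le fun s _ =>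
        mul_nonneg (Real.rpow_nonneg (h0 s) _) (Real.rpow_nonneg (w_pos hr s).le _)
    have := Real.pi_pos
    gcongr

/-- The `L^q` norm of the weight `w^{α+2}`. -/
def weightNorm (α : ℝ) (p : ℝ≥0∞) (r : ℝ) : ℝ :=
  if p = 1 then (1 + r) ^ (α + 2)
  else (1 / (2 * Real.pi) * I12 α (conjExp p) r) ^ (1 / conjExp p)

lemma weightNorm_nonneg (hr : r ∈ Ico (0 : ℝ) 1) : 0 ≤ weightNorm α p r := by
  rw [weightNorm]
  split_ifs
  · exact Real.rpow_nonneg (by linarith [hr.1]) _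
  · exact Real.rpow_nonneg (I12_pos hr _ _).le _

lemma w_zero (hr : 0 ≤ r) : w r 0 = 1 + r := by
  rw [w]
  simp only [Complex.ofReal_zero, zero_mul, neg_zero, Complex.exp_zero, mul_one]
  rw [← Complex.ofReal_one, ← Complex.ofReal_add, Complex.norm_real,
    Real.norm_of_nonneg (by linarith)]

lemma weightedNorm_const_mul (hr : r ∈ Ico (0 : ℝ) 1) (hp : 1 ≤ p) {k : ℝ} (hk : 0 ≤ k)
    (hΦ : ∀ s, 0 ≤ Φ s) :
    weightedNorm α p r (fun s => k * Φ s) = k * weightedNorm α p r Φ := by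
  rw [weightedNorm, weightedNorm]
  split_ifs with h1
  · rw [Real.mul_iSup_of_nonneg hk]
    simp only [mul_assoc]
  · have hq := conjExp_pos hp h1
    have h2 : ∀ s, (k * Φ s) ^ conjExp p * w r s ^ ((2 + α) * conjExp p - 2) =
        k ^ conjExp p * (Φ s ^ conjExp p * w r s ^ ((2 + α) * conjExp p - 2)) := fun s => by
      rw [Real.mul_rpow hk (hΦ s), mul_assoc]
    have h4 : 0 ≤ ∫ s in (0 : ℝ)..2 * Real.pi,
        Φ s ^ conjExp p * w r s ^ ((2 + α) * conjExp p - 2) :=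
      intervalIntegral.integral_nonneg Real.two_pi_pos.le fun s _ =>
        mul_nonneg (Real.rpow_nonneg (hΦ s) _) (Real.rpow_nonneg (w_pos hr s).le _)
    simp only [h2]
    rw [intervalIntegral.integral_const_mul, mul_left_comm,
      Real.mul_rpow (by positivity) (mul_nonneg (by positivity) h4), ← Real.rpow_mul hk,
      mul_one_div_cancel hq.ne', Real.rpow_one]

lemma weightedNorm_one (hα : -1 < α) (hr : r ∈ Ico (0 : ℝ) 1) :
    weightedNorm α p r (fun _ => 1) = weightNorm α p r := by
  rw [weightedNorm, weightNorm]
  split_ifs with h1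
  · simp only [one_mul]
    refine le_antisymm (ciSup_le fun s => ?_) ?_
    · have := w_pos hr s
      have := w_le hr.1 s
      exact Real.rpow_le_rpow (w_pos hr s).le (w_le hr.1 s) (by linarith)
    · rw [← w_zero hr.1]
      refine le_ciSup (f := fun s => w r s ^ (α + 2)) ⟨(1 + r) ^ (α + 2), ?_⟩ 0
      rintro _ ⟨s, rfl⟩
      exact Real.rpow_le_rpow (w_pos hr s).le (w_le hr.1 s) (by linarith)
  · simp only [Real.one_rpow, one_mul]
    rw [I12_eq hr, one_div (2 * Real.pi)]
    simp only [w_rpow_eq hr, halfExp]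

lemma weightedNorm_const (hα : -1 < α) (hr : r ∈ Ico (0 : ℝ) 1) (hp : 1 ≤ p) {k : ℝ}
    (hk : 0 ≤ k) : weightedNorm α p r (fun _ => k) = k * weightNorm α p r := by
  have := weightedNorm_const_mul (α := α) (Φ := fun _ => 1) hr hp hk fun _ => zero_le_one
  rw [← weightedNorm_one hα hr, ← this]
  simp

end

/-! ### The Wirtinger derivatives -/

/-- The limit of the norm of the weight as `r → 1`. -/
def weightConst (α : ℝ) (p : ℝ≥0∞) : ℝ :=
  if p = 1 then 2 ^ (α + 2) else gammaQuot α (conjExp p) ^ (1 / conjExp p)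

lemma C_eq (α : ℝ) (p : ℝ≥0∞) (r : ℝ) :
    C α p r = c α * (|α| * r / 2 + 1 + α / 2) * weightNorm α p r := by
  rw [C, weightNorm]
  split_ifs <;> rfl

lemma CConst_eq (α : ℝ) (p : ℝ≥0∞) :
    CConst α p = c α * (|α| / 2 + 1 + α / 2) * weightConst α p := by
  rw [CConst, weightConst]
  split_ifs <;> rfl

section

variable {α : ℝ} (hα : -1 < α) {p : ℝ≥0∞} (hp : 1 ≤ p)

include hα hp

lemma weightConst_pos : 0 < weightConst α p := by
  rw [weightConst]
  split_ifs with h1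
  · positivity
  · exact Real.rpow_pos_of_pos (gammaQuot_pos hα (one_le_conjExp hp h1)) _

lemma monotoneOn_weightNorm : MonotoneOn (weightNorm α p) (Ico 0 1) := by
  intro x hx y hy hxy
  rw [weightNorm, weightNorm]
  split_ifs with h1
  · exact Real.rpow_le_rpow (by linarith [hx.1]) (by linarith) (by linarith)
  · exact Real.rpow_le_rpow (I12_pos hx _ _).le (monotoneOn_I12 _ _ hx hy hxy)
      (one_div_nonneg.2 (conjExp_pos hp h1).le)

lemma tendsto_weightNorm : Tendsto (weightNorm α p) (𝓝[<] 1) (𝓝 (weightConst α p)) := by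
  by_cases h1 : p = 1
  · have h : ContinuousAt (fun r : ℝ => (1 + r) ^ (α + 2)) 1 :=
      ContinuousAt.rpow_const (by fun_prop) (Or.inl (by norm_num))
    have h2 := h.tendsto.mono_left (nhdsWithin_le_nhds (s := Iio 1))
    have e : weightNorm α p = fun r => (1 + r) ^ (α + 2) := funext fun r => if_pos h1
    rw [weightConst, if_pos h1, e]
    norm_num at h2
    exact h2
  · have h := (tendsto_I12 hα (one_le_conjExp hp h1)).rpow_const (p := 1 / conjExp p)
      (Or.inl (gammaQuot_pos hα (one_le_conjExp hp h1)).ne')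
    have e : weightNorm α p = fun r => (1 / (2 * Real.pi) * I12 α (conjExp p) r) ^
        (1 / conjExp p) := funext fun r => if_neg h1
    rw [weightConst, if_neg h1, e]
    exact h

lemma isLUB_C : IsLUB (C α p '' Ico 0 1) (CConst α p) := by
  have hc := c_pos hα
  refine isLUB_of_monotoneOn_tendsto ?_ ?_
  · intro x hx y hy hxy
    rw [C_eq, C_eq]
    have h1 := monotoneOn_weightNorm hα hp hx hy hxy
    have h2 := weightNorm_nonneg (α := α) (p := p) hx
    have h3 : 0 ≤ |α| * y / 2 + 1 + α / 2 := by
      have := mul_nonneg (abs_nonneg α) hy.1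
      linarith
    gcongr
  · have e : C α p = fun r => c α * (|α| * r / 2 + 1 + α / 2) * weightNorm α p r :=
      funext (C_eq α p)
    rw [e, CConst_eq]
    refine Tendsto.mul (Tendsto.mono_left ?_ nhdsWithin_le_nhds) (tendsto_weightNorm hα hp)
    have h : ContinuousAt (fun r : ℝ => c α * (|α| * r / 2 + 1 + α / 2)) 1 := by fun_prop
    simpa [ContinuousAt] using h

variable {r : ℝ} (hr : r ∈ Ico (0 : ℝ) 1)

include hr

/-- The triangle inequality bounds the modulus of (α+2)e^{is} - αr by a constant in s, leaving the
norm of the weight alone. -/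
lemma weightedNorm_wirtinger_le : weightedNorm α p r (wirtingerΦ α r) ≤ C α p r := by
  have hk := isMobiusKernel_wirtinger hα hr
  have hc := c_pos hα
  have h0 : 0 ≤ c α * (|α| * r / 2 + 1 + α / 2) := by
    have := mul_nonneg (abs_nonneg α) hr.1
    exact mul_nonneg hc.le (by linarith)
  rw [C_eq, ← weightedNorm_const hα hr hp h0]
  refine weightedNorm_mono hr hp hk.contΦ continuous_const hk.nonneg (fun s => ?_) fun _ => rfl
  rw [wirtingerΦ]
  gcongr
  have h := norm_sub_le (((α + 2 : ℝ) : ℂ) * Complex.exp (s * Complex.I)) ((α * r : ℝ) : ℂ)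
  rw [norm_mul, Complex.norm_exp_ofReal_mul_I, mul_one, Complex.norm_real, Complex.norm_real,
    Real.norm_of_nonneg (by linarith), Real.norm_eq_abs, abs_mul, abs_of_nonneg hr.1] at h
  linarith

/-- The reverse triangle inequality. It differs from the upper bound only in the sign of |α|, so the
two have the same limit as α → 0 and agree at α = 0. -/
lemma le_weightedNorm_wirtinger (h1 : 0 ≤ 1 + α / 2 - |α| / 2) :
    c α * (1 + α / 2 - |α| / 2) * weightNorm α p r ≤ weightedNorm α p r (wirtingerΦ α r) := by
  have hk := isMobiusKernel_wirtinger hα hr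
  have hc := c_pos hα
  have h0 : 0 ≤ c α * (1 + α / 2 - |α| / 2) := by positivity
  rw [← weightedNorm_const hα hr hp h0]
  refine weightedNorm_mono hr hp continuous_const hk.contΦ (fun _ => h0) (fun s => ?_) hk.periodicΦ
  rw [wirtingerΦ]
  gcongr
  have h := norm_sub_norm_le (((α + 2 : ℝ) : ℂ) * Complex.exp (s * Complex.I)) ((α * r : ℝ) : ℂ)
  rw [norm_mul, Complex.norm_exp_ofReal_mul_I, mul_one, Complex.norm_real, Complex.norm_real,
    Real.norm_of_nonneg (by linarith : 0 ≤ α + 2), Real.norm_eq_abs, abs_mul,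
    abs_of_nonneg hr.1] at h
  have : |α| * r ≤ |α| := mul_le_of_le_one_right (abs_nonneg _) hr.2.le
  linarith

end

/-- Asymptotic sharpness from two-sided bounds with the same constant. -/
lemma isAsymptoticallySharp_wirtinger {D : (ℂ → ℂ) → ℝ → ℝ → ℂ}
    (hD : ∀ α : ℝ, -1 < α → HasMobiusKernel D α (wirtingerΦ α)) {p : ℝ≥0∞} (hp : 1 ≤ p) :
    IsAsymptoticallySharp D p fun α => CConst α p := by
  have hadm : ∀ α : ℝ, -1 < α → CConst α p ∈ Admissible D α p := fun α hα f hf r hr θ =>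
    (hD α hα).norm_le hp hf hr θ ((weightedNorm_wirtinger_le hα hp hr).trans
      ((isLUB_C hα hp).1 (mem_image_of_mem _ hr)))
  have hlow : ∀ α : ℝ, -1 < α → 0 ≤ 1 + α / 2 - |α| / 2 → ∀ N ∈ Admissible D α p,
      c α * (1 + α / 2 - |α| / 2) * weightConst α p ≤ N := fun α hα h1 N hN => by
    refine le_of_tendsto ((tendsto_weightNorm hα hp).const_mul _) ?_
    filter_upwards [eventually_mem_Ico] with r hr
    exact (le_weightedNorm_wirtinger hα hp hr h1).trans ((hD α hα).weightedNorm_le hp hN hr)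
  refine ⟨⟨hadm 0 (by norm_num), fun N hN => ?_⟩, fun ε hε => ?_⟩
  · have h := hlow 0 (by norm_num) (by norm_num) N hN
    simp only
    rw [CConst_eq]
    simpa using h
  -- The bound 1/2 keeps α > -1 and the lower factor nonnegative; the bound ε/(2+ε) makes the upper
  -- factor at most 1+ε times the lower one.
  · have hδ : 0 < min (1 / 2) (ε / (2 + ε)) := by positivity
    filter_upwards [Metric.ball_mem_nhds (0 : ℝ) hδ] with α hα
    rw [Metric.mem_ball, dist_zero_right, Real.norm_eq_abs, lt_min_iff] at hα
    have h1 : -1 < α := by linarith [(abs_lt.1 hα.1).1]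
    have h2 : 0 ≤ 1 + α / 2 - |α| / 2 := by
      linarith [neg_abs_le α, hα.1]
    refine ⟨hadm α h1, fun N hN => ?_⟩
    have h3 := hlow α h1 h2 N hN
    refine le_trans ?_ (mul_le_mul_of_nonneg_left h3 (by positivity))
    have hc := c_pos h1
    have hw := weightConst_pos h1 hp
    rw [CConst_eq]
    have h4 : |α| / 2 + 1 + α / 2 ≤ (1 + ε) * (1 + α / 2 - |α| / 2) := by
      have h5 := hα.2
      rw [lt_div_iff₀ (by positivity)] at h5
      nlinarith [neg_abs_le α, abs_nonneg α]
    calc c α * (|α| / 2 + 1 + α / 2) * weightConst α p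
        ≤ c α * ((1 + ε) * (1 + α / 2 - |α| / 2)) * weightConst α p := by gcongr
      _ = _ := by ring

/-! ### The angular derivative -/

lemma bddAbove_abs_sin_mul_w {α : ℝ} (hα : -1 < α) {r : ℝ} (hr : 0 ≤ r) :
    BddAbove (range fun s => |Real.sin s| * w r s ^ (α + 2)) := by
  refine ⟨(1 + r) ^ (α + 2), ?_⟩
  rintro _ ⟨s, rfl⟩
  have h1 : w r s ^ (α + 2) ≤ (1 + r) ^ (α + 2) :=
    Real.rpow_le_rpow (norm_nonneg _) (w_le hr s) (by linarith)
  have h2 : 0 ≤ w r s ^ (α + 2) := Real.rpow_nonneg (norm_nonneg _) _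
  exact (mul_le_of_le_one_left h2 (Real.abs_sin_le_one s)).trans h1

lemma weightedNorm_abs_sin {α r : ℝ} (hr : r ∈ Ico (0 : ℝ) 1) {p : ℝ≥0∞} (hp : 1 ≤ p)
    (h1 : p ≠ 1) :
    weightedNorm α p r (fun s => |Real.sin s|) =
      (sinMean (conjExp p) (halfExp α (conjExp p)) r / Real.pi) ^ (1 / conjExp p) := by
  have hq := conjExp_pos hp h1
  have hπ := Real.pi_pos
  rw [weightedNorm, if_neg h1]
  simp only [w_rpow_eq hr]
  rw [← halfExp, integral_abs_sin_rpow hr hq.le]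
  congr 1
  field_simp

/-- The real shift αr does not affect the imaginary part, so the norm is an exact sine mean. This
equality is the source of sharpness. -/
lemma weightedNorm_angular {α : ℝ} (hα : -1 < α) {p : ℝ≥0∞} (hp : 1 ≤ p) {r : ℝ}
    (hr : r ∈ Ico (0 : ℝ) 1) : weightedNorm α p r (angularΦ α r) = B α p r := by
  have hc := c_pos hα
  have h0 : 0 ≤ (α + 2) * c α * r := by
    have := hr.1
    have : 0 ≤ α + 2 := by linarith
    positivity
  have e : angularΦ α r = fun s => (α + 2) * c α * r * |Real.sin s| := by
    funext s
    rw [angularΦ]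
    ring
  rw [e, weightedNorm_const_mul hr hp h0 fun s => abs_nonneg _, B]
  split_ifs with h1
  · rw [weightedNorm, if_pos h1]
  · have hq := conjExp_pos hp h1
    have hF := sinMean_eq_hypergeometric hq (halfExp α (conjExp p)) hr
    have hpos := sinMean_pos hq.le (halfExp α (conjExp p)) (Ico_subset_Ioo' hr)
    rw [show -(halfExp α (conjExp p) + conjExp p / 2) = 1 - (α + 3) * conjExp p / 2 by
      rw [halfExp]; ring, show -halfExp α (conjExp p) = 1 - (α + 2) * conjExp p / 2 by
      rw [halfExp]; ring] at hF
    dsimp only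
    rw [weightedNorm_abs_sin hr hp h1, ← hF, Real.div_rpow hpos.le Real.pi_pos.le]
    ring

/-- Reflecting s to π-s if necessary makes the cosine nonnegative without changing |sin s| or
decreasing w; then w increases with r. -/
lemma w_le_w_one {r : ℝ} (hr : r ∈ Ico (0 : ℝ) 1) (s : ℝ) :
    ∃ s', |Real.sin s'| = |Real.sin s| ∧ w r s ≤ w 1 s' := by
  have key : ∀ s', Real.cos s ≤ Real.cos s' → 0 ≤ Real.cos s' → w r s ≤ w 1 s' := fun s' h h0 => by
    have h2 : w r s ^ 2 ≤ w 1 s' ^ 2 := by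
      rw [w_sq, w_sq]
      nlinarith [hr.1, hr.2, mul_le_mul_of_nonneg_left h hr.1]
    exact (pow_le_pow_iff_left₀ (norm_nonneg _ : 0 ≤ w r s) (norm_nonneg _ : 0 ≤ w 1 s')
      two_ne_zero).1 h2
  rcases le_total 0 (Real.cos s) with h | h
  · exact ⟨s, rfl, key s le_rfl h⟩
  · refine ⟨Real.pi - s, by rw [Real.sin_pi_sub], key _ ?_ ?_⟩ <;> rw [Real.cos_pi_sub] <;> linarith

/-- The half exponent equals q(α+2/p)/2, so the condition on α and p is exactly its nonnegativity.
-/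
lemma halfExp_nonneg {α : ℝ} {p : ℝ≥0∞} (hp : 1 ≤ p) (h1 : p ≠ 1)
    (h : 0 ≤ α + 2 * (p⁻¹).toReal) : 0 ≤ halfExp α (conjExp p) := by
  have hq := conjExp_pos hp h1
  have e := inv_conjExp_add hp h1
  have e2 : halfExp α (conjExp p) = conjExp p * (α + 2 * (p⁻¹).toReal) / 2 := by
    have : (p⁻¹).toReal = 1 - (conjExp p)⁻¹ := by linarith
    rw [this, halfExp]
    field_simp
    ring
  rw [e2]
  positivity

lemma isLUB_B {α : ℝ} (hα : -1 < α) {p : ℝ≥0∞} (hp : 1 ≤ p) (h : 0 ≤ α + 2 * (p⁻¹).toReal) :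
    IsLUB (B α p '' Ico 0 1) (BConst α p) := by
  have hc := c_pos hα
  have hK : 0 < (α + 2) * c α := mul_pos (by linarith) hc
  by_cases h1 : p = 1
  · constructor
    · rintro _ ⟨r, hr, rfl⟩
      have hs0 : 0 ≤ ⨆ s : ℝ, |Real.sin s| * w 1 s ^ (α + 2) :=
        Real.iSup_nonneg fun s => mul_nonneg (abs_nonneg _) (Real.rpow_nonneg (norm_nonneg _) _)
      have hle : ⨆ s : ℝ, |Real.sin s| * w r s ^ (α + 2) ≤
          ⨆ s : ℝ, |Real.sin s| * w 1 s ^ (α + 2) := by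
        refine ciSup_le fun s => ?_
        obtain ⟨s', h2, h3⟩ := w_le_w_one hr s
        refine le_trans ?_ (le_ciSup (bddAbove_abs_sin_mul_w hα zero_le_one) s')
        rw [h2]
        exact mul_le_mul_of_nonneg_left
          (Real.rpow_le_rpow (norm_nonneg _) h3 (by linarith)) (abs_nonneg _)
      rw [B, BConst, if_pos h1, if_pos h1, mul_assoc]
      refine mul_le_mul_of_nonneg_left ?_ hK.le
      exact (mul_le_mul_of_nonneg_left hle hr.1).trans (mul_le_of_le_one_left hs0 hr.2.le)
    · intro M hM
      rw [BConst, if_pos h1, Real.mul_iSup_of_nonneg hK.le]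
      refine ciSup_le fun s => ?_
      have hcont : ContinuousAt
          (fun r => (α + 2) * c α * r * (|Real.sin s| * w r s ^ (α + 2))) 1 := by
        have : ContinuousAt (fun r => w r s) 1 := by unfold w; fun_prop
        have h2 : ContinuousAt (fun r => w r s ^ (α + 2)) 1 :=
          this.rpow_const (Or.inr (by linarith))
        fun_prop
      have ht := hcont.tendsto.mono_left (nhdsWithin_le_nhds (s := Iio 1))
      rw [mul_one] at ht
      refine le_of_tendsto ht ?_
      filter_upwards [eventually_mem_Ico] with r hr
      refine le_trans ?_ (hM (mem_image_of_mem _ hr))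
      rw [B, if_pos h1]
      exact mul_le_mul_of_nonneg_left (le_ciSup (bddAbove_abs_sin_mul_w hα hr.1) s)
        (mul_nonneg hK.le hr.1)
  · have hq := conjExp_pos hp h1
    have hm := halfExp_nonneg hp h1 h
    refine isLUB_of_monotoneOn_tendsto ?_ ?_
    · intro x hx y hy hxy
      have hM := monotoneOn_sinMean hq.le (m := halfExp α (conjExp p)) (by positivity) hx hy hxy
      have e : ∀ r ∈ Ico (0 : ℝ) 1, B α p r = (α + 2) * c α * r *
          (sinMean (conjExp p) (halfExp α (conjExp p)) r / Real.pi) ^ (1 / conjExp p) := by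
        intro r hr
        have e : angularΦ α r = fun s => (α + 2) * c α * r * |Real.sin s| := by
          funext s
          rw [angularΦ]
          ring
        rw [← weightedNorm_angular hα hp hr, e, weightedNorm_const_mul hr hp
          (mul_nonneg hK.le hr.1) fun s => abs_nonneg _, weightedNorm_abs_sin hr hp h1]
      have hpos := sinMean_pos hq.le (halfExp α (conjExp p)) (Ico_subset_Ioo' hx)
      have hπ := Real.pi_pos
      have hy0 := hy.1
      rw [e x hx, e y hy]
      gcongr
    -- Convergence at 1 requires (α+3)q > 2, which follows from (α+2)q ≥ 2 and q > 0.
    · have hF := tendsto_hypSeries_one (1 - (α + 3) * conjExp p / 2) (1 - (α + 2) * conjExp p / 2)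
        (c := 1 + conjExp p / 2) (by linarith) (by rw [halfExp] at hm; linarith)
      have hsq : Tendsto (fun r : ℝ => r ^ 2) (𝓝[<] 1) (𝓝[<] 1) := by
        refine tendsto_nhdsWithin_iff.2 ⟨?_, ?_⟩
        · have : ContinuousAt (fun r : ℝ => r ^ 2) 1 := by fun_prop
          simpa [ContinuousAt] using this.tendsto.mono_left (nhdsWithin_le_nhds (s := Iio 1))
        · filter_upwards [eventually_mem_Ico] with r hr
          exact pow_lt_one₀ hr.1 hr.2 two_ne_zero
      have hF2 := ((hF.comp hsq).const_mul
        (ProbabilityTheory.beta ((conjExp p + 1) / 2) (1 / 2))).rpow_const (p := 1 / conjExp p)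
          (Or.inr (by positivity))
      have hr1 : Tendsto (fun r : ℝ => (α + 2) * c α / Real.pi ^ (1 / conjExp p) * r) (𝓝[<] 1)
          (𝓝 ((α + 2) * c α / Real.pi ^ (1 / conjExp p) * 1)) :=
        (tendsto_id.mono_left nhdsWithin_le_nhds).const_mul _
      have hfin := hr1.mul hF2
      have eB : B α p = fun r => (α + 2) * c α / Real.pi ^ (1 / conjExp p) * r *
          (ProbabilityTheory.beta ((conjExp p + 1) / 2) (1 / 2) *
            hypSeries (1 - (α + 3) * conjExp p / 2) (1 - (α + 2) * conjExp p / 2)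
              (1 + conjExp p / 2) 0 (r ^ 2)) ^ (1 / conjExp p) := by
        funext r
        rw [B, if_neg h1]
        simp only [ordinaryHypergeometric_eq_hypSeries]
      rw [eB, BConst, if_neg h1]
      simp only [ordinaryHypergeometric_eq_hypSeries]
      simpa using hfin

lemma isSharp_dTheta {α : ℝ} (hα : -1 < α) {p : ℝ≥0∞} (hp : 1 ≤ p)
    (h : 0 ≤ α + 2 * (p⁻¹).toReal) : IsSharp dTheta α p (BConst α p) := by
  refine (hasMobiusKernel_dTheta hα).isSharp hp ?_
  rw [image_congr fun r hr => weightedNorm_angular hα hp hr]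
  exact isLUB_B hα hp h

/-! ### The radial derivative -/

/-- The graph of the q-th power lies above its tangent at x, which is Bernoulli's inequality for
y/x. Only x needs the bound R. -/
lemma rpow_le_rpow_add {q R x y : ℝ} (hq : 1 ≤ q) (hx0 : 0 ≤ x) (hxR : x ≤ R) (hy : 0 ≤ y) :
    x ^ q ≤ y ^ q + q * R ^ (q - 1) * |x - y| := by
  rcases hx0.eq_or_lt with h | h
  · rw [← h, Real.zero_rpow (by linarith)]
    have : 0 ≤ R := by linarith
    positivity
  · have hB := one_add_mul_self_le_rpow_one_add (s := y / x - 1)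
      (by have : 0 ≤ y / x := by positivity
          linarith) hq
    rw [add_sub_cancel, Real.div_rpow hy h.le, le_div_iff₀ (by positivity)] at hB
    have hxq : x ^ q = x ^ (q - 1) * x := by
      rw [← Real.rpow_add_one h.ne']
      congr 1
      ring
    have h1 : x ^ q - q * x ^ (q - 1) * (x - y) ≤ y ^ q := by
      refine le_trans (le_of_eq ?_) hB
      rw [hxq]
      field_simp
      ring
    have h2 : q * x ^ (q - 1) * (x - y) ≤ q * R ^ (q - 1) * |x - y| := by
      have h3 : x ^ (q - 1) ≤ R ^ (q - 1) := Real.rpow_le_rpow h.le hxR (by linarith)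
      have h4 := le_abs_self (x - y)
      have h5 : 0 ≤ x ^ (q - 1) := by positivity
      calc q * x ^ (q - 1) * (x - y) ≤ q * x ^ (q - 1) * |x - y| := by gcongr
        _ ≤ _ := by gcongr
    linarith

section

variable {α : ℝ} (hα : -1 < α) {p : ℝ≥0∞} (hp : 1 ≤ p)

include hα

lemma monotoneOn_A_one : MonotoneOn (A α 1) (Ico 0 1) := by
  intro x hx y hy hxy
  have hc := c_pos hα
  rw [A, A, if_pos rfl, if_pos rfl]
  have h1 : (1 + x) ^ (α + 2) ≤ (1 + y) ^ (α + 2) :=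
    Real.rpow_le_rpow (by linarith [hx.1]) (by linarith) (by linarith)
  have h2 : 0 ≤ (1 + x) ^ (α + 2) := Real.rpow_nonneg (by linarith [hx.1]) _
  have h3 : 0 ≤ |α| * y + α + 2 := by
    have := mul_nonneg (abs_nonneg α) hy.1
    linarith
  gcongr

omit hα in
lemma tendsto_A_one (α : ℝ) :
    Tendsto (A α 1) (𝓝[<] 1) (𝓝 (c α * ((|α| + α + 2) * 2 ^ (α + 2)))) := by
  have e : A α 1 = fun r => c α * ((|α| * r + α + 2) * (1 + r) ^ (α + 2)) :=
    funext fun r => if_pos rfl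
  have h : ContinuousAt (fun r : ℝ => c α * ((|α| * r + α + 2) * (1 + r) ^ (α + 2))) 1 := by
    have h1 : ContinuousAt (fun r : ℝ => (1 + r) ^ (α + 2)) 1 :=
      ContinuousAt.rpow_const (by fun_prop) (Or.inl (by norm_num))
    fun_prop
  have h2 := h.tendsto.mono_left (nhdsWithin_le_nhds (s := Iio 1))
  rw [e]
  norm_num at h2
  exact h2

lemma isLUB_A_one : IsLUB (A α 1 '' Ico 0 1) (c α * ((|α| + α + 2) * 2 ^ (α + 2))) :=
  isLUB_of_monotoneOn_tendsto (monotoneOn_A_one hα) (tendsto_A_one α)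

omit hα in
lemma image_Ico_nonempty (f : ℝ → ℝ) : (f '' Ico (0 : ℝ) 1).Nonempty :=
  ⟨f 0, mem_image_of_mem _ ⟨le_rfl, zero_lt_one⟩⟩

lemma AConst_one : AConst α 1 = c α * ((|α| + α + 2) * 2 ^ (α + 2)) :=
  (isLUB_A_one hα).csSup_eq (image_Ico_nonempty _)

omit hα in
/-- `A_{α,p}(r)` for `p > 1`, in terms of the normalized means. -/
lemma A_eq (h1 : p ≠ 1) (α r : ℝ) :
    A α p r = c α * ((α + 2) ^ conjExp p * (1 / (2 * Real.pi) * I11 α (conjExp p) r) +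
      conjExp p * (|α| * r + α + 2) ^ (conjExp p - 1) * |α| * r *
        (1 / (2 * Real.pi) * I12 α (conjExp p) r)) ^ (1 / conjExp p) := by
  rw [A, if_neg h1]
  simp only
  congr 2
  ring

omit hα in
lemma I11_nonneg (α q r : ℝ) : 0 ≤ I11 α q r := by
  refine intervalIntegral.integral_nonneg Real.two_pi_pos.le fun s _ => ?_
  exact div_nonneg (Real.rpow_nonneg (abs_nonneg _) _) (Real.rpow_nonneg (norm_nonneg _) _)

omit hα in
lemma continuous_abs_cos_rpow {q : ℝ} (hq : 0 ≤ q) : Continuous fun t => |Real.cos t| ^ q :=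
  Real.continuous_cos.abs.rpow_const fun _ => Or.inr hq

omit hα in
lemma intervalIntegrable_mul_Q {r : ℝ} (hr : r ∈ Ico (0 : ℝ) 1) {g : ℝ → ℝ} (hg : Continuous g)
    (m a b : ℝ) : IntervalIntegrable (fun t => g t * Q r t ^ m) volume a b :=
  (hg.mul (continuous_Q_rpow (Ico_subset_Ioo' hr) m)).intervalIntegrable _ _

omit hα in
lemma I11_le_I12 {q : ℝ} (hq : 0 ≤ q) {r : ℝ} (hr : r ∈ Ico (0 : ℝ) 1) (α : ℝ) :
    I11 α q r ≤ I12 α q r := by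
  rw [I11_eq hr, I12_eq hr]
  have h1 := intervalIntegrable_mul_Q hr (g := fun _ => 1) continuous_const (halfExp α q) 0
    (2 * Real.pi)
  simp only [one_mul] at h1
  refine intervalIntegral.integral_mono_on Real.two_pi_pos.le
    (intervalIntegrable_mul_Q hr (continuous_abs_cos_rpow hq) _ _ _) h1 fun t _ => ?_
  have := Q_pos (Ico_subset_Ioo' hr) t
  exact mul_le_of_le_one_left (by positivity)
    (Real.rpow_le_one (abs_nonneg _) (Real.abs_cos_le_one t) hq)

include hp

/-- A bound for `A_{α,p}(r)` in terms of a bound for the first mean. -/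
lemma A_le_of_I11_le (h1 : p ≠ 1) {r : ℝ} (hr : r ∈ Ico (0 : ℝ) 1) {X : ℝ}
    (hX : 1 / (2 * Real.pi) * I11 α (conjExp p) r ≤ X) :
    A α p r ≤ c α * ((α + 2) ^ conjExp p * X +
      conjExp p * (|α| + α + 2) ^ (conjExp p - 1) * |α| * gammaQuot α (conjExp p)) ^
        (1 / conjExp p) := by
  have hc := c_pos hα
  have hq := conjExp_pos hp h1
  have hq1 := one_le_conjExp hp h1
  have hα2 : 0 < α + 2 := by linarith
  have hY := I12_le hα hq1 hr
  have hY0 := (I12_pos hr α (conjExp p)).le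
  have hX0 : 0 ≤ 1 / (2 * Real.pi) * I11 α (conjExp p) r :=
    mul_nonneg (by have := Real.pi_pos; positivity) (I11_nonneg _ _ _)
  have hr0 := hr.1
  have h2 : |α| * r ≤ |α| := mul_le_of_le_one_right (abs_nonneg _) hr.2.le
  have h2' : 0 ≤ |α| * r := by positivity
  have h3 : (|α| * r + α + 2) ^ (conjExp p - 1) ≤ (|α| + α + 2) ^ (conjExp p - 1) :=
    Real.rpow_le_rpow (by linarith) (by linarith) (by linarith)
  have h4 : 0 ≤ (|α| * r + α + 2) ^ (conjExp p - 1) := Real.rpow_nonneg (by linarith) _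
  rw [A_eq h1]
  refine mul_le_mul_of_nonneg_left (Real.rpow_le_rpow (by positivity) ?_ (by positivity)) hc.le
  have h6 : 0 ≤ (|α| + α + 2) ^ (conjExp p - 1) := h4.trans h3
  have h5 : conjExp p * (|α| * r + α + 2) ^ (conjExp p - 1) * |α| * r *
        (1 / (2 * Real.pi) * I12 α (conjExp p) r) ≤
      conjExp p * (|α| + α + 2) ^ (conjExp p - 1) * |α| * gammaQuot α (conjExp p) := by
    calc _ = conjExp p * (|α| * r + α + 2) ^ (conjExp p - 1) * (|α| * r) *
        (1 / (2 * Real.pi) * I12 α (conjExp p) r) := by ring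
      _ ≤ _ := by gcongr
  gcongr

/-- Only finiteness is at stake; for p > 1 it follows from |cos| ≤ 1 and the bound on the normalized
mean of the weight. -/
lemma isLUB_A : IsLUB (A α p '' Ico 0 1) (AConst α p) := by
  refine isLUB_csSup (image_Ico_nonempty _) ?_
  by_cases h1 : p = 1
  · subst h1
    exact (isLUB_A_one hα).bddAbove
  · refine ⟨_, forall_mem_image.2 fun r hr => A_le_of_I11_le hα hp h1 hr
      (X := gammaQuot α (conjExp p)) ?_⟩
    refine le_trans ?_ (I12_le hα (one_le_conjExp hp h1) hr)
    exact mul_le_mul_of_nonneg_left (I11_le_I12 (conjExp_pos hp h1).le hr α)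
      (by have := Real.pi_pos; positivity)

omit hα hp in
lemma AClosed_eq (α : ℝ) (p : ℝ≥0∞) (θ : ℝ) :
    AClosed α p θ = c α * ((α + 2) ^ conjExp p *
      (1 / (2 * Real.pi) * G (conjExp p) (halfExp α (conjExp p)) 1 θ) +
      conjExp p * (|α| + α + 2) ^ (conjExp p - 1) * |α| * gammaQuot α (conjExp p)) ^
        (1 / conjExp p) := by
  rw [AClosed]
  simp only [halfExp, gammaQuot]
  congr 3
  ring

end

/-! ### The first mean for large exponents -/

lemma exists_convex_comb_neg {r₁ r₂ : ℝ} (h0 : 0 ≤ r₁) (h : r₁ ≤ r₂) :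
    ∃ μ ∈ Icc (0 : ℝ) 1, r₁ = μ * r₂ + (1 - μ) * -r₂ := by
  rcases (h0.trans h).eq_or_lt with h3 | h3
  · exact ⟨0, by norm_num, by rw [← h3] at h ⊢; linarith⟩
  · refine ⟨(r₁ + r₂) / (2 * r₂), ⟨by positivity, ?_⟩, ?_⟩
    · rw [div_le_one (by positivity)]
      linarith
    · field_simp
      ring

/-- The modulus of an affine function of r is convex, and a power 2m ≥ 1 preserves this. -/
lemma Q_rpow_convex {m : ℝ} (hm : 1 / 2 ≤ m) (t : ℝ) : ConvexOn ℝ univ fun r => Q r t ^ m := by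
  have h1 : ConvexOn ℝ univ fun r : ℝ => w r t := by
    have hn : ConvexOn ℝ univ (norm : ℂ → ℝ) := convexOn_norm convex_univ
    refine ⟨convex_univ, fun x _ y _ a b ha hb hab => ?_⟩
    have h2 := hn.2 (mem_univ (1 + (x : ℂ) * Complex.exp (-(t * Complex.I))))
      (mem_univ (1 + (y : ℂ) * Complex.exp (-(t * Complex.I)))) ha hb hab
    refine le_trans (le_of_eq ?_) h2
    change ‖_‖ = ‖_‖
    congr 1
    simp only [smul_eq_mul, Complex.real_smul]
    push_cast
    have : (a : ℂ) + b = 1 := by exact_mod_cast hab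
    linear_combination (-1 : ℂ) * this
  have h2 : ConvexOn ℝ (Ici 0) fun x : ℝ => x ^ (2 * m) := convexOn_rpow (by linarith)
  have h3 : MonotoneOn (fun x : ℝ => x ^ (2 * m)) (Ici 0) := fun x hx y _ hxy =>
    Real.rpow_le_rpow hx hxy (by linarith)
  have e : (fun r => Q r t ^ m) = fun r => w r t ^ (2 * m) := by
    funext r
    rw [Q_eq_w_sq, ← Real.rpow_natCast, ← Real.rpow_mul (x := w r t) (norm_nonneg _)]
    norm_num
  rw [e]
  refine ⟨convex_univ, fun x _ y _ a b ha hb hab => ?_⟩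
  have hx : w x t ∈ Ici (0 : ℝ) := norm_nonneg _
  have hy : w y t ∈ Ici (0 : ℝ) := norm_nonneg _
  have h5 := h1.2 (mem_univ x) (mem_univ y) ha hb hab
  exact (h3 (norm_nonneg _ : w (a • x + b • y) t ∈ Ici (0 : ℝ))
    (h2.1 hx hy ha hb hab) h5).trans (h2.2 hx hy ha hb hab)

lemma Q_neg_left (r t : ℝ) : Q (-r) t = Q r (t + Real.pi) := by
  rw [Q, Q, Real.cos_add_pi]
  ring

/-- As a function of r in (-1,1) the mean is convex, and it is even because the half turn t ↦ t+π
exchanges r and -r while fixing |cos t|. An even convex function increases on the positive side. -/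
lemma monotoneOn_I11 {α q : ℝ} (hq : 0 ≤ q) (hm : 1 / 2 ≤ halfExp α q) :
    MonotoneOn (I11 α q) (Ico 0 1) := by
  intro x hx y hy hxy
  rw [I11_eq hx, I11_eq hy]
  obtain ⟨μ, hμ, e⟩ := exists_convex_comb_neg hx.1 hxy
  have hy' : -y ∈ Ioo (-1 : ℝ) 1 := ⟨by linarith [hy.2], by linarith [hy.1]⟩
  have hcos := continuous_abs_cos_rpow hq
  have i1 := intervalIntegrable_mul_Q hy hcos (halfExp α q) 0 (2 * Real.pi)
  have i2 : IntervalIntegrable (fun t => |Real.cos t| ^ q * Q (-y) t ^ halfExp α q) volume 0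
      (2 * Real.pi) := (hcos.mul (continuous_Q_rpow hy' _)).intervalIntegrable _ _
  have hsymm : ∫ t in (0 : ℝ)..2 * Real.pi, |Real.cos t| ^ q * Q (-y) t ^ halfExp α q =
      ∫ t in (0 : ℝ)..2 * Real.pi, |Real.cos t| ^ q * Q y t ^ halfExp α q := by
    have hper : Function.Periodic (fun t => |Real.cos t| ^ q * Q y t ^ halfExp α q)
        (2 * Real.pi) := fun t => by simp only [Real.cos_add_two_pi, periodic_Q y t]
    have h1 := intervalIntegral.integral_comp_add_right (a := 0) (b := 2 * Real.pi)
      (fun t => |Real.cos t| ^ q * Q y t ^ halfExp α q) Real.pi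
    have h2 := hper.intervalIntegral_add_eq (0 + Real.pi) 0
    rw [zero_add, zero_add, add_comm Real.pi] at h2
    rw [zero_add] at h1
    rw [← h2, ← h1]
    simp only [Q_neg_left, Real.cos_add_pi, abs_neg]
  calc ∫ t in (0 : ℝ)..2 * Real.pi, |Real.cos t| ^ q * Q x t ^ halfExp α q
      ≤ ∫ t in (0 : ℝ)..2 * Real.pi, (μ * (|Real.cos t| ^ q * Q y t ^ halfExp α q) +
          (1 - μ) * (|Real.cos t| ^ q * Q (-y) t ^ halfExp α q)) := by
        refine intervalIntegral.integral_mono_on Real.two_pi_pos.le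
          (intervalIntegrable_mul_Q hx hcos _ _ _) ((i1.const_mul _).add (i2.const_mul _))
          fun t _ => ?_
        have h := (Q_rpow_convex hm t).2 (mem_univ y) (mem_univ (-y)) hμ.1
          (by linarith [hμ.2] : 0 ≤ 1 - μ) (by ring)
        simp only [smul_eq_mul, ← e] at h
        have h0 : 0 ≤ |Real.cos t| ^ q := by positivity
        calc _ ≤ |Real.cos t| ^ q * (μ * Q y t ^ halfExp α q +
              (1 - μ) * Q (-y) t ^ halfExp α q) := by gcongr
          _ = _ := by ring
    _ = _ := by
        rw [intervalIntegral.integral_add (i1.const_mul _) (i2.const_mul _),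
          intervalIntegral.integral_const_mul, intervalIntegral.integral_const_mul, hsymm]
        ring

lemma tendsto_I11 {α q : ℝ} (hq : 0 ≤ q) (hm : 0 ≤ halfExp α q) :
    Tendsto (I11 α q) (𝓝[<] 1) (𝓝 (G q (halfExp α q) 1 0)) := by
  have hb : ∀ t, |(|Real.cos t| ^ q)| ≤ 1 := fun t => by
    rw [abs_of_nonneg (by positivity)]
    exact Real.rpow_le_one (abs_nonneg _) (Real.abs_cos_le_one t) hq
  have h := (tendsto_integral_mul_Q_rpow (continuous_abs_cos_rpow hq) hb
    (m := halfExp α q) (by linarith)).const_mul 2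
  have e : G q (halfExp α q) 1 0 = 2 * ∫ t in (0 : ℝ)..Real.pi,
      |Real.cos t| ^ q * (2 + 2 * Real.cos t) ^ halfExp α q := by
    rw [G, ← integral_symm_of_even]
    · congr 1
      funext t
      rw [sub_zero]
      congr 2
      ring
    · exact (continuous_abs_cos_rpow hq).mul
        (Continuous.rpow_const (by fun_prop) fun _ => Or.inr hm)
    · intro t
      rw [Real.cos_neg]
  rw [e]
  refine h.congr' ?_
  filter_upwards [eventually_mem_Ico] with r hr
  rw [I11_eq hr, integral_circle_mul_Q_rpow hr (continuous_abs_cos_rpow hq)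
    (fun t => by rw [Real.cos_neg]) fun t => by simp only [Real.cos_add_two_pi]]

/-! ### The first mean for small exponents -/

/-- For a concave function, moving a symmetric pair of points towards its centre increases the sum
of values. -/
lemma add_rpow_sub_rpow_le {m a x y : ℝ} (hm0 : 0 ≤ m) (hm1 : m ≤ 1) (hy : 0 ≤ y) (hyx : y ≤ x)
    (hxa : x ≤ a) : (a + x) ^ m + (a - x) ^ m ≤ (a + y) ^ m + (a - y) ^ m := by
  have hconc := Real.concaveOn_rpow hm0 hm1
  rcases (hy.trans hyx).eq_or_lt with h | h
  · have : y = x := le_antisymm hyx (by linarith)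
    rw [this]
  · have hx1 : a + x ∈ Ici (0 : ℝ) := by rw [mem_Ici]; linarith
    have hx2 : a - x ∈ Ici (0 : ℝ) := by rw [mem_Ici]; linarith
    -- These weights write a+y and a-y as convex combinations of a+x and a-x.
    have hμ1 : 0 ≤ (x + y) / (2 * x) := by positivity
    have hμ2 : 0 ≤ (x - y) / (2 * x) := div_nonneg (by linarith) (by positivity)
    have hμ : (x + y) / (2 * x) + (x - y) / (2 * x) = 1 := by field_simp; ring
    have h1 := hconc.2 hx1 hx2 hμ1 hμ2 hμ
    have h2 := hconc.2 hx2 hx1 hμ1 hμ2 hμ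
    simp only [smul_eq_mul] at h1 h2
    rw [show (x + y) / (2 * x) * (a + x) + (x - y) / (2 * x) * (a - x) = a + y by
      field_simp; ring] at h1
    rw [show (x + y) / (2 * x) * (a - x) + (x - y) / (2 * x) * (a + x) = a - y by
      field_simp; ring] at h2
    have h3 : (a + x) ^ m + (a - x) ^ m = ((x + y) / (2 * x) + (x - y) / (2 * x)) *
      ((a + x) ^ m + (a - x) ^ m) := by rw [hμ, one_mul]
    rw [h3]
    linarith

lemma abs_rpow_symm {m a : ℝ} (x : ℝ) :
    (a + x) ^ m + (a - x) ^ m = (a + |x|) ^ m + (a - |x|) ^ m := by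
  rcases abs_cases x with ⟨h, _⟩ | ⟨h, _⟩
  · rw [h]
  · rw [h, ← sub_eq_add_neg, sub_neg_eq_add, add_comm]

/-- The difference D of the two weights changes sign under a quarter turn. Averaging over the four
quarter turns multiplies D by a difference of symmetric pairs, which by concavity has the same sign
as D. -/
lemma integral_cos_le_integral_sin {q m r : ℝ} (hq : 0 ≤ q) (hm0 : 0 ≤ m) (hm1 : m ≤ 1)
    (hr : r ∈ Ico (0 : ℝ) 1) :
    ∫ t in (0 : ℝ)..2 * Real.pi, |Real.cos t| ^ q * Q r t ^ m ≤
      ∫ t in (0 : ℝ)..2 * Real.pi, |Real.sin t| ^ q * Q r t ^ m := by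
  set D : ℝ → ℝ := fun t => |Real.sin t| ^ q - |Real.cos t| ^ q with hD
  have hDc : Continuous D := ((Real.continuous_sin.abs.rpow_const fun _ => Or.inr hq)).sub
    (continuous_abs_cos_rpow hq)
  have hDh : ∀ t, D (t + Real.pi / 2) = -D t := fun t => by
    simp only [hD, Real.sin_add_pi_div_two, Real.cos_add_pi_div_two, abs_neg]
    ring
  have hper : Function.Periodic (fun t => D t * Q r t ^ m) (2 * Real.pi) := fun t => by
    simp only [hD, Real.cos_add_two_pi, Real.sin_add_two_pi, periodic_Q r t]
  set J := ∫ t in (0 : ℝ)..2 * Real.pi, D t * Q r t ^ m with hJ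
  have hshift : ∀ a, ∫ t in (0 : ℝ)..2 * Real.pi, D (t + a) * Q r (t + a) ^ m = J := fun a => by
    rw [intervalIntegral.integral_comp_add_right (fun t => D t * Q r t ^ m) a]
    have := hper.intervalIntegral_add_eq (0 + a) 0
    rw [zero_add (2 * Real.pi), add_assoc, add_comm a, zero_add (2 * Real.pi + a)] at this
    exact this
  have hQc := continuous_Q_rpow (Ico_subset_Ioo' hr) m
  have hint : ∀ a, IntervalIntegrable (fun t => D t * Q r (t + a) ^ m) volume 0 (2 * Real.pi) :=
    fun a => (hDc.mul (hQc.comp (continuous_add_const a))).intervalIntegrable _ _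
  have h1 : ∫ t in (0 : ℝ)..2 * Real.pi, D t * Q r (t + Real.pi / 2) ^ m = -J := by
    rw [← hshift (Real.pi / 2), ← intervalIntegral.integral_neg]
    congr 1
    funext t
    rw [hDh]
    ring
  have h2 : ∫ t in (0 : ℝ)..2 * Real.pi, D t * Q r (t + Real.pi) ^ m = J := by
    rw [← hshift Real.pi]
    congr 1
    funext t
    rw [show t + Real.pi = t + Real.pi / 2 + Real.pi / 2 by ring, hDh, hDh, neg_neg]
  have h3 : ∫ t in (0 : ℝ)..2 * Real.pi, D t * Q r (t + 3 * Real.pi / 2) ^ m = -J := by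
    rw [← hshift (3 * Real.pi / 2), ← intervalIntegral.integral_neg]
    congr 1
    funext t
    rw [show t + 3 * Real.pi / 2 = t + Real.pi / 2 + Real.pi / 2 + Real.pi / 2 by ring, hDh, hDh,
      hDh]
    ring
  have i0 := hint 0
  simp only [add_zero] at i0
  have hsum : ∫ t in (0 : ℝ)..2 * Real.pi, (D t * Q r t ^ m + D t * Q r (t + Real.pi) ^ m -
      (D t * Q r (t + Real.pi / 2) ^ m + D t * Q r (t + 3 * Real.pi / 2) ^ m)) = 4 * J := by
    rw [intervalIntegral.integral_sub (i0.add (hint _)) ((hint _).add (hint _)),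
      intervalIntegral.integral_add i0 (hint _), intervalIntegral.integral_add (hint _) (hint _),
      h1, h2, h3]
    ring
  have hnonneg : 0 ≤ 4 * J := by
    rw [← hsum]
    refine intervalIntegral.integral_nonneg Real.two_pi_pos.le fun t _ => ?_
    have e1 : Q r t ^ m + Q r (t + Real.pi) ^ m =
        (1 + r ^ 2 + 2 * r * |Real.cos t|) ^ m + (1 + r ^ 2 - 2 * r * |Real.cos t|) ^ m := by
      have := abs_rpow_symm (m := m) (a := 1 + r ^ 2) (2 * r * Real.cos t)
      rw [abs_mul, abs_of_nonneg (by linarith [hr.1] : 0 ≤ 2 * r)] at this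
      rw [← this, Q, Q, Real.cos_add_pi]
      congr 2
      ring
    have e2 : Q r (t + Real.pi / 2) ^ m + Q r (t + 3 * Real.pi / 2) ^ m =
        (1 + r ^ 2 + 2 * r * |Real.sin t|) ^ m + (1 + r ^ 2 - 2 * r * |Real.sin t|) ^ m := by
      have := abs_rpow_symm (m := m) (a := 1 + r ^ 2) (2 * r * Real.sin t)
      rw [abs_mul, abs_of_nonneg (by linarith [hr.1] : 0 ≤ 2 * r)] at this
      rw [← this, Q, Q, show t + 3 * Real.pi / 2 = t + Real.pi / 2 + Real.pi by ring,
        Real.cos_add_pi, Real.cos_add_pi_div_two, add_comm]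
      congr 2 <;> ring
    have e3 : D t * Q r t ^ m + D t * Q r (t + Real.pi) ^ m -
        (D t * Q r (t + Real.pi / 2) ^ m + D t * Q r (t + 3 * Real.pi / 2) ^ m) =
        D t * ((Q r t ^ m + Q r (t + Real.pi) ^ m) -
          (Q r (t + Real.pi / 2) ^ m + Q r (t + 3 * Real.pi / 2) ^ m)) := by ring
    rw [e3, e1, e2]
    have hr0 := hr.1
    have hb : ∀ x : ℝ, |x| ≤ 1 → 2 * r * |x| ≤ 1 + r ^ 2 := fun x hx => by
      nlinarith [sq_nonneg (1 - r), mul_le_mul_of_nonneg_left hx hr.1]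
    -- The sign of D and the comparison of the pairs are both decided by which of |cos t| and |sin
    -- t| is larger.
    rcases le_total |Real.cos t| |Real.sin t| with h | h
    · refine mul_nonneg (sub_nonneg.2 (Real.rpow_le_rpow (abs_nonneg _) h hq)) (sub_nonneg.2 ?_)
      exact add_rpow_sub_rpow_le hm0 hm1 (by positivity) (by gcongr)
        (hb _ (Real.abs_sin_le_one t))
    · refine mul_nonneg_of_nonpos_of_nonpos
        (sub_nonpos.2 (Real.rpow_le_rpow (abs_nonneg _) h hq)) (sub_nonpos.2 ?_)
      exact add_rpow_sub_rpow_le hm0 hm1 (by positivity) (by gcongr)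
        (hb _ (Real.abs_cos_le_one t))
  have hJs : J = (∫ t in (0 : ℝ)..2 * Real.pi, |Real.sin t| ^ q * Q r t ^ m) -
      ∫ t in (0 : ℝ)..2 * Real.pi, |Real.cos t| ^ q * Q r t ^ m := by
    rw [← intervalIntegral.integral_sub
      (intervalIntegrable_mul_Q hr (Real.continuous_sin.abs.rpow_const fun _ => Or.inr hq) _ _ _)
      (intervalIntegrable_mul_Q hr (continuous_abs_cos_rpow hq) _ _ _), hJ]
    congr 1
    funext t
    simp only [hD]
    ring
  linarith

lemma two_mul_sinMean_le_G {q m : ℝ} (hq : 0 ≤ q) (hm : 0 ≤ m) {r : ℝ} (hr : r ∈ Ico (0 : ℝ) 1) :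
    2 * sinMean q m r ≤ G q m 1 (Real.pi / 2) := by
  have hb : ∀ t, |(|Real.sin t| ^ q)| ≤ 1 := fun t => by
    rw [abs_of_nonneg (by positivity)]
    exact Real.rpow_le_one (abs_nonneg _) (Real.abs_sin_le_one t) hq
  have hsc : Continuous fun t => |Real.sin t| ^ q :=
    Real.continuous_sin.abs.rpow_const fun _ => Or.inr hq
  have h := tendsto_integral_mul_Q_rpow hsc hb (m := m) (by linarith)
  have e : G q m 1 (Real.pi / 2) = 2 * ∫ t in (0 : ℝ)..Real.pi,
      |Real.sin t| ^ q * (2 + 2 * Real.cos t) ^ m := by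
    rw [G, ← integral_symm_of_even]
    · congr 1
      funext t
      rw [Real.cos_sub_pi_div_two]
      congr 2
      ring
    · exact hsc.mul (Continuous.rpow_const (by fun_prop) fun _ => Or.inr hm)
    · intro t
      rw [Real.cos_neg, Real.sin_neg, abs_neg]
  have e2 : ∀ r, ∫ t in (0 : ℝ)..Real.pi, |Real.sin t| ^ q * Q r t ^ m = sinMean q m r := by
    intro r
    refine intervalIntegral.integral_congr fun t ht => ?_
    rw [uIcc_of_le Real.pi_pos.le] at ht
    simp only [abs_of_nonneg (Real.sin_nonneg_of_mem_Icc ht)]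
  simp only [e2] at h
  rw [e]
  have := (isLUB_of_monotoneOn_tendsto (monotoneOn_sinMean hq (m := m) (by positivity)) h).1
    (mem_image_of_mem _ hr)
  linarith

section

variable {α : ℝ} (hα : -1 < α) {p : ℝ≥0∞} (hp : 1 ≤ p) (h1 : p ≠ 1)

include hα hp h1

/-- Both means and the coefficient of the second increase with r, so the supremum is the limit at 1.
-/
lemma AConst_eq_AClosed (h4 : 4 < (2 + α) * conjExp p) : AConst α p = AClosed α p 0 := by
  have hq := conjExp_pos hp h1
  have hq1 := one_le_conjExp hp h1
  have hc := c_pos hα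
  have hm : 1 < halfExp α (conjExp p) := by rw [halfExp]; linarith
  have hα2 : 0 < α + 2 := by linarith
  refine (isLUB_of_monotoneOn_tendsto ?_ ?_).csSup_eq (image_Ico_nonempty _)
  · intro x hx y hy hxy
    rw [A_eq h1, A_eq h1]
    have hX := monotoneOn_I11 hq.le (by linarith : 1 / 2 ≤ halfExp α (conjExp p)) hx hy hxy
    have hY := monotoneOn_I12 α (conjExp p) hx hy hxy
    simp only at hY
    have hX0 := I11_nonneg α (conjExp p) x
    have hY0 := I12_pos hx α (conjExp p)
    have hπ := Real.pi_pos
    have hx0 := hx.1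
    have h2 : |α| * x ≤ |α| * y := by gcongr
    have h2' : 0 ≤ |α| * x := by positivity
    have h3 : (|α| * x + α + 2) ^ (conjExp p - 1) ≤ (|α| * y + α + 2) ^ (conjExp p - 1) :=
      Real.rpow_le_rpow (by linarith) (by linarith) (by linarith)
    have h4 : 0 ≤ (|α| * x + α + 2) ^ (conjExp p - 1) := Real.rpow_nonneg (by linarith) _
    have h5 : 0 ≤ (|α| * y + α + 2) ^ (conjExp p - 1) := h4.trans h3
    refine mul_le_mul_of_nonneg_left (Real.rpow_le_rpow (by positivity) ?_ (by positivity)) hc.le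
    have hy0 := hy.1
    refine add_le_add (by gcongr) ?_
    refine mul_le_mul ?_ hY hY0.le (by positivity)
    gcongr
  · have e : A α p = fun r => c α * ((α + 2) ^ conjExp p *
        (1 / (2 * Real.pi) * I11 α (conjExp p) r) +
      conjExp p * (|α| * r + α + 2) ^ (conjExp p - 1) * |α| * r *
        (1 / (2 * Real.pi) * I12 α (conjExp p) r)) ^ (1 / conjExp p) := funext (A_eq h1 α)
    rw [e, AClosed_eq]
    have hX := ((tendsto_I11 (α := α) hq.le (by linarith)).const_mul
      (1 / (2 * Real.pi))).const_mul ((α + 2) ^ conjExp p)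
    have hY := tendsto_I12 hα hq1
    have hcoef : ContinuousAt (fun r : ℝ =>
        conjExp p * (|α| * r + α + 2) ^ (conjExp p - 1) * |α| * r) 1 := by
      have : ContinuousAt (fun r : ℝ => (|α| * r + α + 2) ^ (conjExp p - 1)) 1 :=
        ContinuousAt.rpow_const (by fun_prop) (Or.inr (by linarith))
      fun_prop
    have hcoef' := hcoef.tendsto.mono_left (nhdsWithin_le_nhds (s := Iio 1))
    simp only [mul_one] at hcoef'
    exact ((hX.add (hcoef'.mul hY)).rpow_const (Or.inr (by positivity))).const_mul _

/-- The half exponent lies in [0,1], so the cosine mean is bounded by the sine mean, whose limit at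
1 is the shift θ = π/2. Changing the weight is why only an inequality results. -/
lemma AConst_le_AClosed (h2 : 2 ≤ (2 + α) * conjExp p) (h4 : (2 + α) * conjExp p ≤ 4) :
    AConst α p ≤ AClosed α p (Real.pi / 2) := by
  have hq := conjExp_pos hp h1
  have hm0 : 0 ≤ halfExp α (conjExp p) := by rw [halfExp]; linarith
  have hm1 : halfExp α (conjExp p) ≤ 1 := by rw [halfExp]; linarith
  refine csSup_le (image_Ico_nonempty _) (forall_mem_image.2 fun r hr => ?_)
  rw [AClosed_eq]
  refine A_le_of_I11_le hα hp h1 hr (mul_le_mul_of_nonneg_left ?_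
    (by have := Real.pi_pos; positivity))
  rw [I11_eq hr]
  refine (integral_cos_le_integral_sin hq.le hm0 hm1 hr).trans ?_
  rw [integral_abs_sin_rpow hr hq.le]
  exact two_mul_sinMean_le_G hq.le hm0 hr

end

/-! ### Comparison of the radial kernel with its bound -/

section

variable {α : ℝ} {r : ℝ} (hr : r ∈ Ico (0 : ℝ) 1)

include hr

/-- Stability of the weighted means under perturbation of the integrand. -/
lemma weightedMean_le_add {q R d : ℝ} (hq : 1 ≤ q) {x y : ℝ → ℝ} (hx : Continuous x)
    (hy : Continuous y) (hx0 : ∀ s, 0 ≤ x s) (hy0 : ∀ s, 0 ≤ y s) (hxR : ∀ s, x s ≤ R)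
    (hxy : ∀ s, |x s - y s| ≤ d) :
    (2 * Real.pi)⁻¹ * ∫ s in (0 : ℝ)..2 * Real.pi, x s ^ q * w r s ^ ((2 + α) * q - 2) ≤
      (2 * Real.pi)⁻¹ * (∫ s in (0 : ℝ)..2 * Real.pi, y s ^ q * w r s ^ ((2 + α) * q - 2)) +
        q * R ^ (q - 1) * d * (1 / (2 * Real.pi) * I12 α q r) := by
  have hq0 : 0 ≤ q := by linarith
  have hR : 0 ≤ R := (hx0 0).trans (hxR 0)
  have hI : I12 α q r = ∫ s in (0 : ℝ)..2 * Real.pi, w r s ^ ((2 + α) * q - 2) := by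
    rw [I12_eq hr]
    simp only [w_rpow_eq hr, halfExp]
  have hwi : IntervalIntegrable (fun s => w r s ^ ((2 + α) * q - 2)) volume 0 (2 * Real.pi) :=
    (continuous_w_rpow hr _).intervalIntegrable _ _
  have hint : ∀ {z : ℝ → ℝ}, Continuous z → IntervalIntegrable
      (fun s => z s ^ q * w r s ^ ((2 + α) * q - 2)) volume 0 (2 * Real.pi) := fun hz =>
    ((hz.rpow_const fun _ => Or.inr hq0).mul (continuous_w_rpow hr _)).intervalIntegrable _ _
  have h := intervalIntegral.integral_mono_on Real.two_pi_pos.le (hint hx)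
    ((hint hy).add (hwi.const_mul (q * R ^ (q - 1) * d))) fun s _ => by
      have h1 := rpow_le_rpow_add hq (hx0 s) (hxR s) (hy0 s)
      have h2 : q * R ^ (q - 1) * |x s - y s| ≤ q * R ^ (q - 1) * d := by
        have := hxy s
        gcongr
      have h3 : 0 ≤ w r s ^ ((2 + α) * q - 2) := Real.rpow_nonneg (w_pos hr s).le _
      calc _ ≤ (y s ^ q + q * R ^ (q - 1) * d) * w r s ^ ((2 + α) * q - 2) :=
            mul_le_mul_of_nonneg_right (by linarith) h3
        _ = _ := by ring
  rw [intervalIntegral.integral_add (hint hy) (hwi.const_mul _),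
    intervalIntegral.integral_const_mul, ← hI] at h
  have h4 := mul_le_mul_of_nonneg_left h (inv_nonneg.2 Real.two_pi_pos.le)
  refine h4.trans (le_of_eq ?_)
  ring

/-- The weighted mean of `|(α+2) cos s - α r|^q`. -/
lemma weightedMean_cos {q : ℝ} (hα : -1 < α) :
    (2 * Real.pi)⁻¹ * ∫ s in (0 : ℝ)..2 * Real.pi,
        |(α + 2) * Real.cos s| ^ q * w r s ^ ((2 + α) * q - 2) =
      (α + 2) ^ q * (1 / (2 * Real.pi) * I11 α q r) := by
  have hα2 : 0 ≤ α + 2 := by linarith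
  rw [I11_eq hr]
  simp only [abs_mul, abs_of_nonneg hα2, Real.mul_rpow hα2 (abs_nonneg _), w_rpow_eq hr,
    mul_assoc, intervalIntegral.integral_const_mul, ← halfExp.eq_1]
  ring

end

section

variable {α : ℝ} (hα : -1 < α) {p : ℝ≥0∞} (hp : 1 ≤ p) {r : ℝ} (hr : r ∈ Ico (0 : ℝ) 1)

include hα hr

lemma abs_radial_le (s : ℝ) : |(α + 2) * Real.cos s - α * r| ≤ |α| * r + α + 2 := by
  have h := abs_sub ((α + 2) * Real.cos s) (α * r)
  have hα2 : 0 ≤ α + 2 := by linarith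
  rw [abs_mul, abs_mul α, abs_of_nonneg hα2, abs_of_nonneg hr.1] at h
  nlinarith [mul_le_mul_of_nonneg_left (Real.abs_cos_le_one s) hα2]

lemma abs_cos_le (s : ℝ) : |(α + 2) * Real.cos s| ≤ |α| * r + α + 2 := by
  have hα2 : 0 ≤ α + 2 := by linarith
  have := mul_nonneg (abs_nonneg α) hr.1
  rw [abs_mul, abs_of_nonneg hα2]
  nlinarith [mul_le_mul_of_nonneg_left (Real.abs_cos_le_one s) hα2]

omit hα in
lemma abs_abs_radial_sub_le (s : ℝ) :
    abs (|(α + 2) * Real.cos s - α * r| - |(α + 2) * Real.cos s|) ≤ |α| * r := by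
  refine (abs_abs_sub_abs_le_abs_sub _ _).trans (le_of_eq ?_)
  rw [sub_sub_cancel_left, abs_neg, abs_mul, abs_of_nonneg hr.1]

include hp

lemma weightedNorm_radial_eq (h1 : p ≠ 1) : weightedNorm α p r (radialΦ α r) =
    c α * ((2 * Real.pi)⁻¹ * ∫ s in (0 : ℝ)..2 * Real.pi,
      |(α + 2) * Real.cos s - α * r| ^ conjExp p *
        w r s ^ ((2 + α) * conjExp p - 2)) ^ (1 / conjExp p) := by
  rw [show radialΦ α r = fun s => c α * |(α + 2) * Real.cos s - α * r| from rfl,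
    weightedNorm_const_mul hr hp (c_pos hα).le fun s => abs_nonneg _, weightedNorm, if_neg h1]

/-- Removing the shift αr changes the modulus by at most |α|r while both versions stay below R =
|α|r+α+2. The stability estimate with these data is exactly the second term of A; for p = 1 the
bound R alone is used. -/
lemma weightedNorm_radial_le : weightedNorm α p r (radialΦ α r) ≤ A α p r := by
  have hc := c_pos hα
  have hk := isMobiusKernel_radial hα hr
  by_cases h1 : p = 1
  · have h0 : 0 ≤ |α| * r + α + 2 := (abs_nonneg _).trans (abs_cos_le hα hr 0)
    rw [A, if_pos h1, ← mul_assoc, show (1 + r) ^ (α + 2) = weightNorm α p r from (if_pos h1).symm,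
      ← weightedNorm_const hα hr hp (mul_nonneg hc.le h0)]
    exact weightedNorm_mono hr hp hk.contΦ continuous_const hk.nonneg
      (fun s => mul_le_mul_of_nonneg_left (abs_radial_le hα hr s) hc.le) fun _ => rfl
  · have hq := conjExp_pos hp h1
    rw [weightedNorm_radial_eq hα hp hr h1, A_eq h1]
    refine mul_le_mul_of_nonneg_left (Real.rpow_le_rpow ?_ ?_ (by positivity)) hc.le
    · refine mul_nonneg (by have := Real.pi_pos; positivity)
        (intervalIntegral.integral_nonneg Real.two_pi_pos.le fun s _ => ?_)
      exact mul_nonneg (by positivity) (Real.rpow_nonneg (w_pos hr s).le _)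
    · rw [← weightedMean_cos hr hα, mul_assoc _ |α| r]
      exact weightedMean_le_add hr (one_le_conjExp hp h1) (by fun_prop) (by fun_prop)
        (fun s => abs_nonneg _) (fun s => abs_nonneg _) (abs_radial_le hα hr)
        (abs_abs_radial_sub_le hr)

/-- The error term in the comparison of `A_{α,p}(r)` with the best constant. -/
def radialError (α q : ℝ) : ℝ := q * (|α| + α + 2) ^ (q - 1) * |α| * gammaQuot α q

/-- The stability estimate with the two integrands exchanged, followed by subadditivity of the power
1/q ≤ 1. -/
lemma A_le_weightedNorm_add (h1 : p ≠ 1) : A α p r ≤ weightedNorm α p r (radialΦ α r) +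
    c α * (2 * radialError α (conjExp p)) ^ (1 / conjExp p) := by
  have hc := c_pos hα
  have hq := conjExp_pos hp h1
  have hq1 := one_le_conjExp hp h1
  have hX := weightedMean_le_add (α := α) (q := conjExp p) hr hq1
    (x := fun s => |(α + 2) * Real.cos s|) (y := fun s => |(α + 2) * Real.cos s - α * r|)
    (by fun_prop) (by fun_prop) (fun s => abs_nonneg _) (fun s => abs_nonneg _) (abs_cos_le hα hr)
    (fun s => by rw [abs_sub_comm]; exact abs_abs_radial_sub_le hr s)
  rw [weightedMean_cos hr hα] at hX
  have hA := A_le_of_I11_le hα hp h1 hr le_rfl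
  rw [weightedNorm_radial_eq hα hp hr h1, ← mul_add]
  set M := (2 * Real.pi)⁻¹ * ∫ s in (0 : ℝ)..2 * Real.pi,
    |(α + 2) * Real.cos s - α * r| ^ conjExp p * w r s ^ ((2 + α) * conjExp p - 2) with hM
  have hM0 : 0 ≤ M := by
    refine mul_nonneg (by have := Real.pi_pos; positivity)
      (intervalIntegral.integral_nonneg Real.two_pi_pos.le fun s _ => ?_)
    exact mul_nonneg (by positivity) (Real.rpow_nonneg (w_pos hr s).le _)
  have hY := I12_le hα hq1 hr
  have hY0 := (I12_pos hr α (conjExp p)).le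
  have h2 : |α| * r ≤ |α| := mul_le_of_le_one_right (abs_nonneg _) hr.2.le
  have hR : 0 ≤ |α| * r + α + 2 := (abs_nonneg _).trans (abs_cos_le hα hr 0)
  have hE : conjExp p * (|α| * r + α + 2) ^ (conjExp p - 1) * (|α| * r) *
      (1 / (2 * Real.pi) * I12 α (conjExp p) r) ≤ radialError α (conjExp p) := by
    rw [radialError]
    have h3 : (|α| * r + α + 2) ^ (conjExp p - 1) ≤ (|α| + α + 2) ^ (conjExp p - 1) :=
      Real.rpow_le_rpow hR (by linarith) (by linarith)
    have h4 : 0 ≤ (|α| * r + α + 2) ^ (conjExp p - 1) := Real.rpow_nonneg hR _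
    have h5 := h4.trans h3
    have h6 : 0 ≤ |α| * r := mul_nonneg (abs_nonneg _) hr.1
    gcongr
  have hE0 : 0 ≤ radialError α (conjExp p) := by
    refine le_trans ?_ hE
    have := hr.1
    positivity
  refine hA.trans (mul_le_mul_of_nonneg_left ?_ hc.le)
  -- One copy of the error is the second term in the bound for A; the other is the cost of restoring
  -- the shift.
  refine le_trans (Real.rpow_le_rpow ?_ (?_ : _ ≤ M + 2 * radialError α (conjExp p))
    (by positivity)) (Real.rpow_add_le_add_rpow hM0 (by positivity) (by positivity)
      ((div_le_one hq).2 hq1))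
  · have hα2 : 0 < α + 2 := by linarith
    have := mul_nonneg (one_div_nonneg.2 Real.two_pi_pos.le) (I11_nonneg α (conjExp p) r)
    rw [radialError] at hE0
    positivity
  · rw [radialError] at hE ⊢
    linarith

end

lemma tendsto_radialError {q : ℝ} (hq : 1 ≤ q) : Tendsto (fun α => (2 * radialError α q) ^ (1 / q))
    (𝓝 0) (𝓝 0) := by
  have hΓ : ∀ {x : ℝ}, 0 < x → ContinuousAt Real.Gamma x := fun {x} hx =>
    (Real.differentiableAt_Gamma fun m => by
      have : (0 : ℝ) ≤ m := m.cast_nonneg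
      linarith).continuousAt
  have h1 : ContinuousAt (fun α : ℝ => Real.Gamma ((α + 2) * q - 1)) 0 :=
    ContinuousAt.comp (f := fun α : ℝ => (α + 2) * q - 1) (hΓ (by linarith)) (by fun_prop)
  have h2 : ContinuousAt (fun α : ℝ => Real.Gamma ((α + 2) * q / 2)) 0 :=
    ContinuousAt.comp (f := fun α : ℝ => (α + 2) * q / 2) (hΓ (by linarith)) (by fun_prop)
  have h3 : ContinuousAt (fun α => gammaQuot α q) 0 :=
    h1.div (h2.pow 2) (pow_ne_zero 2 (Real.Gamma_pos_of_pos (by linarith)).ne')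
  have h4 : ContinuousAt (fun α : ℝ => (|α| + α + 2) ^ (q - 1)) 0 :=
    ContinuousAt.rpow_const (by fun_prop) (Or.inr (by linarith))
  have h5 : ContinuousAt (fun α => (2 * radialError α q) ^ (1 / q)) 0 := by
    refine ContinuousAt.rpow_const ?_ (Or.inr (by positivity))
    unfold radialError
    fun_prop
  have h6 := h5.tendsto
  rwa [show (2 * radialError 0 q) ^ (1 / q) = 0 by
    rw [radialError, abs_zero, mul_zero, zero_mul, mul_zero, Real.zero_rpow (by positivity)]] at h6

/-- The norm of `cos` in `L^q`, a lower bound for the best radial constant up to a factor. -/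
def cosNorm (p : ℝ≥0∞) : ℝ :=
  ((2 * Real.pi)⁻¹ * ∫ s in (0 : ℝ)..2 * Real.pi, |Real.cos s| ^ conjExp p) ^ (1 / conjExp p)

section

variable {p : ℝ≥0∞} (hp : 1 ≤ p)

include hp

lemma cosNorm_pos (h1 : p ≠ 1) : 0 < cosNorm p := by
  have hq := conjExp_pos hp h1
  refine Real.rpow_pos_of_pos (mul_pos (inv_pos.2 Real.two_pi_pos) ?_) _
  exact intervalIntegral.integral_pos Real.two_pi_pos (continuous_abs_cos_rpow hq.le).continuousOn
    (fun s _ => by positivity) ⟨0, ⟨le_rfl, Real.two_pi_pos.le⟩, by simp⟩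

/-- At r = 0 both the shift and the weight disappear. The value bounds every admissible constant
from below, which converts the additive error into a multiplicative one. -/
lemma weightedNorm_radial_zero (h1 : p ≠ 1) {α : ℝ} (hα : -1 < α) :
    weightedNorm α p 0 (radialΦ α 0) = c α * ((α + 2) * cosNorm p) := by
  have hq := conjExp_pos hp h1
  have hα2 : 0 ≤ α + 2 := by linarith
  have hw : ∀ s, w 0 s = 1 := fun s => by simp [w]
  have hI : 0 ≤ (2 * Real.pi)⁻¹ * ∫ s in (0 : ℝ)..2 * Real.pi, |Real.cos s| ^ conjExp p :=
    mul_nonneg (inv_nonneg.2 Real.two_pi_pos.le)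
      (intervalIntegral.integral_nonneg Real.two_pi_pos.le fun s _ => by positivity)
  rw [weightedNorm_radial_eq hα hp ⟨le_rfl, zero_lt_one⟩ h1, cosNorm]
  simp only [hw, Real.one_rpow, mul_one, mul_zero, sub_zero, abs_mul, abs_of_nonneg hα2,
    Real.mul_rpow hα2 (abs_nonneg _), intervalIntegral.integral_const_mul]
  rw [mul_left_comm, Real.mul_rpow (by positivity) hI, ← Real.rpow_mul hα2,
    mul_one_div_cancel hq.ne', Real.rpow_one]

lemma AConst_mem_admissible {α : ℝ} (hα : -1 < α) : AConst α p ∈ Admissible dR α p :=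
  fun _ hf _ hr θ => (hasMobiusKernel_dR hα).norm_le hp hf hr θ
    ((weightedNorm_radial_le hα hp hr).trans ((isLUB_A hα hp).1 (mem_image_of_mem _ hr)))

lemma AConst_le_add (h1 : p ≠ 1) {α : ℝ} (hα : -1 < α) {N : ℝ} (hN : N ∈ Admissible dR α p) :
    AConst α p ≤ N + c α * (2 * radialError α (conjExp p)) ^ (1 / conjExp p) :=
  (isLUB_A hα hp).2 (forall_mem_image.2 fun _ hr => (A_le_weightedNorm_add hα hp hr h1).trans
    (add_le_add_left ((hasMobiusKernel_dR hα).weightedNorm_le hp hN hr) _))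

-- The kernel at s = 0, where the weight is largest, in the limit r → 1.
omit hp in
lemma le_of_mem_admissible_one {α : ℝ} (hα : -1 < α) {N : ℝ} (hN : N ∈ Admissible dR α 1) :
    c α * ((α + 2 - |α|) * 2 ^ (α + 2)) ≤ N := by
  have hc := c_pos hα
  have h : ContinuousAt (fun r : ℝ => c α * ((α + 2 - |α|) * (1 + r) ^ (α + 2))) 1 := by
    have h1 : ContinuousAt (fun r : ℝ => (1 + r) ^ (α + 2)) 1 :=
      ContinuousAt.rpow_const (by fun_prop) (Or.inl (by norm_num))
    fun_prop
  have h2 := h.tendsto.mono_left (nhdsWithin_le_nhds (s := Iio 1))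
  norm_num at h2
  refine le_of_tendsto h2 ?_
  filter_upwards [eventually_mem_Ico] with r hr
  refine le_trans ?_ ((hasMobiusKernel_dR hα).weightedNorm_le le_rfl hN hr)
  rw [weightedNorm, if_pos rfl]
  refine le_trans ?_ (le_ciSup ((isMobiusKernel_radial hα hr).bddAbove hr) 0)
  rw [w_zero hr.1, radialΦ, Real.cos_zero, mul_one, ← mul_assoc]
  have h3 : α * r ≤ |α| := (mul_le_mul_of_nonneg_right (le_abs_self α) hr.1).trans
    (mul_le_of_le_one_right (abs_nonneg _) hr.2.le)
  have h4 : α + 2 - |α| ≤ |α + 2 - α * r| := by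
    linarith [le_abs_self (α + 2 - α * r)]
  have h5 : 0 ≤ (1 + r) ^ (α + 2) := Real.rpow_nonneg (by linarith [hr.1]) _
  gcongr

lemma isAsymptoticallySharp_dR : IsAsymptoticallySharp dR p fun α => AConst α p := by
  have hnear : ∀ᶠ α : ℝ in 𝓝 0, -1 < α := eventually_gt_nhds (by norm_num)
  by_cases h1 : p = 1
  · subst h1
    refine ⟨⟨AConst_mem_admissible hp (by norm_num), fun N hN => ?_⟩, fun ε hε => ?_⟩
    · have h := le_of_mem_admissible_one (by norm_num) hN
      simp only
      rw [AConst_one (by norm_num)]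
      simpa using h
    -- The value at α = 0 is 2ε > 0, so the ratio of the two bounds stays below 1+ε nearby.
    · have hcont : ContinuousAt (fun α : ℝ => (1 + ε) * (α + 2 - |α|) - (|α| + α + 2)) 0 := by
        fun_prop
      filter_upwards [hnear, hcont.eventually (lt_mem_nhds (a := 0) (by norm_num; linarith))]
        with α hα hlt
      refine ⟨AConst_mem_admissible hp hα, fun N hN => ?_⟩
      have hc := c_pos hα
      refine le_trans ?_ (mul_le_mul_of_nonneg_left (le_of_mem_admissible_one hα hN)
        (by positivity))
      rw [AConst_one hα]
      calc c α * ((|α| + α + 2) * 2 ^ (α + 2))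
          ≤ c α * (((1 + ε) * (α + 2 - |α|)) * 2 ^ (α + 2)) := by
            have : |α| + α + 2 ≤ (1 + ε) * (α + 2 - |α|) := by linarith
            gcongr
        _ = _ := by ring
  · have hq := conjExp_pos hp h1
    refine ⟨⟨AConst_mem_admissible hp (by norm_num), fun N hN => ?_⟩, fun ε hε => ?_⟩
    · have h := AConst_le_add hp h1 (by norm_num) hN
      rwa [radialError, abs_zero, mul_zero, zero_mul, mul_zero, Real.zero_rpow (by positivity),
        mul_zero, add_zero] at h
    · have hκ := cosNorm_pos hp h1
      -- The error is measured against the lower bound from r = 0, in which α+2 ≥ 1.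
      have hsmall := (tendsto_radialError (one_le_conjExp hp h1)).eventually
        (gt_mem_nhds (show 0 < ε * cosNorm p by positivity))
      filter_upwards [hnear, hsmall] with α hα hlt
      refine ⟨AConst_mem_admissible hp hα, fun N hN => ?_⟩
      have hc := c_pos hα
      have hN0 := (hasMobiusKernel_dR hα).weightedNorm_le hp hN ⟨le_rfl, zero_lt_one⟩
      rw [weightedNorm_radial_zero hp h1 hα] at hN0
      refine (AConst_le_add hp h1 hα hN).trans ?_
      rw [add_mul, one_mul]
      refine add_le_add le_rfl ?_
      calc c α * (2 * radialError α (conjExp p)) ^ (1 / conjExp p)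
          ≤ c α * (ε * cosNorm p) := by gcongr
        _ ≤ ε * (c α * ((α + 2) * cosNorm p)) := by
            have : 1 * cosNorm p ≤ (α + 2) * cosNorm p := by
              gcongr
              linarith
            nlinarith [mul_le_mul_of_nonneg_left this (mul_nonneg hε.le hc.le)]
        _ ≤ ε * N := by gcongr

end

end AlphaHarmonic

end

/-! ### The theorem. -/

open AlphaHarmonic in
theorem theorem1p7 (p : ℝ≥0∞) (hp : 1 ≤ p) :
    (∀ α : ℝ, -1 < α →
      -- the suprema over `0 ≤ r < 1` are finite, with the stated values
      IsLUB (A α p '' Ico 0 1) (AConst α p) ∧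
      (p = 1 → AConst α p = c α * ((|α| + α + 2) * 2 ^ (α + 2))) ∧
      (p ≠ 1 → 4 < (2 + α) * conjExp p → AConst α p = AClosed α p 0) ∧
      (p ≠ 1 → 2 ≤ (2 + α) * conjExp p → (2 + α) * conjExp p ≤ 4 →
        AConst α p ≤ AClosed α p (Real.pi / 2)) ∧
      (0 ≤ α + 2 * (p⁻¹).toReal → IsLUB (B α p '' Ico 0 1) (BConst α p)) ∧
      IsLUB (C α p '' Ico 0 1) (CConst α p) ∧
      -- the pointwise estimates
      (∀ f : Circle → ℂ, MemLpT f p →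
        DifferentiableOn ℝ (P α f) (Metric.ball 0 1) ∧
        ∀ r ∈ Ico (0 : ℝ) 1, ∀ θ : ℝ,
          (‖dR (P α f) r θ‖ ≤ A α p r / (1 - r ^ 2) ^ growthExp p * normLpT f p ∧
            A α p r / (1 - r ^ 2) ^ growthExp p * normLpT f p
              ≤ AConst α p / (1 - r ^ 2) ^ growthExp p * normLpT f p) ∧
          (‖dTheta (P α f) r θ‖ ≤ B α p r / (1 - r ^ 2) ^ growthExp p * normLpT f p ∧
            (0 ≤ α + 2 * (p⁻¹).toReal →
              B α p r / (1 - r ^ 2) ^ growthExp p * normLpT f p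
                ≤ BConst α p / (1 - r ^ 2) ^ growthExp p * normLpT f p)) ∧
          (‖dZ (P α f) r θ‖ ≤ C α p r / (1 - r ^ 2) ^ growthExp p * normLpT f p ∧
            ‖dZbar (P α f) r θ‖ ≤ C α p r / (1 - r ^ 2) ^ growthExp p * normLpT f p ∧
            C α p r / (1 - r ^ 2) ^ growthExp p * normLpT f p
              ≤ CConst α p / (1 - r ^ 2) ^ growthExp p * normLpT f p)) ∧
      -- sharpness in the estimate of the angular derivative
      (0 ≤ α + 2 * (p⁻¹).toReal → IsSharp dTheta α p (BConst α p))) ∧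
    -- asymptotic sharpness of the other constants
    IsAsymptoticallySharp dR p (fun α => AConst α p) ∧
    IsAsymptoticallySharp dZ p (fun α => CConst α p) ∧
    IsAsymptoticallySharp dZbar p (fun α => CConst α p) := by
  refine ⟨fun α hα => ⟨isLUB_A hα hp, ?_, fun h1 => AConst_eq_AClosed hα hp h1,
    fun h1 => AConst_le_AClosed hα hp h1, isLUB_B hα hp, isLUB_C hα hp, fun f hf => ⟨?_, ?_⟩,
    isSharp_dTheta hα hp⟩, isAsymptoticallySharp_dR hp,
    isAsymptoticallySharp_wirtinger (fun _ => hasMobiusKernel_dZ) hp,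
    isAsymptoticallySharp_wirtinger (fun _ => hasMobiusKernel_dZbar) hp⟩
  · rintro rfl
    exact AConst_one hα
  · intro z hz
    exact (hasFDerivAt_P α (hf.integrable hp) (by simpa using hz)).differentiableAt
      |>.differentiableWithinAt
  · intro r hr θ
    have hr2 := one_sub_sq_pos hr
    have hn := normLpT_nonneg f p
    have hmono : ∀ {a b : ℝ}, a ≤ b → a / (1 - r ^ 2) ^ growthExp p * normLpT f p ≤
        b / (1 - r ^ 2) ^ growthExp p * normLpT f p := fun h => by gcongr
    have hmem : ∀ {g : ℝ → ℝ}, g r ∈ g '' Ico 0 1 := mem_image_of_mem _ hr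
    exact ⟨⟨(hasMobiusKernel_dR hα).norm_le hp hf hr θ (weightedNorm_radial_le hα hp hr),
        hmono ((isLUB_A hα hp).1 hmem)⟩,
      ⟨(hasMobiusKernel_dTheta hα).norm_le hp hf hr θ (weightedNorm_angular hα hp hr).le,
        fun h => hmono ((isLUB_B hα hp h).1 hmem)⟩,
      (hasMobiusKernel_dZ hα).norm_le hp hf hr θ (weightedNorm_wirtinger_le hα hp hr),
      (hasMobiusKernel_dZbar hα).norm_le hp hf hr θ (weightedNorm_wirtinger_le hα hp hr),
      hmono ((isLUB_C hα hp).1 hmem)⟩
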